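/- A *JB\*-algebra* is a complex Banach space $\mathcal{M}$ that is a complex Jordan algebra, with product $\circ$, equipped with a conjugate-linear involution $*$ such that $\|x\circ y\|\le\|x\|\|y\|$, $\|x^*\|=\|x\|$ and $\|\{x,x^*,x\}\|=\|x\|^3$ for all $x,y\in\mathcal{M}$, where $\{x,y,z\}=(x\circ y)\circ z+(y\circ z)\circ x-(x\circ z)\circ y$. A *JBW\*-algebra* is a JB\*-algebra that is isometrically isomorphic to the dual of a Banach space $\mathcal{M}_*$ (its predual), which is identified with a subspace of $\mathcal{M}^*$. A *normal faithful state* on $\mathcal{M}$ is a functional $\varphi\in\mathcal{M}_*$ with $\|\varphi\|=1$, $\varphi(a)\ge 0$ for each positive $a$, and $\varphi(a)=0$ for a positive $a$ only if $a=0$; here $a$ is positive if $a=b\circ b$ for some $b=b^*\in\mathcal{M}$. For an interpolation couple $(X_0,X_1)$ of complex Banach spaces, let $\mathscr{F}(X_0,X_1)$ be the space of bounded continuous functions $f$ from the strip $0\le\operatorname{Re}z\le1$ to $X_0+X_1$, holomorphic on $0<\operatorname{Re}z<1$, such that $t\mapsto f(it)$ and $t\mapsto f(1+it)$ are continuous functions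 $\mathbb{R}\to X_0$ and $\mathbb{R}\to X_1$ tending to $0$ at infinity, with norm $\|f\|_{\mathscr F}=\max\{\sup_t\|f(it)\|_{X_0},\sup_t\|f(1+it)\|_{X_1}\}$; for $0\le\theta\le1$ put $(X_0,X_1)_\theta=\{f(\theta):f\in\mathscr{F}(X_0,X_1)\}$ with norm $\|x\|=\inf\{\|f\|_{\mathscr F}: f(\theta)=x\}$. Let $\mathcal{M}$ be a JBW\*-algebra with a normal faithful state $\varphi$. Regard $(\mathcal{M},\mathcal{M}_*)$ as an interpolation couple through the embedding $x\mapsto\varphi_x$, $\varphi_x(y)=\varphi(x\circ y)$, by which $\mathcal{M}$ is identified with a space of functionals on $\mathcal M$, and for $1<p<\infty$ let $\mathrm{L}^p(\mathcal{M},\varphi)=(\mathcal{M},\mathcal{M}_*)_{1/p}$. Let $\mathcal{H}_\varphi$ be the Hilbert space completion of $\mathcal{M}$ for the inner product $\langle x,y\rangle=\varphi(x^*\circ y)$. 1. $\mathcal{M}\subset\mathrm{L}^2(\mathcal{M},\varphi)$, and there is a linear surjective isometry $\mathrm{L}^2(\mathcal{M},\varphi)\to\mathcal{H}_\varphi$ that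 is the identity on $\mathcal{M}$. In particular the norms of $\mathrm{L}^2(\mathcal{M},\varphi)$ and $\mathcal{H}_\varphi$ coincide on $\mathcal{M}$. 2. Let $1<p<\infty$ and $\frac1p+\frac1{p^*}=1$. Then $(\mathrm{L}^p(\mathcal{M},\varphi))^*=\mathrm{L}^{p^*}(\mathcal{M},\varphi)$ isometrically: $\mathcal{M}\subset\mathrm{L}^{p^*}(\mathcal{M},\varphi)$, and there is a linear surjective isometry $D:\mathrm{L}^{p^*}(\mathcal{M},\varphi)\to(\mathrm{L}^p(\mathcal{M},\varphi))^*$ such that $D(y)(h)=h(y)$ for all $y\in\mathcal{M}$ and all $h\in\mathrm{L}^p(\mathcal{M},\varphi)\subset\mathcal{M}_*$; in particular $D(y)(x)=\varphi(x\circ y)$ for $x,y\in\mathcal{M}$. -/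

import Mathlib

noncomputable section

open scoped ZeroAtInfty

/-! ### Complex interpolation -/

/-- An interpolation couple: two complex normed spaces `X₀`, `X₁` that embed continuously into a
common space `V`. -/
structure InterpolationCouple (X₀ X₁ V : Type*) [NormedAddCommGroup X₀] [NormedSpace ℂ X₀]
    [NormedAddCommGroup X₁] [NormedSpace ℂ X₁] [NormedAddCommGroup V] [NormedSpace ℂ V] where
  left : X₀ →L[ℂ] V
  right : X₁ →L[ℂ] V
  left_injective : Function.Injective left
  right_injective : Function.Injective right

namespace InterpolationCouple

variable {X₀ X₁ V : Type*} [NormedAddCommGroup X₀] [NormedSpace ℂ X₀]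
  [NormedAddCommGroup X₁] [NormedSpace ℂ X₁] [NormedAddCommGroup V] [NormedSpace ℂ V]

/-- The map `(x₀, x₁) ↦ x₀ + x₁` on the `ℓ¹`-direct sum. -/
def addMap (c : InterpolationCouple X₀ X₁ V) : WithLp 1 (X₀ × X₁) →L[ℂ] V :=
  (c.left.coprod c.right).comp (WithLp.prodContinuousLinearEquiv 1 ℂ X₀ X₁ : _ →L[ℂ] X₀ × X₁)

/-- The sum `X₀ + X₁`, realized as the quotient of the `ℓ¹`-direct sum of `X₀` and `X₁` by
`{(x₀, x₁) | x₀ + x₁ = 0 in V}`. The quotient norm is `inf {‖x₀‖ + ‖x₁‖ | x = x₀ + x₁}`. -/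
abbrev Sum (c : InterpolationCouple X₀ X₁ V) : Type _ :=
  WithLp 1 (X₀ × X₁) ⧸ c.addMap.ker

instance isClosed_ker_addMap (c : InterpolationCouple X₀ X₁ V) :
    IsClosed (c.addMap.ker : Set (WithLp 1 (X₀ × X₁))) :=
  c.addMap.isClosed_ker

/-- The inclusion `X₀ + X₁ ⊆ V`. -/
def toAmbient (c : InterpolationCouple X₀ X₁ V) : c.Sum →ₗ[ℂ] V :=
  c.addMap.ker.liftQ c.addMap.toLinearMap le_rfl

/-- The inclusion `X₀ ⊆ X₀ + X₁`. -/
def inl (c : InterpolationCouple X₀ X₁ V) (x : X₀) : c.Sum :=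
  c.addMap.ker.mkQ (WithLp.toLp 1 (x, 0))

/-- The inclusion `X₁ ⊆ X₀ + X₁`. -/
def inr (c : InterpolationCouple X₀ X₁ V) (x : X₁) : c.Sum :=
  c.addMap.ker.mkQ (WithLp.toLp 1 (0, x))

/-- The family `𝓕(X₀, X₁)`: bounded continuous functions from the closed strip `0 ≤ Re z ≤ 1` to
`X₀ + X₁`, holomorphic in the open strip, whose boundary values `t ↦ f (i t)` and
`t ↦ f (1 + i t)` are continuous functions `ℝ → X₀` and `ℝ → X₁` tending to `0` at infinity.
The values of `toFun` outside of the closed strip are irrelevant. -/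
structure StripFunction (c : InterpolationCouple X₀ X₁ V) where
  toFun : ℂ → c.Sum
  continuousOn : ContinuousOn toFun {z : ℂ | 0 ≤ z.re ∧ z.re ≤ 1}
  bounded : ∃ C : ℝ, ∀ z : ℂ, 0 ≤ z.re → z.re ≤ 1 → ‖toFun z‖ ≤ C
  holomorphic : DifferentiableOn ℂ toFun {z : ℂ | 0 < z.re ∧ z.re < 1}
  leftBoundary : C₀(ℝ, X₀)
  rightBoundary : C₀(ℝ, X₁)
  left_eq : ∀ t : ℝ, toFun (t * Complex.I) = c.inl (leftBoundary t)
  right_eq : ∀ t : ℝ, toFun (1 + t * Complex.I) = c.inr (rightBoundary t)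

/-- The norm of `𝓕(X₀, X₁)`: the maximum of the two suprema
`sup ‖f (i t)‖` in `X₀` and `sup ‖f (1 + i t)‖` in `X₁`. -/
def StripFunction.norm {c : InterpolationCouple X₀ X₁ V} (f : c.StripFunction) : ℝ :=
  max ‖f.leftBoundary‖ ‖f.rightBoundary‖

theorem inl_add (c : InterpolationCouple X₀ X₁ V) (x y : X₀) :
    c.inl (x + y) = c.inl x + c.inl y := by
  unfold inl
  rw [← map_add, ← WithLp.toLp_add]
  simp

theorem inr_add (c : InterpolationCouple X₀ X₁ V) (x y : X₁) :
    c.inr (x + y) = c.inr x + c.inr y := by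
  unfold inr
  rw [← map_add, ← WithLp.toLp_add]
  simp

theorem inl_smul (c : InterpolationCouple X₀ X₁ V) (a : ℂ) (x : X₀) :
    c.inl (a • x) = a • c.inl x := by
  unfold inl
  rw [← map_smul, ← WithLp.toLp_smul]
  simp

theorem inr_smul (c : InterpolationCouple X₀ X₁ V) (a : ℂ) (x : X₁) :
    c.inr (a • x) = a • c.inr x := by
  unfold inr
  rw [← map_smul, ← WithLp.toLp_smul]
  simp

theorem norm_inl_le (c : InterpolationCouple X₀ X₁ V) (x : X₀) : ‖c.inl x‖ ≤ ‖x‖ := by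
  refine (Submodule.Quotient.norm_mk_le _ _).trans ?_
  rw [WithLp.prod_norm_eq_of_L1]
  simp

theorem norm_inr_le (c : InterpolationCouple X₀ X₁ V) (x : X₁) : ‖c.inr x‖ ≤ ‖x‖ := by
  refine (Submodule.Quotient.norm_mk_le _ _).trans ?_
  rw [WithLp.prod_norm_eq_of_L1]
  simp

namespace StripFunction

variable {c : InterpolationCouple X₀ X₁ V}

/-- Scalar multiples of strip functions. -/
def smul (a : ℂ) (f : c.StripFunction) : c.StripFunction where
  toFun z := a • f.toFun z
  continuousOn := f.continuousOn.const_smul a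
  bounded := by
    obtain ⟨C, hC⟩ := f.bounded
    refine ⟨‖a‖ * C, fun z h0 h1 => ?_⟩
    rw [norm_smul]
    exact mul_le_mul_of_nonneg_left (hC z h0 h1) (norm_nonneg a)
  holomorphic := f.holomorphic.const_smul a
  leftBoundary := a • f.leftBoundary
  rightBoundary := a • f.rightBoundary
  left_eq t := by rw [f.left_eq, ← inl_smul]; rfl
  right_eq t := by rw [f.right_eq, ← inr_smul]; rfl

/-- Sums of strip functions. -/
def add (f g : c.StripFunction) : c.StripFunction where
  toFun z := f.toFun z + g.toFun z
  continuousOn := f.continuousOn.add g.continuousOn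
  bounded := by
    obtain ⟨C, hC⟩ := f.bounded
    obtain ⟨D, hD⟩ := g.bounded
    exact ⟨C + D, fun z h0 h1 =>
      (norm_add_le _ _).trans (add_le_add (hC z h0 h1) (hD z h0 h1))⟩
  holomorphic := f.holomorphic.add g.holomorphic
  leftBoundary := f.leftBoundary + g.leftBoundary
  rightBoundary := f.rightBoundary + g.rightBoundary
  left_eq t := by rw [f.left_eq, g.left_eq, ← inl_add]; rfl
  right_eq t := by rw [f.right_eq, g.right_eq, ← inr_add]; rfl

/-- The zero strip function. -/
def zero (c : InterpolationCouple X₀ X₁ V) : c.StripFunction where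
  toFun _ := 0
  continuousOn := continuousOn_const
  bounded := ⟨0, by simp⟩
  holomorphic := differentiableOn_const 0
  leftBoundary := 0
  rightBoundary := 0
  left_eq t := by simpa using (inl_smul c 0 0).symm
  right_eq t := by simpa using (inr_smul c 0 0).symm

theorem norm_nonneg (f : c.StripFunction) : 0 ≤ f.norm :=
  le_max_of_le_left (_root_.norm_nonneg _)

theorem norm_add_le (f g : c.StripFunction) : (f.add g).norm ≤ f.norm + g.norm :=
  max_le
    ((_root_.norm_add_le _ _).trans (add_le_add (le_max_left _ _) (le_max_left _ _)))
    ((_root_.norm_add_le _ _).trans (add_le_add (le_max_right _ _) (le_max_right _ _)))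

theorem norm_smul_eq (a : ℂ) (f : c.StripFunction) : (f.smul a).norm = ‖a‖ * f.norm := by
  show max ‖a • f.leftBoundary‖ ‖a • f.rightBoundary‖ = _
  rw [_root_.norm_smul, _root_.norm_smul, ← mul_max_of_nonneg _ _ (_root_.norm_nonneg a)]
  rfl

/-- The three lines estimate. -/
theorem norm_apply_le (f : c.StripFunction) (z : ℂ) (h0 : 0 ≤ z.re) (h1 : z.re ≤ 1) :
    ‖f.toFun z‖ ≤ f.norm := by
  have hcl : closure (Complex.HadamardThreeLines.verticalStrip 0 1) =
      {z : ℂ | 0 ≤ z.re ∧ z.re ≤ 1} := by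
    rw [Complex.HadamardThreeLines.verticalStrip, Complex.closure_preimage_re,
      closure_Ioo zero_ne_one]
    rfl
  have hd : DiffContOnCl ℂ f.toFun (Complex.HadamardThreeLines.verticalStrip 0 1) :=
    ⟨f.holomorphic, hcl ▸ f.continuousOn⟩
  have hB : BddAbove ((Norm.norm ∘ f.toFun) ''
      Complex.HadamardThreeLines.verticalClosedStrip 0 1) := by
    obtain ⟨C, hC⟩ := f.bounded
    refine ⟨C, ?_⟩
    rintro _ ⟨w, hw, rfl⟩
    exact hC w hw.1 hw.2
  have ha : ∀ w ∈ Complex.re ⁻¹' {(0 : ℝ)}, ‖f.toFun w‖ ≤ f.norm := by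
    intro w hw
    have hw' : w = (w.im : ℂ) * Complex.I := by
      apply Complex.ext <;> simp
      exact hw
    rw [hw', f.left_eq]
    exact (norm_inl_le c _).trans
      ((f.leftBoundary.toBCF.norm_coe_le_norm w.im).trans (le_max_left _ _))
  have hb : ∀ w ∈ Complex.re ⁻¹' {(1 : ℝ)}, ‖f.toFun w‖ ≤ f.norm := by
    intro w hw
    have hw' : w = 1 + (w.im : ℂ) * Complex.I := by
      apply Complex.ext <;> simp
      exact hw
    rw [hw', f.right_eq]
    exact (norm_inr_le c _).trans
      ((f.rightBoundary.toBCF.norm_coe_le_norm w.im).trans (le_max_right _ _))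
  have h := Complex.HadamardThreeLines.norm_le_interp_of_mem_verticalClosedStrip'
    zero_lt_one (z := z) ⟨h0, h1⟩ hd hB ha hb
  refine h.trans (le_of_eq ?_)
  rw [← Real.rpow_add_of_nonneg f.norm_nonneg (by simpa using h1) (by simpa using h0)]
  simp

end StripFunction

/-- `(X₀, X₁)_θ = {f(θ) | f ∈ 𝓕(X₀, X₁)}` as a subspace of `X₀ + X₁`. -/
def interpolationSubmodule (c : InterpolationCouple X₀ X₁ V) (θ : Set.Icc (0 : ℝ) 1) :
    Submodule ℂ c.Sum where
  carrier := {x | ∃ f : c.StripFunction, f.toFun ((θ : ℝ) : ℂ) = x}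
  add_mem' := by
    rintro _ _ ⟨f, rfl⟩ ⟨g, rfl⟩
    exact ⟨f.add g, rfl⟩
  zero_mem' := ⟨StripFunction.zero c, rfl⟩
  smul_mem' := by
    rintro a _ ⟨f, rfl⟩
    exact ⟨f.smul a, rfl⟩

/-- The complex interpolation space `(X₀, X₁)_θ`. It is a type of its own because its norm is not
the one inherited from `X₀ + X₁`. -/
def Interpolation (c : InterpolationCouple X₀ X₁ V) (θ : Set.Icc (0 : ℝ) 1) : Type _ :=
  c.interpolationSubmodule θ

namespace Interpolation

variable {c : InterpolationCouple X₀ X₁ V} {θ : Set.Icc (0 : ℝ) 1}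

instance : AddCommGroup (c.Interpolation θ) :=
  inferInstanceAs (AddCommGroup (c.interpolationSubmodule θ))

instance : Module ℂ (c.Interpolation θ) :=
  inferInstanceAs (Module ℂ (c.interpolationSubmodule θ))

/-- The inclusion `(X₀, X₁)_θ ⊆ X₀ + X₁`. -/
def toSum : c.Interpolation θ →ₗ[ℂ] c.Sum :=
  (c.interpolationSubmodule θ).subtype

/-- The norm `‖x‖ = inf {‖f‖ | f ∈ 𝓕(X₀, X₁), f(θ) = x}`. -/
instance : Norm (c.Interpolation θ) where
  norm x := sInf {r | ∃ f : c.StripFunction, f.toFun ((θ : ℝ) : ℂ) = toSum x ∧ r = f.norm}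

theorem norm_le (x : c.Interpolation θ) (f : c.StripFunction)
    (hf : f.toFun ((θ : ℝ) : ℂ) = toSum x) : ‖x‖ ≤ f.norm :=
  csInf_le ⟨0, by rintro _ ⟨g, _, rfl⟩; exact g.norm_nonneg⟩ ⟨f, hf, rfl⟩

theorem le_norm (x : c.Interpolation θ) (r : ℝ)
    (h : ∀ f : c.StripFunction, f.toFun ((θ : ℝ) : ℂ) = toSum x → r ≤ f.norm) : r ≤ ‖x‖ := by
  obtain ⟨f, hf⟩ := x.2
  refine le_csInf ⟨f.norm, f, hf, rfl⟩ ?_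
  rintro _ ⟨g, hg, rfl⟩
  exact h g hg

theorem norm_smul_le (a : ℂ) (x : c.Interpolation θ) : ‖a • x‖ ≤ ‖a‖ * ‖x‖ := by
  rcases eq_or_ne a 0 with rfl | ha
  · rw [zero_smul, norm_zero, zero_mul]
    refine (norm_le 0 (StripFunction.zero c) (by rw [map_zero]; rfl)).trans (le_of_eq ?_)
    simp [StripFunction.norm, StripFunction.zero]
  · have hpos : 0 < ‖a‖ := norm_pos_iff.mpr ha
    rw [← div_le_iff₀' hpos]
    refine le_norm x _ fun f hf => ?_
    rw [div_le_iff₀' hpos, ← StripFunction.norm_smul_eq]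
    exact norm_le _ (f.smul a) (by rw [map_smul, ← hf]; rfl)

theorem core : NormedSpace.Core ℂ (c.Interpolation θ) where
  norm_nonneg x := le_norm x 0 fun f _ => f.norm_nonneg
  norm_smul a x := by
    refine le_antisymm (norm_smul_le a x) ?_
    rcases eq_or_ne a 0 with rfl | ha
    · rw [norm_zero, zero_mul]
      exact le_norm _ 0 fun f _ => f.norm_nonneg
    · have hpos : 0 < ‖a‖ := norm_pos_iff.mpr ha
      have h := norm_smul_le a⁻¹ (a • x)
      rw [smul_smul, inv_mul_cancel₀ ha, one_smul, norm_inv] at h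
      rwa [← div_eq_inv_mul, le_div_iff₀' hpos] at h
  norm_triangle x y := by
    rw [← sub_le_iff_le_add']
    refine le_norm y _ fun g hg => ?_
    rw [sub_le_iff_le_add', ← sub_le_iff_le_add]
    refine le_norm x _ fun f hf => ?_
    rw [sub_le_iff_le_add]
    exact (norm_le (x + y) (f.add g) (by rw [map_add, ← hf, ← hg]; rfl)).trans
      (f.norm_add_le g)
  norm_eq_zero_iff x := by
    constructor
    · intro h
      have h1 : ‖toSum x‖ ≤ 0 := h ▸ le_norm x _ fun f hf => by
        rw [← hf]
        exact f.norm_apply_le _ (by simpa using θ.2.1) (by simpa using θ.2.2)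
      exact Subtype.ext (norm_le_zero_iff.mp h1)
    · rintro rfl
      refine le_antisymm ?_ (le_norm 0 0 fun f _ => f.norm_nonneg)
      simpa using norm_smul_le (0 : ℂ) (0 : c.Interpolation θ)

instance : NormedAddCommGroup (c.Interpolation θ) := NormedAddCommGroup.ofCore core

instance : NormedSpace ℂ (c.Interpolation θ) := NormedSpace.ofCore core

end Interpolation

end InterpolationCouple

/-! ### JBW*-algebras -/

/-- The Jordan triple product `{x, y, z} = (x ∘ y) ∘ z + (y ∘ z) ∘ x - (x ∘ z) ∘ y`; the Jordan
product `∘` is written `*`. -/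
def jordanTriple {M : Type*} [NonUnitalNonAssocRing M] (x y z : M) : M :=
  (x * y) * z + (y * z) * x - (x * z) * y

/-- JB*-algebras: complex Banach spaces with the structure of a complex Jordan algebra (with
product written `*`) and a conjugate-linear involution (written `star`) such that
`‖x ∘ y‖ ≤ ‖x‖ ‖y‖`, `‖x*‖ = ‖x‖` and `‖{x, x*, x}‖ = ‖x‖ ^ 3`. -/
class JBStarAlgebra (M : Type*) extends NormedAddCommGroup M, NonUnitalNonAssocCommRing M,
    StarRing M, NormedSpace ℂ M, IsScalarTower ℂ M M, SMulCommClass ℂ M M, StarModule ℂ M,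
    CompleteSpace M, IsCommJordan M where
  norm_mul_le' : ∀ x y : M, ‖x * y‖ ≤ ‖x‖ * ‖y‖
  norm_star' : ∀ x : M, ‖star x‖ = ‖x‖
  norm_jordanTriple' : ∀ x : M, ‖jordanTriple x (star x) x‖ = ‖x‖ ^ 3

/-- The positive elements of a JB*-algebra: the squares of selfadjoint elements. -/
def IsJordanPositive {M : Type*} [JBStarAlgebra M] (a : M) : Prop :=
  ∃ b : M, IsSelfAdjoint b ∧ a = b * b

section JBW

/- A JBW*-algebra is a JB*-algebra `M` that is a dual Banach space: there are a Banach space `P`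
(the predual) and an isometric isomorphism `e` of `M` with the dual of `P`. -/
variable {M P : Type*} [JBStarAlgebra M] [NormedAddCommGroup P] [NormedSpace ℂ P]

/-- The canonical inclusion of the predual into the dual of `M`, `⟨ω, x⟩ = e x ω`. -/
def predualInclusion (e : M ≃ₗᵢ[ℂ] StrongDual ℂ P) : P →L[ℂ] StrongDual ℂ M :=
  (e.toContinuousLinearEquiv : M →L[ℂ] StrongDual ℂ P).flip

/-- Normal faithful states on the JBW*-algebra `M` with predual `P`. -/
structure NormalFaithfulState (e : M ≃ₗᵢ[ℂ] StrongDual ℂ P) where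
  /-- The underlying bounded functional. -/
  toDual : StrongDual ℂ M
  normal : toDual ∈ Set.range (predualInclusion e)
  positive : ∀ a : M, IsJordanPositive a → 0 ≤ (toDual a).re ∧ (toDual a).im = 0
  norm_eq_one : ‖toDual‖ = 1
  faithful : ∀ a : M, IsJordanPositive a → toDual a = 0 → a = 0

namespace NormalFaithfulState

variable {e : M ≃ₗᵢ[ℂ] StrongDual ℂ P}

/-- The Jordan product as a bounded bilinear map. -/
def mulCLM (M : Type*) [JBStarAlgebra M] : M →L[ℂ] M →L[ℂ] M :=
  (LinearMap.mul ℂ M).mkContinuous₂ 1 fun x y => by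
    simpa using JBStarAlgebra.norm_mul_le' x y

/-- The map `i : x ↦ φ_x`, where `φ_x(y) = φ(x ∘ y)`. -/
def translate (φ : NormalFaithfulState e) : M →L[ℂ] StrongDual ℂ M :=
  (ContinuousLinearMap.compL ℂ M M ℂ φ.toDual).comp (mulCLM M)

theorem translate_apply (φ : NormalFaithfulState e) (x y : M) :
    φ.translate x y = φ.toDual (x * y) := rfl

theorem sq_im (φ : NormalFaithfulState e) {u : M} (hu : IsSelfAdjoint u) :
    (φ.toDual (u * u)).im = 0 :=
  (φ.positive _ ⟨u, hu, rfl⟩).2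

theorem mul_im (φ : NormalFaithfulState e) {u v : M} (hu : IsSelfAdjoint u)
    (hv : IsSelfAdjoint v) : (φ.toDual (u * v)).im = 0 := by
  have h1 := φ.sq_im (hu.add hv)
  have h2 := φ.sq_im (hu.sub hv)
  simp only [add_mul, mul_add, sub_mul, mul_sub, map_add, map_sub, Complex.add_im,
    Complex.sub_im, mul_comm v u] at h1 h2
  linarith

theorem map_star_mul_star (φ : NormalFaithfulState e) (x y : M) :
    φ.toDual (star x * star y) = (starRingEnd ℂ) (φ.toDual (x * y)) := by
  obtain ⟨a, b, ha, hb, rfl⟩ : ∃ a b : M, IsSelfAdjoint a ∧ IsSelfAdjoint b ∧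
      x = a + Complex.I • b :=
    ⟨realPart x, imaginaryPart x, (realPart x).2, (imaginaryPart x).2,
      (realPart_add_I_smul_imaginaryPart x).symm⟩
  obtain ⟨c, d, hc, hd, rfl⟩ : ∃ c d : M, IsSelfAdjoint c ∧ IsSelfAdjoint d ∧
      y = c + Complex.I • d :=
    ⟨realPart y, imaginaryPart y, (realPart y).2, (imaginaryPart y).2,
      (realPart_add_I_smul_imaginaryPart y).symm⟩
  have h1 := φ.mul_im ha hc
  have h2 := φ.mul_im ha hd
  have h3 := φ.mul_im hb hc
  have h4 := φ.mul_im hb hd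
  simp only [star_add, star_smul, ha.star_eq, hb.star_eq, hc.star_eq, hd.star_eq, add_mul,
    mul_add, smul_mul_assoc, mul_smul_comm, map_add, map_smul, smul_eq_mul]
  apply Complex.ext <;> simp [h1, h2, h3, h4]

theorem star_mul_self_eq (φ : NormalFaithfulState e) {a b : M} (ha : IsSelfAdjoint a)
    (hb : IsSelfAdjoint b) :
    φ.toDual (star (a + Complex.I • b) * (a + Complex.I • b)) =
      φ.toDual (a * a) + φ.toDual (b * b) := by
  simp only [star_add, star_smul, ha.star_eq, hb.star_eq, add_mul, mul_add, smul_mul_assoc,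
    mul_smul_comm, map_add, map_smul, smul_eq_mul, mul_comm b a]
  apply Complex.ext <;> simp

theorem eq_zero_of_sq (φ : NormalFaithfulState e) {b : M} (hb : IsSelfAdjoint b)
    (h : φ.toDual (b * b) = 0) : b = 0 := by
  have h0 : b * b = 0 := φ.faithful _ ⟨b, hb, rfl⟩ h
  have h1 := JBStarAlgebra.norm_jordanTriple' b
  rw [hb.star_eq] at h1
  simp only [jordanTriple, h0, zero_mul, add_zero, sub_zero, norm_zero] at h1
  exact norm_eq_zero.mp (pow_eq_zero_iff (three_ne_zero) |>.mp h1.symm)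

theorem re_star_mul_self_nonneg (φ : NormalFaithfulState e) (x : M) :
    0 ≤ (φ.toDual (star x * x)).re := by
  obtain ⟨a, b, ha, hb, rfl⟩ : ∃ a b : M, IsSelfAdjoint a ∧ IsSelfAdjoint b ∧
      x = a + Complex.I • b :=
    ⟨realPart x, imaginaryPart x, (realPart x).2, (imaginaryPart x).2,
      (realPart_add_I_smul_imaginaryPart x).symm⟩
  rw [φ.star_mul_self_eq ha hb, Complex.add_re]
  exact add_nonneg (φ.positive _ ⟨a, ha, rfl⟩).1 (φ.positive _ ⟨b, hb, rfl⟩).1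

theorem eq_zero_of_star_mul_self (φ : NormalFaithfulState e) (x : M)
    (h : φ.toDual (star x * x) = 0) : x = 0 := by
  obtain ⟨a, b, ha, hb, rfl⟩ : ∃ a b : M, IsSelfAdjoint a ∧ IsSelfAdjoint b ∧
      x = a + Complex.I • b :=
    ⟨realPart x, imaginaryPart x, (realPart x).2, (imaginaryPart x).2,
      (realPart_add_I_smul_imaginaryPart x).symm⟩
  rw [φ.star_mul_self_eq ha hb] at h
  have hpa := φ.positive _ ⟨a, ha, rfl⟩
  have hpb := φ.positive _ ⟨b, hb, rfl⟩
  have h0 := congrArg Complex.re h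
  rw [Complex.add_re, Complex.zero_re] at h0
  have h1 : φ.toDual (a * a) = 0 := Complex.ext (by rw [Complex.zero_re]; linarith [hpa.1, hpb.1]) hpa.2
  have h2 : φ.toDual (b * b) = 0 := Complex.ext (by rw [Complex.zero_re]; linarith [hpa.1, hpb.1]) hpb.2
  rw [φ.eq_zero_of_sq ha h1, φ.eq_zero_of_sq hb h2, smul_zero, add_zero]

theorem translate_injective (φ : NormalFaithfulState e) : Function.Injective φ.translate := by
  rw [injective_iff_map_eq_zero]
  intro x hx
  refine φ.eq_zero_of_star_mul_self x ?_
  rw [mul_comm, ← translate_apply, hx]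
  rfl

theorem predualInclusion_injective (e : M ≃ₗᵢ[ℂ] StrongDual ℂ P) :
    Function.Injective (predualInclusion e) := by
  rw [injective_iff_map_eq_zero]
  intro ω hω
  by_contra hne
  obtain ⟨f, hf⟩ := SeparatingDual.exists_ne_zero (R := ℂ) hne
  apply hf
  have h : predualInclusion e ω (e.symm f) = 0 := by rw [hω]; rfl
  simpa [predualInclusion] using h

/-- The interpolation couple `(M, M_*)`: both spaces are embedded in the dual of `M`, the algebra
by `i : x ↦ φ_x` and the predual canonically. -/
def couple (φ : NormalFaithfulState e) : InterpolationCouple M P (StrongDual ℂ M) where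
  left := φ.translate
  right := predualInclusion e
  left_injective := φ.translate_injective
  right_injective := predualInclusion_injective e

/-- The nonassociative `L^p`-space `L^p(M, φ) = (M, M_*)_{1/p}`, for `1 < p < ∞`. -/
abbrev Lp (φ : NormalFaithfulState e) (p : ℝ) (hp : 1 < p) : Type _ :=
  φ.couple.Interpolation
    ⟨1 / p, one_div_nonneg.mpr (zero_le_one.trans hp.le),
      (div_le_one (zero_lt_one.trans hp)).mpr hp.le⟩

/-- The functional on `M` given by an element of `L^p(M, φ)`. -/
def Lp.toFunctional {φ : NormalFaithfulState e} {p : ℝ} {hp : 1 < p} (h : φ.Lp p hp) :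
    StrongDual ℂ M :=
  φ.couple.toAmbient (InterpolationCouple.Interpolation.toSum h)

/-- The element `h` of `L^p(M, φ)` is the element `x` of `M`, under the identification of `M` with
`i(M)`. -/
def Lp.IsElement {φ : NormalFaithfulState e} {p : ℝ} {hp : 1 < p} (h : φ.Lp p hp) (x : M) :
    Prop :=
  InterpolationCouple.Interpolation.toSum h = φ.couple.inl x

/-- The sesquilinear form `⟨x, y⟩ = φ(x* ∘ y)` on `M`. -/
def form (φ : NormalFaithfulState e) (x y : M) : ℂ := φ.toDual (star x * y)

theorem conj_form (φ : NormalFaithfulState e) (x y : M) :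
    (starRingEnd ℂ) (φ.form y x) = φ.form x y := by
  have h := φ.map_star_mul_star (star y) x
  rw [star_star, mul_comm] at h
  exact h.symm

theorem form_add_left (φ : NormalFaithfulState e) (x y z : M) :
    φ.form (x + y) z = φ.form x z + φ.form y z := by
  simp only [form, star_add, add_mul, map_add]

theorem form_smul_left (φ : NormalFaithfulState e) (x y : M) (r : ℂ) :
    φ.form (r • x) y = (starRingEnd ℂ) r * φ.form x y := by
  simp only [form, star_smul, smul_mul_assoc, map_smul, smul_eq_mul]
  rfl

/-- The vector space `M`, to be equipped with the inner product `⟨x, y⟩ = φ(x* ∘ y)`. -/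
def PreHilbert (_φ : NormalFaithfulState e) : Type _ := M

instance (φ : NormalFaithfulState e) : AddCommGroup φ.PreHilbert :=
  inferInstanceAs (AddCommGroup M)

instance (φ : NormalFaithfulState e) : Module ℂ φ.PreHilbert :=
  inferInstanceAs (Module ℂ M)

/-- The inner product `⟨x, y⟩ = φ(x* ∘ y)` on `M`. -/
@[reducible]
def innerCore (φ : NormalFaithfulState e) : InnerProductSpace.Core ℂ φ.PreHilbert where
  inner := φ.form
  conj_inner_symm := φ.conj_form
  re_inner_nonneg := φ.re_star_mul_self_nonneg
  add_left := φ.form_add_left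
  smul_left := φ.form_smul_left
  definite := φ.eq_zero_of_star_mul_self

instance (φ : NormalFaithfulState e) : NormedAddCommGroup φ.PreHilbert :=
  φ.innerCore.toNormedAddCommGroup

instance (φ : NormalFaithfulState e) : InnerProductSpace ℂ φ.PreHilbert :=
  InnerProductSpace.ofCore φ.innerCore.toCore

/-- The Hilbert space `H_φ`: the completion of `M` for the inner product `φ(x* ∘ y)`. -/
abbrev HilbertCompletion (φ : NormalFaithfulState e) : Type _ :=
  UniformSpace.Completion φ.PreHilbert

/-- The identity map of `M`, as a map to `M` with its inner product. -/
def toPreHilbert (φ : NormalFaithfulState e) : M ≃ₗ[ℂ] φ.PreHilbert :=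
  LinearEquiv.refl ℂ M

/-- The canonical map `M → H_φ`. -/
def toHilbert (φ : NormalFaithfulState e) (x : M) : φ.HilbertCompletion :=
  (φ.toPreHilbert x : UniformSpace.Completion φ.PreHilbert)

end NormalFaithfulState

end JBW
end

noncomputable section

open scoped ZeroAtInfty
open Filter Topology MeasureTheory
open scoped BoundedContinuousFunction

/-! The functionals φ(x ∘ ·) are normal (`exists_predual_translate`). Hence M sits inside M_*, the
sum of the couple is M_* itself (`predualEquivSum`), and every interpolation space consists of
elements of M_*. Normality is reached from the axioms alone. A norming element of φ is an
idempotent, and Peirce theory with faithfulness makes it a unit (`exists_unit`). The polynomials 1 +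
ity - t²y²/2 have norm 1 + O(t⁴) for selfadjoint y, so comparing t²-terms in a weak* limit makes y ↦
φ(y ∘ y) weak*-lower semicontinuous, and a polarization argument turns this into continuity of φ(c ∘
·) on bounded sets.

Half of the duality is the three lines theorem. If F and g are strip functions for θ and 1 - θ, the
pairing of F(z) with g(1 - z) is analytic, and on the boundary lines it pairs M with M_*: the form
φ(x ∘ y) is symmetric, so the two factors may change roles. This gives |φ(x ∘ y)| ≤ ‖x‖_θ ‖y‖_{1-θ}
(`norm_apply_toPredual_le`). Gaussian smoothing shows that M is dense in each space
(`denseRange_ofAlgebra`).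

For the converse, the interpolation norm is at most the L¹-norm of the boundary values for harmonic
measure (`BddStrip.norm_le_integral`), so Hahn–Banach represents a functional ℓ with ‖ℓ‖ ≤ 1 by a
pair Λ₀, Λ₁ on boundary functions (`exists_boundary_functional`). Evaluating Λ₁ on Gaussian kernels
divided by the Poisson kernel yields entire M-valued functions. Since Λ₀ + Λ₁ annihilates boundary
values of functions vanishing at θ, the same functions are given by Λ₀ on the other line, so they
are strip functions of norm at most 1, and their values at 1 - θ converge to ℓ pointwise on M
(`exists_niceStrip_tendsto`). A norming ℓ gives equality of norms (`norm_pairing_eq`).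

At θ = 1/2, pairing a strip function with its own adjoint gives φ(g* ∘ g) ≤ C², and the
approximation of functionals with Cauchy–Schwarz identifies the norm with that of H_φ
(`norm_ofAlgebra_midpoint`).

Surjectivity of the duality map amounts to density of M in the dual (`denseRange_pairing`). The
approximating strip functions take values in a Hilbert space on the line Re z = 1/2, so by the
parallelogram law suitable convex combinations are Cauchy there in quadratic mean. Interpolating
between that line and another line of the strip makes them Cauchy at 1 - θ, and pointwise
convergence becomes norm convergence. Isometries defined on M with dense range then extend to the
complete spaces. -/

/-! ### Powers in Jordan algebras -/

section JordanPower

variable {M : Type*} [JBStarAlgebra M]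

/-- The linearized Jordan identity. -/
theorem jordan_linearized (a b c d : M) :
    a * ((b * c) * d) - (b * c) * (a * d) + (b * ((c * a) * d) - (c * a) * (b * d)) +
      (c * ((a * b) * d) - (a * b) * (c * d)) = 0 := by
  have h := DFunLike.congr_fun (two_nsmul_lie_lmul_lmul_add_add_eq_zero a b c) d
  have h2 : (2 : ℂ) • (a * ((b * c) * d) - (b * c) * (a * d) +
      (b * ((c * a) * d) - (c * a) * (b * d)) +
      (c * ((a * b) * d) - (a * b) * (c * d))) = 0 := by
    rw [two_smul, ← two_nsmul]
    exact h
  exact (smul_eq_zero.mp h2).resolve_left two_ne_zero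

/-- `jordanPow a n` is the power `a ^ (n + 1)` in a Jordan algebra. -/
def jordanPow (a : M) : ℕ → M
  | 0 => a
  | n + 1 => a * jordanPow a n

/-- The linearized Jordan identity, read as an operator identity in its third entry. It reduces
multiplication by a triple product to multiplications by products of at most two factors, which is
what an induction on powers needs. -/
theorem lmul_mul_mul_eq (a b d : M) :
    AddMonoid.End.mulLeft ((a * b) * d) =
      AddMonoid.End.mulLeft (a * d) * AddMonoid.End.mulLeft b +
      AddMonoid.End.mulLeft (b * d) * AddMonoid.End.mulLeft a +
      AddMonoid.End.mulLeft (a * b) * AddMonoid.End.mulLeft d -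
      AddMonoid.End.mulLeft a * AddMonoid.End.mulLeft d * AddMonoid.End.mulLeft b -
      AddMonoid.End.mulLeft b * AddMonoid.End.mulLeft d * AddMonoid.End.mulLeft a := by
  refine AddMonoidHom.ext fun x => ?_
  have h := jordan_linearized a b x d
  show ((a * b) * d) * x = (a * d) * (b * x) + (b * d) * (a * x) + (a * b) * (d * x) -
    a * (d * (b * x)) - b * (d * (a * x))
  rw [mul_comm (b * x) d, mul_comm (b * x) (a * d), mul_comm x a, mul_comm (a * x) d,
    mul_comm (a * x) (b * d), mul_comm x, mul_comm x d] at h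
  rw [← sub_eq_zero, ← h]
  abel

/-- By `lmul_mul_mul_eq` every L_{aⁿ} is a polynomial in L_a and L_{a∘a}, and these two commute by
the Jordan identity. -/
theorem commute_lmul_jordanPow (a : M) (n : ℕ) :
    Commute (AddMonoid.End.mulLeft a) (AddMonoid.End.mulLeft (jordanPow a n)) ∧
    Commute (AddMonoid.End.mulLeft (a * a)) (AddMonoid.End.mulLeft (jordanPow a n)) := by
  induction n using Nat.twoStepInduction with
  | zero => exact ⟨Commute.refl _, (commute_lmul_lmul_sq a).symm⟩
  | one => exact ⟨commute_lmul_lmul_sq a, Commute.refl _⟩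
  | more n ih0 ih1 =>
    have h : jordanPow a (n + 2) = (jordanPow a n * a) * a := by
      rw [jordanPow, jordanPow, mul_comm a, mul_comm a]
    have h1 : jordanPow a n * a = jordanPow a (n + 1) := by rw [jordanPow, mul_comm]
    rw [h, lmul_mul_mul_eq, h1]
    have hc := commute_lmul_lmul_sq a
    refine ⟨?_, ?_⟩
    · exact ((((ih1.1.mul_right (Commute.refl _)).add_right (hc.mul_right ih0.1)).add_right
        (ih1.1.mul_right (Commute.refl _))).sub_right
        ((ih0.1.mul_right (Commute.refl _)).mul_right (Commute.refl _))).sub_right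
        (((Commute.refl _).mul_right (Commute.refl _)).mul_right ih0.1)
    · exact ((((ih1.2.mul_right hc.symm).add_right ((Commute.refl _).mul_right ih0.2)).add_right
        (ih1.2.mul_right hc.symm)).sub_right
        ((ih0.2.mul_right hc.symm).mul_right hc.symm)).sub_right
        ((hc.symm.mul_right hc.symm).mul_right ih0.2)

/-- Jordan algebras are power-associative. -/
theorem jordanPow_mul_jordanPow (a : M) (m n : ℕ) :
    jordanPow a m * jordanPow a n = jordanPow a (m + n + 1) := by
  induction n with
  | zero => rw [jordanPow, mul_comm]; rfl
  | succ n ih =>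
    -- Commutation of the two multiplication operators replaces associativity.
    have h := DFunLike.congr_fun (commute_lmul_jordanPow a m).1 (jordanPow a n)
    have h' : a * (jordanPow a m * jordanPow a n) = jordanPow a m * (a * jordanPow a n) := h
    rw [jordanPow, ← h', ih]
    rfl

theorem star_jordanPow {a : M} (ha : IsSelfAdjoint a) (n : ℕ) :
    star (jordanPow a n) = jordanPow a n := by
  induction n with
  | zero => exact ha
  | succ n ih => rw [jordanPow, star_mul, ih, ha.star_eq, mul_comm]

theorem norm_jordanPow_le (a : M) (n : ℕ) : ‖jordanPow a n‖ ≤ ‖a‖ ^ (n + 1) := by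
  induction n with
  | zero => simp [jordanPow]
  | succ n ih =>
    rw [jordanPow, pow_succ']
    exact (JBStarAlgebra.norm_mul_le' _ _).trans (mul_le_mul_of_nonneg_left ih (norm_nonneg a))

/-- The closed subalgebra generated by an element of a Jordan algebra. -/
def jordanElemental (a : M) : Submodule ℂ M :=
  (Submodule.span ℂ (Set.range (jordanPow a))).topologicalClosure

theorem self_mem_jordanElemental (a : M) : a ∈ jordanElemental a :=
  Submodule.le_topologicalClosure _ (Submodule.subset_span ⟨0, rfl⟩)

theorem continuous_jordan_mul : Continuous fun p : M × M => p.1 * p.2 :=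
  (NormalFaithfulState.mulCLM M).continuous₂

theorem jordanElemental_mul_mem {a x y : M} (hx : x ∈ jordanElemental a)
    (hy : y ∈ jordanElemental a) : x * y ∈ jordanElemental a := by
  refine map_mem_closure₂ continuous_jordan_mul hx hy fun x hx y hy => ?_
  refine Submodule.span_induction₂ (p := fun x y _ _ =>
    x * y ∈ Submodule.span ℂ (Set.range (jordanPow a))) ?_ ?_ ?_ ?_ ?_ ?_ ?_ hx hy
  · rintro _ _ ⟨m, rfl⟩ ⟨n, rfl⟩
    exact Submodule.subset_span ⟨_, (jordanPow_mul_jordanPow a m n).symm⟩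
  · intros; simp
  · intros; simp
  · intro _ _ _ _ _ _ h1 h2; rw [add_mul]; exact add_mem h1 h2
  · intro _ _ _ _ _ _ h1 h2; rw [mul_add]; exact add_mem h1 h2
  · intro _ _ _ _ _ h; rw [smul_mul_assoc]; exact Submodule.smul_mem _ _ h
  · intro _ _ _ _ _ h; rw [mul_smul_comm]; exact Submodule.smul_mem _ _ h

/-- Power associativity settles triples of powers; trilinearity extends it to the span, and joint
continuity of the product to the closure. -/
theorem jordanElemental_mul_assoc {a x y z : M} (hx : x ∈ jordanElemental a)
    (hy : y ∈ jordanElemental a) (hz : z ∈ jordanElemental a) : x * y * z = x * (y * z) := by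
  have key : ∀ x ∈ Submodule.span ℂ (Set.range (jordanPow a)),
      ∀ y ∈ Submodule.span ℂ (Set.range (jordanPow a)),
      ∀ z ∈ Submodule.span ℂ (Set.range (jordanPow a)), x * y * z = x * (y * z) := by
    intro x hx y hy z hz
    induction hx using Submodule.span_induction with
    | zero => simp
    | add _ _ _ _ h1 h2 => simp only [add_mul, h1, h2]
    | smul _ _ _ h => simp only [smul_mul_assoc, h]
    | mem x hx =>
      induction hy using Submodule.span_induction with
      | zero => simp
      | add _ _ _ _ h1 h2 => simp only [add_mul, mul_add, h1, h2]
      | smul _ _ _ h => simp only [smul_mul_assoc, mul_smul_comm, h]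
      | mem y hy =>
        induction hz using Submodule.span_induction with
        | zero => simp
        | add _ _ _ _ h1 h2 => simp only [mul_add, h1, h2]
        | smul _ _ _ h => simp only [mul_smul_comm, h]
        | mem z hz =>
          obtain ⟨k, rfl⟩ := hx
          obtain ⟨m, rfl⟩ := hy
          obtain ⟨n, rfl⟩ := hz
          simp only [jordanPow_mul_jordanPow]
          congr 1
          ring
  have hm := continuous_jordan_mul (M := M)
  have c1 : IsClosed {p : M × M × M | p.1 * p.2.1 * p.2.2 = p.1 * (p.2.1 * p.2.2)} :=
    isClosed_eq
      (hm.comp ((hm.comp (continuous_fst.prodMk (continuous_fst.comp continuous_snd))).prodMk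
        (continuous_snd.comp continuous_snd)))
      (hm.comp (continuous_fst.prodMk (hm.comp continuous_snd)))
  have hmem : (x, y, z) ∈ closure ((Submodule.span ℂ (Set.range (jordanPow a)) : Set M) ×ˢ
      ((Submodule.span ℂ (Set.range (jordanPow a)) : Set M) ×ˢ
      (Submodule.span ℂ (Set.range (jordanPow a)) : Set M))) := by
    rw [closure_prod_eq, closure_prod_eq]
    exact ⟨hx, hy, hz⟩
  exact c1.closure_subset_iff.mpr (fun p hp => key _ hp.1 _ hp.2.1 _ hp.2.2) hmem

theorem jordanElemental_star_mem {a x : M} (ha : IsSelfAdjoint a) (hx : x ∈ jordanElemental a) :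
    star x ∈ jordanElemental a := by
  have hs : Continuous (star : M → M) :=
    (AddMonoidHomClass.isometry_of_norm (starAddEquiv : M ≃+ M)
      JBStarAlgebra.norm_star').continuous
  refine map_mem_closure hs hx fun x hx => ?_
  induction hx using Submodule.span_induction with
  | zero => simp
  | add _ _ _ _ h1 h2 => rw [star_add]; exact add_mem h1 h2
  | smul _ _ _ h => rw [star_smul]; exact Submodule.smul_mem _ _ h
  | mem x hx =>
    obtain ⟨n, rfl⟩ := hx
    rw [star_jordanPow ha]
    exact Submodule.subset_span ⟨n, rfl⟩

/-- The C*-inequality in associative parts of a JB*-algebra. -/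
theorem sq_norm_le_of_assoc {x : M} (h : x * x * star x = x * (star x * x)) :
    ‖x‖ ^ 2 ≤ ‖star x * x‖ := by
  have h1 := JBStarAlgebra.norm_jordanTriple' x
  -- All three terms of the triple product coincide, so two of them cancel; the cubic norm axiom
  -- then reads ‖x(x*x)‖ = ‖x‖³.
  have h2 : jordanTriple x (star x) x = x * (star x * x) := by
    rw [jordanTriple, h, mul_comm (x * star x), mul_comm (star x * x), mul_comm x (star x)]
    abel
  rw [h2] at h1
  have h3 := JBStarAlgebra.norm_mul_le' x (star x * x)
  rw [h1] at h3
  rcases (norm_nonneg x).eq_or_lt with h0 | h0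
  · rw [← h0]; simp
  · have : ‖x‖ ^ 3 = ‖x‖ * ‖x‖ ^ 2 := by ring
    rw [this] at h3
    exact le_of_mul_le_mul_left h3 h0

/-- The closed subalgebra generated by a selfadjoint element of a JB*-algebra is a commutative
C*-algebra. -/
@[reducible]
def jordanElementalCStar {a : M} (ha : IsSelfAdjoint a) :
    NonUnitalCommCStarAlgebra (jordanElemental a) where
  __ := (inferInstance : NormedAddCommGroup (jordanElemental a))
  __ := (inferInstance : NormedSpace ℂ (jordanElemental a))
  mul x y := ⟨x.1 * y.1, jordanElemental_mul_mem x.2 y.2⟩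
  left_distrib x y z := Subtype.ext (mul_add _ _ _)
  right_distrib x y z := Subtype.ext (add_mul _ _ _)
  zero_mul x := Subtype.ext (zero_mul _)
  mul_zero x := Subtype.ext (mul_zero _)
  mul_assoc x y z := Subtype.ext (jordanElemental_mul_assoc x.2 y.2 z.2)
  mul_comm x y := Subtype.ext (mul_comm _ _)
  norm_mul_le x y := JBStarAlgebra.norm_mul_le' _ _
  star x := ⟨star x.1, jordanElemental_star_mem ha x.2⟩
  star_involutive x := Subtype.ext (star_star _)
  star_mul x y := Subtype.ext (star_mul _ _)
  star_add x y := Subtype.ext (star_add _ _)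
  complete := (Submodule.isClosed_topologicalClosure _).completeSpace_coe.complete
  norm_mul_self_le x := by
    rw [← sq]
    refine sq_norm_le_of_assoc (x := x.1) ?_
    rw [jordanElemental_mul_assoc x.2 x.2 (jordanElemental_star_mem ha x.2),
      mul_comm x.1 (star x.1)]
  norm_smul_le a x := norm_smul_le _ _
  smul_assoc r x y := Subtype.ext (smul_mul_assoc _ _ _)
  smul_comm r x y := Subtype.ext (mul_smul_comm _ _ _).symm
  star_smul r x := Subtype.ext (star_smul _ _)

/-- Selfadjoint elements are differences of squares. -/
theorem exists_sq_sub_sq {a : M} (ha : IsSelfAdjoint a) :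
    ∃ b c : M, IsSelfAdjoint b ∧ IsSelfAdjoint c ∧ a = b * b - c * c := by
  let _ := jordanElementalCStar ha
  set x : jordanElemental a := ⟨a, self_mem_jordanElemental a⟩
  have hx : IsSelfAdjoint x := Subtype.ext ha
  -- Square roots of the positive and the negative part. Both functions vanish at 0, as the
  -- non-unital functional calculus requires.
  have h1 : IsSelfAdjoint (cfcₙ (fun t : ℝ => √(max t 0)) x) := cfcₙ_predicate _ _
  have h2 : IsSelfAdjoint (cfcₙ (fun t : ℝ => √(max (-t) 0)) x) := cfcₙ_predicate _ _
  refine ⟨_, _, congrArg Subtype.val h1, congrArg Subtype.val h2, ?_⟩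
  have h3 : x = cfcₙ (fun t : ℝ => √(max t 0)) x * cfcₙ (fun t : ℝ => √(max t 0)) x -
      cfcₙ (fun t : ℝ => √(max (-t) 0)) x * cfcₙ (fun t : ℝ => √(max (-t) 0)) x := by
    rw [← cfcₙ_mul _ _ x (by fun_prop) (by simp) (by fun_prop) (by simp),
      ← cfcₙ_mul _ _ x (by fun_prop) (by simp) (by fun_prop) (by simp),
      ← cfcₙ_sub _ _ x (by fun_prop) (by simp) (by fun_prop) (by simp)]
    conv_lhs => rw [← cfcₙ_id' ℝ x]
    congr 1
    funext t
    rw [Real.mul_self_sqrt (le_max_right _ _), Real.mul_self_sqrt (le_max_right _ _)]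
    rcases le_total 0 t with h | h
    · rw [max_eq_left h, max_eq_right (by linarith)]; ring
    · rw [max_eq_right h, max_eq_left (by linarith)]; ring
  exact congrArg Subtype.val h3

/-- The polynomial 3t - t³ maps [-1, 1] into [-2, 2] and takes the value 2 at 1. If φ(a) = 1, the
bound therefore forces φ(a³) ≥ 1, which is its use in `exists_unit`. -/
theorem norm_three_smul_sub_cube_le {a : M} (ha : IsSelfAdjoint a) (h1 : ‖a‖ ≤ 1) :
    ‖(3 : ℝ) • a - a * (a * a)‖ ≤ 2 := by
  let _ := jordanElementalCStar ha
  set x : jordanElemental a := ⟨a, self_mem_jordanElemental a⟩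
  have hx : IsSelfAdjoint x := Subtype.ext ha
  have h3 : (3 : ℝ) • x - x * (x * x) = cfcₙ (fun t : ℝ => 3 * t - t * (t * t)) x := by
    rw [cfcₙ_sub _ _ x (by fun_prop) (by simp) (by fun_prop) (by simp),
      cfcₙ_const_mul _ _ x (by fun_prop) (by simp),
      cfcₙ_mul _ _ x (by fun_prop) (by simp) (by fun_prop) (by simp),
      cfcₙ_mul _ _ x (by fun_prop) (by simp) (by fun_prop) (by simp), cfcₙ_id' ℝ x]
  have h4 : ‖cfcₙ (fun t : ℝ => 3 * t - t * (t * t)) x‖ ≤ 2 := by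
    refine norm_cfcₙ_le (𝕜 := ℝ) fun t ht => ?_
    have ht1 : |t| ≤ 1 := by
      have := norm_apply_le_norm_cfcₙ (𝕜 := ℝ) (fun t : ℝ => t) x ht
      rw [cfcₙ_id' ℝ x] at this
      exact this.trans h1
    rw [Real.norm_eq_abs]
    rw [abs_le] at ht1 ⊢
    constructor <;> nlinarith [ht1.1, ht1.2, sq_nonneg (t - 1), sq_nonneg (t + 1)]
  rw [← h3] at h4
  exact h4

end JordanPower

/-! ### Weak* limits along ultrafilters -/

section WeakStar

variable {M P ι : Type*} [NormedAddCommGroup M] [NormedSpace ℂ M] [NormedAddCommGroup P]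
  [NormedSpace ℂ P] {e : M ≃ₗᵢ[ℂ] StrongDual ℂ P} {𝒰 : Filter ι}

/-- Weak* convergence in a dual Banach space. -/
def WeakStarTendsto (e : M ≃ₗᵢ[ℂ] StrongDual ℂ P) (f : ι → M) (𝒰 : Filter ι) (l : M) : Prop :=
  ∀ ω : P, Tendsto (fun i => e (f i) ω) 𝒰 (𝓝 (e l ω))

namespace WeakStarTendsto

theorem const (l : M) : WeakStarTendsto e (fun _ : ι => l) 𝒰 l := fun _ => tendsto_const_nhds

theorem add {f g : ι → M} {l m : M} (hf : WeakStarTendsto e f 𝒰 l)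
    (hg : WeakStarTendsto e g 𝒰 m) : WeakStarTendsto e (fun i => f i + g i) 𝒰 (l + m) :=
  fun ω => by simpa using (hf ω).add (hg ω)

theorem smul {f : ι → M} {l : M} (c : ℂ) (hf : WeakStarTendsto e f 𝒰 l) :
    WeakStarTendsto e (fun i => c • f i) 𝒰 (c • l) :=
  fun ω => by simpa using (hf ω).const_mul c

theorem sub {f g : ι → M} {l m : M} (hf : WeakStarTendsto e f 𝒰 l)
    (hg : WeakStarTendsto e g 𝒰 m) : WeakStarTendsto e (fun i => f i - g i) 𝒰 (l - m) :=
  fun ω => by simpa using (hf ω).sub (hg ω)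

theorem unique [𝒰.NeBot] {f : ι → M} {l m : M} (hf : WeakStarTendsto e f 𝒰 l)
    (hg : WeakStarTendsto e f 𝒰 m) : l = m :=
  e.injective (ContinuousLinearMap.ext fun ω => tendsto_nhds_unique (hf ω) (hg ω))

theorem norm_le [𝒰.NeBot] {f : ι → M} {l : M} (hf : WeakStarTendsto e f 𝒰 l) {R : ℝ}
    (hR : 0 ≤ R) (h : ∀ᶠ i in 𝒰, ‖f i‖ ≤ R) : ‖l‖ ≤ R := by
  rw [← e.norm_map]
  refine ContinuousLinearMap.opNorm_le_bound _ hR fun ω => ?_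
  refine le_of_tendsto (hf ω).norm ?_
  filter_upwards [h] with i hi
  refine ((e (f i)).le_opNorm ω).trans ?_
  rw [e.norm_map]
  exact mul_le_mul_of_nonneg_right hi (norm_nonneg ω)

end WeakStarTendsto

/-- Bounded families in a dual Banach space converge along ultrafilters. -/
theorem exists_weakStarTendsto (e : M ≃ₗᵢ[ℂ] StrongDual ℂ P) (𝒰 : Ultrafilter ι) (f : ι → M)
    {R : ℝ} (hf : ∀ᶠ i in (𝒰 : Filter ι), ‖f i‖ ≤ R) : ∃ l, WeakStarTendsto e f 𝒰 l := by
  have hc := WeakDual.isCompact_closedBall (𝕜 := ℂ) (E := P) 0 R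
  have hm : ∀ᶠ i in (𝒰 : Filter ι), StrongDual.toWeakDual (e (f i)) ∈
      WeakDual.toStrongDual ⁻¹' Metric.closedBall (0 : StrongDual ℂ P) R := by
    filter_upwards [hf] with i hi
    simpa using hi
  obtain ⟨l, -, hl⟩ := hc.ultrafilter_le_nhds (𝒰.map fun i => StrongDual.toWeakDual (e (f i)))
    (by rw [le_principal_iff]; exact Filter.mem_map.mpr hm)
  refine ⟨e.symm (WeakDual.toStrongDual l), fun ω => ?_⟩
  rw [e.apply_symm_apply]
  exact ((WeakDual.eval_continuous ω).tendsto l).comp hl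

theorem exists_ultrafilter_tendsto {𝒰 : Ultrafilter ι} {f : ι → ℝ} {R : ℝ}
    (hf : ∀ i, |f i| ≤ R) : ∃ r, Tendsto f 𝒰 (𝓝 r) := by
  obtain ⟨r, -, hr⟩ := (isCompact_Icc (a := -R) (b := R)).ultrafilter_le_nhds (𝒰.map f)
    (by rw [le_principal_iff]; exact Filter.mem_map.mpr (Filter.univ_mem' fun i => abs_le.mp (hf i)))
  exact ⟨r, hr⟩

/-- A functional that is weak*-continuous at `0` on the unit ball belongs to the predual. -/
theorem mem_range_predual [CompleteSpace P] (e : M ≃ₗᵢ[ℂ] StrongDual ℂ P) (ψ : StrongDual ℂ M)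
    (h : ∀ (𝒰 : Ultrafilter M) (l : M), (∀ᶠ y in (𝒰 : Filter M), ‖y‖ ≤ 1) →
      WeakStarTendsto e id 𝒰 l → Tendsto ψ 𝒰 (𝓝 (ψ l))) :
    ∃ ω : P, ∀ x, ψ x = e x ω := by
  set J : P →L[ℂ] StrongDual ℂ M := (e.toContinuousLinearEquiv : M →L[ℂ] StrongDual ℂ P).flip
  have hJ : ∀ ω x, J ω x = e x ω := fun _ _ => rfl
  have hiso : Isometry J := by
    refine AddMonoidHomClass.isometry_of_norm J fun ω => le_antisymm ?_ ?_
    · refine ContinuousLinearMap.opNorm_le_bound _ (norm_nonneg ω) fun x => ?_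
      rw [hJ, mul_comm, ← e.norm_map x]
      exact (e x).le_opNorm ω
    · refine NormedSpace.norm_le_dual_bound ℂ ω (norm_nonneg _) fun f => ?_
      have := (J ω).le_opNorm (e.symm f)
      rwa [hJ, e.apply_symm_apply, e.symm.norm_map] at this
  -- An isometric image of the complete space `P` is closed, so it is enough to approximate ψ in
  -- norm.
  have hclosed : IsClosed (Set.range J) := hiso.isClosedEmbedding.isClosed_range
  suffices hψ : ψ ∈ Set.range J by
    obtain ⟨ω, rfl⟩ := hψ
    exact ⟨ω, fun x => rfl⟩
  rw [← hclosed.closure_eq, Metric.mem_closure_iff]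
  intro ε hε
  set B : M →ₗ[ℂ] P →ₗ[ℂ] ℂ :=
    { toFun := fun x => (e x).toLinearMap
      map_add' := fun x y => by rw [map_add]; rfl
      map_smul' := fun c x => by rw [map_smul]; rfl }
  have hBinj : Function.Injective B := fun x y hxy =>
    e.injective (ContinuousLinearMap.ext fun ω => LinearMap.congr_fun hxy ω)
  have : T2Space (WeakBilin B) := (WeakBilin.isEmbedding hBinj).t2Space
  -- This convex set omits 0 and is weak*-compact by the continuity assumption on ψ. Some ω in the
  -- predual therefore separates it from 0, so ψ is small on the unit ball of the kernel of ω.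
  set A : Set (WeakBilin B) := {y : M | ‖y‖ ≤ 1 ∧ ε / 2 ≤ (ψ y).re}
  have hAconv : Convex ℝ A := by
    intro x hx y hy a b ha hb hab
    change M at x y
    have hlin : (a • x + b • y : M) = (a : ℂ) • x + (b : ℂ) • y := rfl
    have h1 : ‖(a • x + b • y : M)‖ ≤ 1 ∧ ε / 2 ≤ (ψ (a • x + b • y : M)).re := by
      refine ⟨?_, ?_⟩
      · rw [hlin]
        refine (norm_add_le _ _).trans ?_
        rw [norm_smul, norm_smul, Complex.norm_real, Complex.norm_real, Real.norm_of_nonneg ha,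
          Real.norm_of_nonneg hb]
        nlinarith [hx.1, hy.1]
      · rw [hlin]
        simp only [map_add, map_smul, Complex.add_re, smul_eq_mul, Complex.re_ofReal_mul]
        nlinarith [hx.2, hy.2]
    exact h1
  have hAcomp : IsCompact A := by
    rw [isCompact_iff_ultrafilter_le_nhds]
    intro 𝒱 h𝒱
    rw [le_principal_iff] at h𝒱
    change Ultrafilter M at 𝒱
    have h1 : ∀ᶠ y in (𝒱 : Filter M), ‖y‖ ≤ 1 := by
      filter_upwards [h𝒱] with y hy using hy.1
    obtain ⟨l, hl⟩ := exists_weakStarTendsto e 𝒱 id h1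
    refine ⟨l, ⟨hl.norm_le zero_le_one h1, ?_⟩, ?_⟩
    · refine ge_of_tendsto ((Complex.continuous_re.tendsto _).comp (h 𝒱 l h1 hl)) ?_
      filter_upwards [h𝒱] with y hy using hy.2
    · exact (WeakBilin.tendsto_iff_forall_eval_tendsto (f := id) B hBinj).mpr hl
  have h0 : (0 : WeakBilin B) ∉ A := by
    intro h0
    have h2 : ε / 2 ≤ (ψ (0 : M)).re := h0.2
    rw [map_zero, Complex.zero_re] at h2
    linarith
  obtain ⟨f, u, hf0, hfA⟩ := RCLike.geometric_hahn_banach_point_closed (𝕜 := ℂ) hAconv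
    hAcomp.isClosed h0
  obtain ⟨ω, hω⟩ := LinearMap.dualEmbedding_surjective B f
  rw [map_zero, map_zero] at hf0
  have hker : ∀ y : M, ‖y‖ ≤ 1 → e y ω = 0 → (ψ y).re ≤ ε / 2 := by
    intro y hy1 hy2
    by_contra! hlt
    have h3 : u < (e y ω).re := by
      have h3 := hfA y ⟨hy1, hlt.le⟩
      rwa [← hω] at h3
    rw [hy2, Complex.zero_re] at h3
    linarith
  set K : Submodule ℂ M := (J ω).ker
  have hbound : ‖ψ.comp K.subtypeL‖ ≤ ε / 2 := by
    refine ContinuousLinearMap.opNorm_le_of_unit_norm (𝕜 := ℂ) (by positivity) fun x hx => ?_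
    obtain ⟨c, hc1, hc⟩ := Complex.exists_norm_eq_mul_self (ψ x)
    have h1 := hker (c • x) (by rw [norm_smul, hc1, one_mul]; exact hx.le) (by
      have hx0 : e x ω = 0 := LinearMap.mem_ker.mp x.2
      rw [map_smul, smul_apply, hx0, smul_zero])
    rw [map_smul, smul_eq_mul, ← hc, Complex.ofReal_re] at h1
    exact h1
  -- The extension g has norm at most ε/2, and ψ - g vanishes on the kernel of ω, so it is a
  -- multiple of ω. Thus ψ is within ε/2 of the predual.
  obtain ⟨g, hg, hgn⟩ := exists_extension_norm_eq K (ψ.comp K.subtypeL)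
  have hle : (J ω).ker ≤ (ψ - g).ker := by
    intro x hx
    have := hg ⟨x, hx⟩
    rw [LinearMap.mem_ker]
    show ψ x - g x = 0
    rw [this]
    exact sub_self _
  have hspan := mem_span_of_iInf_ker_le_ker (ι := Unit) (L := fun _ => (J ω).toLinearMap)
    (K := (ψ - g).toLinearMap) (by rw [iInf_const]; exact hle)
  rw [Set.range_const, Submodule.mem_span_singleton] at hspan
  obtain ⟨c, hc⟩ := hspan
  refine ⟨J (c • ω), ⟨_, rfl⟩, ?_⟩
  have hd : ψ - J (c • ω) = g := by
    ext x
    have := LinearMap.congr_fun hc x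
    simp only [LinearMap.smul_apply, ContinuousLinearMap.coe_coe, sub_apply]
      at this
    rw [map_smul, sub_apply, smul_apply, this]
    abel
  rw [dist_eq_norm, hd, hgn]
  linarith

end WeakStar

/-! ### Elementary properties of normal faithful states and of real and imaginary parts -/

namespace NormalFaithfulState

variable {M P : Type*} [JBStarAlgebra M] [NormedAddCommGroup P] [NormedSpace ℂ P]
  {e : M ≃ₗᵢ[ℂ] StrongDual ℂ P} (φ : NormalFaithfulState e)

theorem tendsto_toDual {ι : Type*} {𝒰 : Filter ι} {f : ι → M} {l : M}
    (h : WeakStarTendsto e f 𝒰 l) : Tendsto (fun i => φ.toDual (f i)) 𝒰 (𝓝 (φ.toDual l)) := by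
  obtain ⟨ω, hω⟩ := φ.normal
  rw [← hω]
  exact h ω

theorem norm_toDual_le (x : M) : ‖φ.toDual x‖ ≤ ‖x‖ := by
  simpa [φ.norm_eq_one] using φ.toDual.le_opNorm x

theorem re_toDual_le (x : M) : (φ.toDual x).re ≤ ‖x‖ :=
  (Complex.re_le_norm _).trans (φ.norm_toDual_le x)

theorem im_toDual_eq_zero {a : M} (ha : IsSelfAdjoint a) : (φ.toDual a).im = 0 := by
  obtain ⟨b, c, hb, hc, rfl⟩ := exists_sq_sub_sq ha
  rw [map_sub, Complex.sub_im, φ.sq_im hb, φ.sq_im hc, sub_zero]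

theorem toDual_star (x : M) : φ.toDual (star x) = (starRingEnd ℂ) (φ.toDual x) := by
  obtain ⟨a, b, ha, hb, rfl⟩ : ∃ a b : M, IsSelfAdjoint a ∧ IsSelfAdjoint b ∧
      x = a + Complex.I • b :=
    ⟨realPart x, imaginaryPart x, (realPart x).2, (imaginaryPart x).2,
      (realPart_add_I_smul_imaginaryPart x).symm⟩
  have h1 := φ.im_toDual_eq_zero ha
  have h2 := φ.im_toDual_eq_zero hb
  simp only [star_add, star_smul, ha.star_eq, hb.star_eq, map_add, map_smul, smul_eq_mul]
  apply Complex.ext <;> simp [h1, h2]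

end NormalFaithfulState

section

variable {M : Type*} [JBStarAlgebra M]

theorem norm_realPart_le (x : M) : ‖(realPart x : M)‖ ≤ ‖x‖ := by
  rw [realPart_apply_coe]
  refine (norm_smul_le _ _).trans ?_
  have := norm_add_le x (star x)
  rw [JBStarAlgebra.norm_star'] at this
  norm_num
  linarith

theorem norm_imaginaryPart_le (x : M) : ‖(imaginaryPart x : M)‖ ≤ ‖x‖ := by
  rw [imaginaryPart_apply_coe, norm_smul, norm_neg, Complex.norm_I, one_mul]
  refine (norm_smul_le _ _).trans ?_
  have := norm_sub_le x (star x)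
  rw [JBStarAlgebra.norm_star'] at this
  norm_num
  linarith

theorem norm_mul_self {x : M} (hx : IsSelfAdjoint x) : ‖x * x‖ = ‖x‖ ^ 2 := by
  refine le_antisymm ((JBStarAlgebra.norm_mul_le' x x).trans_eq (sq _).symm) ?_
  have h := sq_norm_le_of_assoc (x := x) (by rw [hx.star_eq, mul_comm])
  rwa [hx.star_eq] at h

/-! ### Peirce decomposition -/

/-- The operator L = L_p satisfies L(2L - 1)(L - 1) = 0, so its only possible eigenvalues are 0, 1/2
and 1. -/
theorem peirce_cubic {p : M} (hp : p * p = p) (b : M) :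
    (2 : ℂ) • (p * (p * (p * b))) - (3 : ℂ) • (p * (p * b)) + p * b = 0 := by
  have h := jordan_linearized p p b p
  rw [mul_comm b p, hp, mul_comm (p * b) p, hp, mul_comm b p] at h
  rw [← h]
  module

theorem peirce_zero_sq {p b : M} (hp : p * p = p) (hb : p * b = 0) : p * (b * b) = 0 := by
  have h := jordan_linearized p p b b
  rw [mul_comm b p, hp, hb] at h
  simpa using h

/-- The square of an element of the Peirce 1/2-space has no component in that space: only the
eigenvalues 0 and 1 of L_p occur on it. -/
theorem peirce_half_sq {p c : M} (hp : p * p = p) (hc : p * c = (1 / 2 : ℂ) • c) :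
    p * (p * (c * c)) = p * (c * c) := by
  have h := jordan_linearized c c p p
  rw [mul_comm c p, hp, hc, mul_comm (c * c) p] at h
  simp only [smul_mul_assoc, mul_smul_comm, mul_comm c p, hc] at h
  rw [← sub_eq_zero, ← h]
  module

/-- Orthogonality gives (p + c)² = p + c², and c² satisfies the same hypotheses as c. Repeated
squaring bounds every ‖p + c‖^(2^k) by 2, which is impossible if ‖p + c‖ > 1. -/
theorem norm_add_le_one_of_peirce_zero {p c : M} (hp : p * p = p) (hps : IsSelfAdjoint p)
    (hp1 : ‖p‖ ≤ 1) (hcs : IsSelfAdjoint c) (hc1 : ‖c‖ ≤ 1) (hc : p * c = 0) : ‖p + c‖ ≤ 1 := by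
  have key : ∀ (k : ℕ) (c : M), IsSelfAdjoint c → ‖c‖ ≤ 1 → p * c = 0 →
      ‖p + c‖ ^ (2 ^ k) ≤ 2 := by
    intro k
    induction k with
    | zero =>
      intro c _ hc1 _
      rw [pow_zero, pow_one]
      linarith [norm_add_le p c]
    | succ k ih =>
      intro c hcs hc1 hc
      have h1 : (p + c) * (p + c) = p + c * c := by
        rw [add_mul, mul_add, mul_add, hp, hc, mul_comm c p, hc]
        abel
      have h2 := ih (c * c) (by rw [IsSelfAdjoint, star_mul, hcs.star_eq])
        ((JBStarAlgebra.norm_mul_le' c c).trans (mul_le_one₀ hc1 (norm_nonneg c) hc1))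
        (peirce_zero_sq hp hc)
      rw [← h1, norm_mul_self (hps.add hcs), ← pow_mul, ← pow_succ'] at h2
      exact h2
  by_contra! hlt
  obtain ⟨n, hn⟩ := pow_unbounded_of_one_lt 2 hlt
  have := key n c hcs hc1 hc
  have h2 : ‖p + c‖ ^ n ≤ ‖p + c‖ ^ (2 ^ n) := pow_le_pow_right₀ hlt.le Nat.lt_two_pow_self.le
  linarith

end

/-! ### Existence of the unit -/

namespace NormalFaithfulState

variable {M P : Type*} [JBStarAlgebra M] [NormedAddCommGroup P] [NormedSpace ℂ P]
  {e : M ≃ₗᵢ[ℂ] StrongDual ℂ P} (φ : NormalFaithfulState e)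

/-- A normal state attains its norm at a selfadjoint element. -/
theorem exists_isSelfAdjoint_toDual_eq_one :
    ∃ a : M, IsSelfAdjoint a ∧ ‖a‖ ≤ 1 ∧ (φ.toDual a).re = 1 := by
  have h1 : ∀ n : ℕ, ∃ y : M, ‖y‖ ≤ 1 ∧ 1 - 1 / ((n : ℝ) + 1) ≤ (φ.toDual y).re := by
    intro n
    have hpos : 0 < 1 / ((n : ℝ) + 1) := by positivity
    obtain ⟨x, hx1, hx2⟩ := φ.toDual.exists_lt_apply_of_lt_opNorm
      (r := 1 - 1 / ((n : ℝ) + 1)) (by rw [φ.norm_eq_one]; linarith)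
    obtain ⟨c, hc1, hc⟩ := Complex.exists_norm_eq_mul_self (φ.toDual x)
    refine ⟨c • x, by rw [norm_smul, hc1, one_mul]; exact hx1.le, ?_⟩
    rw [map_smul, smul_eq_mul, ← hc, Complex.ofReal_re]
    exact hx2.le
  choose y hy1 hy2 using h1
  -- Weak* compactness and normality produce a maximizer from a maximizing sequence. Its real part
  -- is a maximizer too, because φ is real on selfadjoint elements.
  obtain ⟨l, hl⟩ := exists_weakStarTendsto e (hyperfilter ℕ) y (.of_forall hy1)
  have hl1 : ‖l‖ ≤ 1 := hl.norm_le zero_le_one (.of_forall hy1)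
  have hre : 1 ≤ (φ.toDual l).re := by
    have ha : Tendsto (fun n => (φ.toDual (y n)).re) (hyperfilter ℕ) (𝓝 (φ.toDual l).re) :=
      (Complex.continuous_re.tendsto _).comp (φ.tendsto_toDual hl)
    have hb : Tendsto (fun n : ℕ => 1 - 1 / ((n : ℝ) + 1)) (hyperfilter ℕ) (𝓝 (1 - 0)) :=
      (tendsto_const_nhds.sub tendsto_one_div_add_atTop_nhds_zero_nat).mono_left
        Nat.hyperfilter_le_atTop
    rw [sub_zero] at hb
    exact le_of_tendsto_of_tendsto' hb ha hy2
  refine ⟨realPart l, (realPart l).2, (norm_realPart_le l).trans hl1, ?_⟩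
  have h2 : (φ.toDual l).re = (φ.toDual (realPart l : M)).re := by
    conv_lhs => rw [← realPart_add_I_smul_imaginaryPart l]
    have := φ.im_toDual_eq_zero (imaginaryPart l).2
    simp [this]
  refine le_antisymm ?_ (h2 ▸ hre)
  exact (φ.re_toDual_le _).trans ((norm_realPart_le l).trans hl1)

/-- A JBW*-algebra with a normal faithful state is unital. -/
theorem exists_unit : ∃ u : M, IsSelfAdjoint u ∧ ‖u‖ ≤ 1 ∧ φ.toDual u = 1 ∧ ∀ x, u * x = x := by
  obtain ⟨p, hps, hp1, hpφ⟩ := φ.exists_isSelfAdjoint_toDual_eq_one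
  -- As φ(p²) and φ(p⁴) are at most 1 and φ(p³) ≥ 1, one gets φ((p - p²)²) ≤ 1 - 2 + 1 = 0, and
  -- faithfulness applies.
  have hp : p * p = p := by
    have hs2 : IsSelfAdjoint (p * p) := by rw [IsSelfAdjoint, star_mul, hps.star_eq]
    have hsd : IsSelfAdjoint (p - p * p) := hps.sub hs2
    have h3 : 1 ≤ (φ.toDual (p * (p * p))).re := by
      have h := (φ.re_toDual_le _).trans (norm_three_smul_sub_cube_le hps hp1)
      rw [map_sub, ← Complex.coe_smul, map_smul, Complex.sub_re] at h
      simp [hpφ] at h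
      linarith
    have hn2 : ‖p * p‖ ≤ 1 :=
      (JBStarAlgebra.norm_mul_le' p p).trans (mul_le_one₀ hp1 (norm_nonneg p) hp1)
    have h2 : (φ.toDual (p * p)).re ≤ 1 := (φ.re_toDual_le _).trans hn2
    have h4 : (φ.toDual ((p * p) * (p * p))).re ≤ 1 := (φ.re_toDual_le _).trans
      ((JBStarAlgebra.norm_mul_le' _ _).trans (mul_le_one₀ hn2 (norm_nonneg _) hn2))
    have h0 := φ.positive _ ⟨_, hsd, rfl⟩
    have hz : φ.toDual ((p - p * p) * (p - p * p)) = 0 := by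
      refine Complex.ext (le_antisymm ?_ h0.1) h0.2
      have hexp : (p - p * p) * (p - p * p) =
          p * p - (2 : ℂ) • (p * (p * p)) + (p * p) * (p * p) := by
        rw [sub_mul, mul_sub, mul_sub, mul_comm (p * p) p]
        module
      rw [hexp]
      simp
      linarith
    exact (sub_eq_zero.mp (φ.eq_zero_of_sq hsd hz)).symm
  -- For a small multiple c of b, ‖p + c²‖ ≤ 1 gives 1 + φ(c²) ≤ 1, hence φ(c²) = 0. The Peirce
  -- 0-space is thus trivial.
  have hzero : ∀ b : M, IsSelfAdjoint b → p * b = 0 → b = 0 := by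
    intro b hb hpb
    set r : ℝ := 1 / (‖b‖ + 1)
    have hr : 0 < r := by positivity
    set c : M := (r : ℂ) • b
    have hc : IsSelfAdjoint c := by
      rw [IsSelfAdjoint, star_smul, hb.star_eq]; simp [c]
    have hpc : p * c = 0 := by rw [mul_smul_comm, hpb, smul_zero]
    have hc1 : ‖c‖ ≤ 1 := by
      rw [norm_smul, Complex.norm_real, Real.norm_of_nonneg hr.le, one_div_mul_eq_div,
        div_le_one (by positivity)]
      linarith
    have hcc := norm_add_le_one_of_peirce_zero hp hps hp1 (c := c * c)
      (by rw [IsSelfAdjoint, star_mul, hc.star_eq])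
      ((JBStarAlgebra.norm_mul_le' c c).trans (mul_le_one₀ hc1 (norm_nonneg c) hc1))
      (peirce_zero_sq hp hpc)
    have h1 := (φ.re_toDual_le _).trans hcc
    rw [map_add, Complex.add_re, hpφ] at h1
    have h2 := φ.positive _ ⟨c, hc, rfl⟩
    have h3 : c = 0 := φ.eq_zero_of_sq hc (Complex.ext (le_antisymm (by simpa using h1) h2.1) h2.2)
    exact (smul_eq_zero.mp h3).resolve_left (by exact_mod_cast hr.ne')
  have hone : ∀ b : M, IsSelfAdjoint b → p * b = b := by
    have hmul : ∀ b : M, IsSelfAdjoint b → IsSelfAdjoint (p * b) := fun b hb => by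
      rw [IsSelfAdjoint, star_mul, hps.star_eq, hb.star_eq, mul_comm]
    have hsm : ∀ (r : ℝ) (b : M), IsSelfAdjoint b → IsSelfAdjoint ((r : ℂ) • b) :=
      fun r b hb => by rw [IsSelfAdjoint, star_smul, hb.star_eq]; simp
    -- By `peirce_cubic` this element lies in the Peirce 0-space, which is trivial. So L_p has only
    -- the eigenvalues 1/2 and 1 left.
    have hquad : ∀ b : M, IsSelfAdjoint b →
        b - (3 : ℂ) • (p * b) + (2 : ℂ) • (p * (p * b)) = 0 := by
      intro b hb
      refine hzero _ ((hb.sub (by simpa using hsm 3 _ (hmul b hb))).add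
        (by simpa using hsm 2 _ (hmul _ (hmul b hb)))) ?_
      rw [mul_add, mul_sub, mul_smul_comm, mul_smul_comm, ← peirce_cubic hp b]
      module
    intro b hb
    set c : M := b - p * b
    have hc : IsSelfAdjoint c := hb.sub (hmul b hb)
    have hpc : p * c = (1 / 2 : ℂ) • c := by
      have := hquad b hb
      rw [← sub_eq_zero, mul_sub, ← neg_eq_zero, ← (smul_eq_zero_iff_right (r := (1 / 2 : ℂ)) (by norm_num)).mpr this]
      module
    have hcs : IsSelfAdjoint (c * c) := by rw [IsSelfAdjoint, star_mul, hc.star_eq]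
    have hcc : p * (c * c) = c * c := by
      have h1 := peirce_half_sq hp hpc
      have h2 := hquad _ hcs
      rw [h1] at h2
      rw [eq_comm, ← sub_eq_zero, ← h2]
      module
    -- L_c commutes with L_{c∘c}. Applied to p, with p ∘ c = c/2 and p ∘ c² = c², this reads c³/2 =
    -- c³. So c³ = 0, and c = 0 by the cubic norm axiom.
    have hj : (c * c) * (p * c) = ((c * c) * p) * c := by
      have h := DFunLike.congr_fun (commute_lmul_lmul_sq c) p
      have h' : c * ((c * c) * p) = (c * c) * (c * p) := h
      rw [mul_comm p c, ← h', mul_comm c]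
    rw [hpc, mul_comm (c * c) p, hcc, mul_smul_comm] at hj
    have h3 : (c * c) * c = 0 := by
      have : (1 / 2 : ℂ) • (c * c * c) = 0 := by
        rw [← sub_eq_zero] at hj
        rw [← neg_eq_zero, ← hj]
        module
      exact (smul_eq_zero.mp this).resolve_left (by norm_num)
    have h4 : c = 0 := by
      have h1 := JBStarAlgebra.norm_jordanTriple' c
      rw [hc.star_eq, jordanTriple, h3] at h1
      simpa using h1.symm
    exact (sub_eq_zero.mp h4).symm
  refine ⟨p, hps, hp1, Complex.ext hpφ (φ.im_toDual_eq_zero hps), fun x => ?_⟩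
  conv_lhs => rw [← realPart_add_I_smul_imaginaryPart x]
  rw [mul_add, mul_smul_comm, hone _ (realPart x).2, hone _ (imaginaryPart x).2,
    realPart_add_I_smul_imaginaryPart x]

end NormalFaithfulState

/-! ### Weak* continuity of the Jordan product under a normal faithful state -/

section

variable {M : Type*} [JBStarAlgebra M]

/-- Second-order Taylor polynomials of `exp (i t y)` are nearly contractive. -/
theorem sq_norm_taylor_le {o y : M} (ho : ∀ x, o * x = x) (hos : IsSelfAdjoint o) (ho1 : ‖o‖ ≤ 1)
    (hy : IsSelfAdjoint y) (t : ℝ) :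
    ‖o + ((t : ℂ) * Complex.I) • y - ((t : ℂ) ^ 2 / 2) • (y * y)‖ ^ 2 ≤
      1 + t ^ 4 / 4 * ‖y‖ ^ 4 := by
  have ho' : ∀ x, x * o = x := fun x => by rw [mul_comm, ho]
  -- The powers of y become independent symbols with a multiplication table; both identities below
  -- are then polynomial identities.
  obtain ⟨y2, h2⟩ : ∃ z, z = jordanPow y 1 := ⟨_, rfl⟩
  obtain ⟨y3, h3⟩ : ∃ z, z = jordanPow y 2 := ⟨_, rfl⟩
  obtain ⟨y4, h4⟩ : ∃ z, z = jordanPow y 3 := ⟨_, rfl⟩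
  obtain ⟨y5, h5⟩ : ∃ z, z = jordanPow y 4 := ⟨_, rfl⟩
  obtain ⟨y6, h6⟩ : ∃ z, z = jordanPow y 5 := ⟨_, rfl⟩
  have m11 : y * y = y2 := h2.symm
  have m12 : y * y2 = y3 := by rw [h2, h3]; rfl
  have m13 : y * y3 = y4 := by rw [h3, h4]; rfl
  have m14 : y * y4 = y5 := by rw [h4, h5]; rfl
  have m22 : y2 * y2 = y4 := by rw [h2, h4, jordanPow_mul_jordanPow]
  have m23 : y2 * y3 = y5 := by rw [h2, h3, h5, jordanPow_mul_jordanPow]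
  have m24 : y2 * y4 = y6 := by rw [h2, h4, h6, jordanPow_mul_jordanPow]
  have m21 : y2 * y = y3 := by rw [mul_comm, m12]
  have m31 : y3 * y = y4 := by rw [mul_comm, m13]
  have m32 : y3 * y2 = y5 := by rw [mul_comm, m23]
  have m41 : y4 * y = y5 := by rw [mul_comm, m14]
  have m42 : y4 * y2 = y6 := by rw [mul_comm, m24]
  have s2 : star y2 = y2 := by rw [h2, star_jordanPow hy]
  rw [m11]
  have hst : star (o + ((t : ℂ) * Complex.I) • y - ((t : ℂ) ^ 2 / 2) • y2) =
      o - ((t : ℂ) * Complex.I) • y - ((t : ℂ) ^ 2 / 2) • y2 := by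
    rw [star_sub, star_add, star_smul, star_smul, hos.star_eq, hy.star_eq, s2]
    have e1 : star ((t : ℂ) * Complex.I) = -((t : ℂ) * Complex.I) := by simp
    have e2 : star ((t : ℂ) ^ 2 / 2) = (t : ℂ) ^ 2 / 2 := by simp
    rw [e1, e2]
    module
  -- This is |1 + is - s²/2|² = 1 + s⁴/4 for real s. The terms of second order cancel, which is the
  -- reason for going up to the second Taylor polynomial.
  have hprod : star (o + ((t : ℂ) * Complex.I) • y - ((t : ℂ) ^ 2 / 2) • y2) *
      (o + ((t : ℂ) * Complex.I) • y - ((t : ℂ) ^ 2 / 2) • y2) =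
      o + ((t : ℂ) ^ 4 / 4) • y4 := by
    rw [hst]
    simp only [sub_mul, add_mul, mul_add, mul_sub, smul_mul_assoc, mul_smul_comm, ho, ho', m11,
      m12, m21, m22]
    match_scalars <;> ring_nf <;> simp only [Complex.I_sq] <;> ring
  have hassoc : (o + ((t : ℂ) * Complex.I) • y - ((t : ℂ) ^ 2 / 2) • y2) *
      (o + ((t : ℂ) * Complex.I) • y - ((t : ℂ) ^ 2 / 2) • y2) *
      star (o + ((t : ℂ) * Complex.I) • y - ((t : ℂ) ^ 2 / 2) • y2) =
      (o + ((t : ℂ) * Complex.I) • y - ((t : ℂ) ^ 2 / 2) • y2) *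
      (star (o + ((t : ℂ) * Complex.I) • y - ((t : ℂ) ^ 2 / 2) • y2) *
      (o + ((t : ℂ) * Complex.I) • y - ((t : ℂ) ^ 2 / 2) • y2)) := by
    rw [hprod, hst]
    simp only [sub_mul, add_mul, mul_add, mul_sub, smul_mul_assoc, mul_smul_comm, ho, ho', m11,
      m12, m21, m22, m13, m31, m14, m41, m23, m32, m24, m42]
    match_scalars <;> ring_nf <;> simp only [Complex.I_sq, Complex.I_pow_three] <;> ring
  refine (sq_norm_le_of_assoc hassoc).trans ?_
  rw [hprod]
  refine (norm_add_le _ _).trans (add_le_add ho1 ?_)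
  rw [norm_smul, h4]
  have e3 : ‖(t : ℂ) ^ 4 / 4‖ = t ^ 4 / 4 := by
    rw [norm_div, norm_pow, Complex.norm_real, Real.norm_eq_abs, Even.pow_abs ⟨2, rfl⟩]
    norm_num
  rw [e3]
  exact mul_le_mul_of_nonneg_left (norm_jordanPow_le y 3) (by positivity)

end

namespace NormalFaithfulState

variable {M P : Type*} [JBStarAlgebra M] [NormedAddCommGroup P] [NormedSpace ℂ P]
  {e : M ≃ₗᵢ[ℂ] StrongDual ℂ P} (φ : NormalFaithfulState e)

/-- Lower semicontinuity of `y ↦ φ (y* ∘ y)` along weak* convergent selfadjoint families. -/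
theorem re_star_mul_self_le_of_tendsto {ι : Type*} {𝒰 : Ultrafilter ι} {y : ι → M} {l : M}
    {R L : ℝ} (hy : ∀ i, IsSelfAdjoint (y i)) (hR : ∀ i, ‖y i‖ ≤ R)
    (hl : WeakStarTendsto e y 𝒰 l)
    (hL : Tendsto (fun i => (φ.toDual (y i * y i)).re) 𝒰 (𝓝 L)) :
    (φ.toDual (star l * l)).re ≤ L := by
  obtain ⟨o, hos, ho1, hoφ, ho⟩ := φ.exists_unit
  have ho' : ∀ x, x * o = x := fun x => by rw [mul_comm, ho]
  obtain ⟨i₀⟩ : Nonempty ι := by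
    by_contra h
    rw [not_nonempty_iff] at h
    exact 𝒰.neBot.ne (Filter.filter_eq_bot_of_isEmpty _)
  have hR0 : 0 ≤ R := (norm_nonneg _).trans (hR i₀)
  -- The limit w of the squares need not be the square of l. Only Re φ(w) = L is needed.
  obtain ⟨w, hw⟩ := exists_weakStarTendsto e 𝒰 (fun i => y i * y i) (R := R * R)
    (.of_forall fun i => (JBStarAlgebra.norm_mul_le' _ _).trans
      (mul_le_mul (hR i) (hR i) (norm_nonneg _) hR0))
  have hLw : (φ.toDual w).re = L :=
    tendsto_nhds_unique ((Complex.continuous_re.tendsto _).comp (φ.tendsto_toDual hw)) hL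
  have hlim : (φ.toDual l).im = 0 := by
    refine tendsto_nhds_unique ((Complex.continuous_im.tendsto _).comp (φ.tendsto_toDual hl)) ?_
    refine tendsto_const_nhds.congr fun i => ?_
    exact (φ.im_toDual_eq_zero (hy i)).symm
  set A : ℝ := (Complex.I * (φ.toDual (star l * w) - φ.toDual (star w * l)) / 2).re
  set D : ℝ := (φ.toDual (star w * w) / 4).re - R ^ 4 / 4
  -- Let u be the weak* limit of the Taylor polynomials. Then φ(u* ∘ u) ≤ ‖u‖² ≤ 1 + t⁴R⁴/4. In the
  -- expansion of the left side the constant is 1, the linear term vanishes because φ(l) is real,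
  -- and the t²-coefficient is φ(l* ∘ l) - L.
  have key : ∀ t : ℝ, t ^ 2 * ((φ.toDual (star l * l)).re - L) + t ^ 3 * A + t ^ 4 * D ≤ 0 := by
    intro t
    have hu : WeakStarTendsto e (fun i => o + ((t : ℂ) * Complex.I) • y i -
        ((t : ℂ) ^ 2 / 2) • (y i * y i)) 𝒰
        (o + ((t : ℂ) * Complex.I) • l - ((t : ℂ) ^ 2 / 2) • w) :=
      ((WeakStarTendsto.const o).add (hl.smul _)).sub (hw.smul _)
    have hb : ∀ i, ‖o + ((t : ℂ) * Complex.I) • y i - ((t : ℂ) ^ 2 / 2) • (y i * y i)‖ ≤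
        √(1 + t ^ 4 / 4 * R ^ 4) := by
      intro i
      refine Real.le_sqrt_of_sq_le ((sq_norm_taylor_le ho hos ho1 (hy i) t).trans ?_)
      gcongr
      exact hR i
    have hn := hu.norm_le (Real.sqrt_nonneg _) (.of_forall hb)
    set u := o + ((t : ℂ) * Complex.I) • l - ((t : ℂ) ^ 2 / 2) • w
    have h1 : (φ.toDual (star u * u)).re ≤ 1 + t ^ 4 / 4 * R ^ 4 := by
      refine (φ.re_toDual_le _).trans ((JBStarAlgebra.norm_mul_le' _ _).trans ?_)
      rw [JBStarAlgebra.norm_star', ← sq]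
      calc ‖u‖ ^ 2 ≤ √(1 + t ^ 4 / 4 * R ^ 4) ^ 2 := by gcongr
        _ = _ := Real.sq_sqrt (by positivity)
    have h2 : star u = o - ((t : ℂ) * Complex.I) • star l - ((t : ℂ) ^ 2 / 2) • star w := by
      have e1 : star ((t : ℂ) * Complex.I) = -((t : ℂ) * Complex.I) := by simp
      have e2 : star ((t : ℂ) ^ 2 / 2) = (t : ℂ) ^ 2 / 2 := by simp
      rw [star_sub, star_add, star_smul, star_smul, hos.star_eq, e1, e2]
      module
    have h3 : φ.toDual (star u * u) = 1 + ((t : ℂ) * Complex.I) * (φ.toDual l - φ.toDual (star l))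
        + (t : ℂ) ^ 2 * (φ.toDual (star l * l) - (φ.toDual w + φ.toDual (star w)) / 2)
        + (t : ℂ) ^ 3 * (Complex.I * (φ.toDual (star l * w) - φ.toDual (star w * l)) / 2)
        + (t : ℂ) ^ 4 * (φ.toDual (star w * w) / 4) := by
      rw [h2]
      simp only [u, sub_mul, add_mul, mul_add, mul_sub, smul_mul_assoc, mul_smul_comm, ho, ho',
        map_add, map_sub, map_smul, smul_eq_mul, hoφ]
      linear_combination (-(t : ℂ) ^ 2 * φ.toDual (star l * l)) * Complex.I_mul_I
    have h4 : (φ.toDual (star u * u)).re = 1 + t ^ 2 * ((φ.toDual (star l * l)).re - L) +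
        t ^ 3 * A + t ^ 4 * (φ.toDual (star w * w) / 4).re := by
      rw [h3, φ.toDual_star, φ.toDual_star, Complex.sub_conj, Complex.add_conj, hlim, hLw]
      have c2 : ((t : ℂ) ^ 2) = ((t ^ 2 : ℝ) : ℂ) := by push_cast; rfl
      have c3 : ((t : ℂ) ^ 3) = ((t ^ 3 : ℝ) : ℂ) := by push_cast; rfl
      have c4 : ((t : ℂ) ^ 4) = ((t ^ 4 : ℝ) : ℂ) := by push_cast; rfl
      rw [c2, c3, c4]
      simp only [Complex.add_re, Complex.re_ofReal_mul, Complex.sub_re, A]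
      simp
    simp only [D]
    rw [h4] at h1
    linarith
  by_contra! hlt
  set d := (φ.toDual (star l * l)).re - L
  have hd : 0 < d := by simp only [d]; linarith
  have hle : ∀ᶠ t : ℝ in 𝓝[>] 0, d + t * A + t ^ 2 * D ≤ 0 := by
    filter_upwards [self_mem_nhdsWithin] with t ht
    have ht' : (0 : ℝ) < t := ht
    have := key t
    have h5 : t ^ 2 * d + t ^ 3 * A + t ^ 4 * D = t ^ 2 * (d + t * A + t ^ 2 * D) := by ring
    rw [h5] at this
    by_contra! hc
    have : 0 < t ^ 2 * (d + t * A + t ^ 2 * D) := by positivity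
    linarith
  have ht : Tendsto (fun t : ℝ => d + t * A + t ^ 2 * D) (𝓝[>] 0) (𝓝 (d + 0 * A + 0 ^ 2 * D)) := by
    refine Tendsto.mono_left ?_ nhdsWithin_le_nhds
    exact Continuous.tendsto (by fun_prop) 0
  have := le_of_tendsto ht hle
  simp at this
  linarith

/-- Lower semicontinuity applied to y_i + sc for all real s, of both signs, compares two affine
functions of s. One can lie below the other on the whole line only if the slopes agree. -/
theorem tendsto_re_mul_of_isSelfAdjoint {ι : Type*} {𝒰 : Ultrafilter ι} {y : ι → M} {l c : M}
    {R : ℝ} (hy : ∀ i, IsSelfAdjoint (y i)) (hR : ∀ i, ‖y i‖ ≤ R)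
    (hl : WeakStarTendsto e y 𝒰 l) (hc : IsSelfAdjoint c) :
    Tendsto (fun i => (φ.toDual (c * y i)).re) 𝒰 (𝓝 (φ.toDual (c * l)).re) := by
  obtain ⟨i₀⟩ : Nonempty ι := by
    by_contra h
    rw [not_nonempty_iff] at h
    exact 𝒰.neBot.ne (Filter.filter_eq_bot_of_isEmpty _)
  have hR0 : 0 ≤ R := (norm_nonneg _).trans (hR i₀)
  have habs : ∀ x : M, |(φ.toDual x).re| ≤ ‖x‖ := fun x =>
    (Complex.abs_re_le_norm _).trans (φ.norm_toDual_le x)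
  obtain ⟨L, hL⟩ := exists_ultrafilter_tendsto (𝒰 := 𝒰)
    (f := fun i => (φ.toDual (y i * y i)).re) (R := R * R) fun i => (habs _).trans
      ((JBStarAlgebra.norm_mul_le' _ _).trans (mul_le_mul (hR i) (hR i) (norm_nonneg _) hR0))
  obtain ⟨m, hm⟩ := exists_ultrafilter_tendsto (𝒰 := 𝒰)
    (f := fun i => (φ.toDual (c * y i)).re) (R := ‖c‖ * R) fun i => (habs _).trans
      ((JBStarAlgebra.norm_mul_le' _ _).trans (mul_le_mul_of_nonneg_left (hR i) (norm_nonneg _)))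
  have key : ∀ s : ℝ, (φ.toDual (star l * l)).re + 2 * s * (φ.toDual (c * l)).re ≤
      L + 2 * s * m := by
    intro s
    have hsc : IsSelfAdjoint ((s : ℂ) • c) := by
      rw [IsSelfAdjoint, star_smul, hc.star_eq]; simp
    have hexp : ∀ i, φ.toDual ((y i + (s : ℂ) • c) * (y i + (s : ℂ) • c)) =
        φ.toDual (y i * y i) + ((2 * s : ℝ) : ℂ) * φ.toDual (c * y i) +
          ((s ^ 2 : ℝ) : ℂ) * φ.toDual (c * c) := by
      intro i
      simp only [add_mul, mul_add, smul_mul_assoc, mul_smul_comm, map_add, map_smul, smul_eq_mul,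
        mul_comm (y i) c]
      push_cast
      ring
    have h1 := φ.re_star_mul_self_le_of_tendsto (𝒰 := 𝒰) (y := fun i => y i + (s : ℂ) • c)
      (l := l + (s : ℂ) • c) (R := R + ‖(s : ℂ) • c‖) (L := L + 2 * s * m +
        s ^ 2 * (φ.toDual (c * c)).re)
      (fun i => (hy i).add hsc)
      (fun i => (norm_add_le _ _).trans (add_le_add_left (hR i) _))
      (hl.add (WeakStarTendsto.const _)) (by
        simp_rw [hexp, Complex.add_re, Complex.re_ofReal_mul]
        exact (hL.add (hm.const_mul _)).add tendsto_const_nhds)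
    have h2 : (φ.toDual (star (l + (s : ℂ) • c) * (l + (s : ℂ) • c))).re =
        (φ.toDual (star l * l)).re + 2 * s * (φ.toDual (c * l)).re +
          s ^ 2 * (φ.toDual (c * c)).re := by
      have h3 : φ.toDual (star l * c) = (starRingEnd ℂ) (φ.toDual (c * l)) := by
        rw [← φ.toDual_star, star_mul, hc.star_eq]
      have h4 : star (s : ℂ) = (s : ℂ) := by simp
      simp only [star_add, star_smul, hc.star_eq, h4, add_mul, mul_add, smul_mul_assoc,
        mul_smul_comm, map_add, map_smul, smul_eq_mul, h3]
      simp
      ring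
    rw [h2] at h1
    linarith
  have heq : (φ.toDual (c * l)).re = m := by
    set d := (φ.toDual (star l * l)).re - L
    set g := (φ.toDual (c * l)).re - m
    have h1 : ∀ s : ℝ, d + 2 * s * g ≤ 0 := fun s => by
      have := key s
      simp only [d, g]
      linarith
    have hg : g = 0 := by
      by_contra hg
      have := h1 ((1 - d) / (2 * g))
      have h2 : 2 * ((1 - d) / (2 * g)) * g = 1 - d := by field_simp
      linarith
    simp only [g] at hg
    linarith
  rw [heq]
  exact hm

/-- A purely imaginary weak* limit of selfadjoint elements vanishes. -/
theorem re_mul_self_le_of_tendsto_I_smul (d : M) (hd : IsSelfAdjoint d) (k : ℕ) :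
    ∀ {ι : Type*} {𝒰 : Ultrafilter ι} {y : ι → M} {R L : ℝ}, (∀ i, IsSelfAdjoint (y i)) →
    (∀ i, ‖y i‖ ≤ R) → WeakStarTendsto e y 𝒰 (Complex.I • d) →
    Tendsto (fun i => (φ.toDual (y i * y i)).re) 𝒰 (𝓝 L) →
    (φ.toDual (d * d)).re ≤ L / 2 ^ k := by
  induction k with
  | zero =>
    intro ι 𝒰 y R L hy hR hl hL
    have := φ.re_star_mul_self_le_of_tendsto hy hR hl hL
    simp only [star_smul, hd.star_eq, smul_mul_assoc, mul_smul_comm, smul_smul] at this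
    simpa using this
  | succ k ih =>
    intro ι 𝒰 y R L hy hR hl hL
    -- An iterated limit, first in j and then in i. The averages (y_i + y_j)/2 have the same weak*
    -- limit i·d, but the limit of φ of their squares is L/2 instead of L.
    set 𝒱 : Ultrafilter (ι × ι) := 𝒰.bind fun i => 𝒰.map fun j => (i, j)
    have h𝒱 : ∀ {p : ι × ι → Prop}, (∀ᶠ i in (𝒰 : Filter ι), ∀ᶠ j in (𝒰 : Filter ι), p (i, j)) →
        ∀ᶠ q in (𝒱 : Filter (ι × ι)), p q := fun {p} h => h
    have hfst : Tendsto Prod.fst (𝒱 : Filter (ι × ι)) 𝒰 := by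
      intro s hs
      refine h𝒱 (p := fun q => q.1 ∈ s) ?_
      filter_upwards [hs] with i hi using Eventually.of_forall fun _ => hi
    have hsnd : Tendsto Prod.snd (𝒱 : Filter (ι × ι)) 𝒰 := by
      intro s hs
      exact h𝒱 (p := fun q => q.2 ∈ s) (Eventually.of_forall fun _ => hs)
    have hsm : ∀ x : M, IsSelfAdjoint x → IsSelfAdjoint ((1 / 2 : ℂ) • x) := fun x hx => by
      rw [IsSelfAdjoint, star_smul, hx.star_eq]; simp
    -- For fixed i, the limit in j is the real part of i·φ(y_i ∘ d), and φ(y_i ∘ d) is real.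
    have hcross : Tendsto (fun q : ι × ι => (φ.toDual (y q.1 * y q.2)).re) 𝒱 (𝓝 0) := by
      rw [Metric.tendsto_nhds]
      intro ε hε
      refine h𝒱 (Eventually.of_forall fun i => ?_)
      have h1 := φ.tendsto_re_mul_of_isSelfAdjoint hy hR hl (hy i)
      have h2 : (φ.toDual (y i * Complex.I • d)).re = 0 := by
        rw [mul_smul_comm, map_smul]
        simp [φ.mul_im (hy i) hd]
      rw [h2] at h1
      exact (Metric.tendsto_nhds.mp h1) ε hε
    have h1 := ih (𝒰 := 𝒱) (y := fun q => (1 / 2 : ℂ) • y q.1 + (1 / 2 : ℂ) • y q.2) (R := R)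
      (L := (L + 2 * 0 + L) / 4)
      (fun q => (hsm _ (hy _)).add (hsm _ (hy _)))
      (fun q => by
        refine (norm_add_le _ _).trans ?_
        rw [norm_smul, norm_smul]
        norm_num
        linarith [hR q.1, hR q.2])
      (by
        have h2 : WeakStarTendsto e (fun q : ι × ι => (1 / 2 : ℂ) • y q.1 + (1 / 2 : ℂ) • y q.2)
            𝒱 ((1 / 2 : ℂ) • (Complex.I • d) + (1 / 2 : ℂ) • (Complex.I • d)) :=
          (WeakStarTendsto.smul _ fun ω => (hl ω).comp hfst).add
            (WeakStarTendsto.smul _ fun ω => (hl ω).comp hsnd)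
        convert h2 using 1
        module)
      (by
        have h3 : ∀ q : ι × ι, (φ.toDual (((1 / 2 : ℂ) • y q.1 + (1 / 2 : ℂ) • y q.2) *
            ((1 / 2 : ℂ) • y q.1 + (1 / 2 : ℂ) • y q.2))).re =
            ((φ.toDual (y q.1 * y q.1)).re + 2 * (φ.toDual (y q.1 * y q.2)).re +
              (φ.toDual (y q.2 * y q.2)).re) / 4 := by
          intro q
          have h4 : ((1 / 2 : ℂ) • y q.1 + (1 / 2 : ℂ) • y q.2) *
              ((1 / 2 : ℂ) • y q.1 + (1 / 2 : ℂ) • y q.2) =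
              ((1 / 4 : ℝ) : ℂ) • (y q.1 * y q.1) + ((1 / 2 : ℝ) : ℂ) • (y q.1 * y q.2) +
                ((1 / 4 : ℝ) : ℂ) • (y q.2 * y q.2) := by
            simp only [add_mul, mul_add, smul_mul_assoc, mul_smul_comm, mul_comm (y q.2) (y q.1)]
            push_cast
            module
          rw [h4]
          simp only [map_add, map_smul, Complex.add_re, smul_eq_mul, Complex.re_ofReal_mul]
          ring
        simp_rw [h3]
        exact (((hL.comp hfst).add (hcross.const_mul 2)).add (hL.comp hsnd)).div_const 4)
    refine h1.trans_eq ?_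
    rw [pow_succ]
    field_simp
    ring

/-- After subtraction of the real part of l, the limit is purely imaginary, say i·d. Then φ(d ∘ d) ≤
L/2^k for all k, so d = 0 by faithfulness. -/
theorem isSelfAdjoint_of_tendsto (φ : NormalFaithfulState e) {ι : Type*} {𝒰 : Ultrafilter ι} {y : ι → M} {l : M}
    {R : ℝ} (hy : ∀ i, IsSelfAdjoint (y i)) (hR : ∀ i, ‖y i‖ ≤ R)
    (hl : WeakStarTendsto e y 𝒰 l) : IsSelfAdjoint l := by
  have hdec := realPart_add_I_smul_imaginaryPart l
  have ha : IsSelfAdjoint (realPart l : M) := (realPart l).2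
  have hd : IsSelfAdjoint (imaginaryPart l : M) := (imaginaryPart l).2
  generalize (realPart l : M) = a at *
  generalize (imaginaryPart l : M) = d at *
  have hR' : ∀ i, ‖y i - a‖ ≤ R + ‖a‖ := fun i =>
    (norm_sub_le _ _).trans (add_le_add_left (hR i) _)
  have hl' : WeakStarTendsto e (fun i => y i - a) 𝒰 (Complex.I • d) := by
    have := hl.sub (WeakStarTendsto.const a)
    rwa [← hdec, add_sub_cancel_left] at this
  obtain ⟨L, hL⟩ := exists_ultrafilter_tendsto (𝒰 := 𝒰)
    (f := fun i => (φ.toDual ((y i - a) * (y i - a))).re) (R := (R + ‖a‖) * (R + ‖a‖)) fun i =>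
      ((Complex.abs_re_le_norm _).trans (φ.norm_toDual_le _)).trans
      ((JBStarAlgebra.norm_mul_le' _ _).trans (mul_le_mul (hR' i) (hR' i) (norm_nonneg _)
        ((norm_nonneg _).trans (hR' i))))
  have h0 : (φ.toDual (d * d)).re ≤ 0 := by
    refine ge_of_tendsto' (f := fun k : ℕ => L / 2 ^ k) (x := atTop) ?_ fun k =>
      φ.re_mul_self_le_of_tendsto_I_smul d hd k (fun i => (hy i).sub ha) hR' hl' hL
    exact tendsto_const_nhds.div_atTop (tendsto_pow_atTop_atTop_of_one_lt one_lt_two)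
  have hp := φ.positive _ ⟨d, hd, rfl⟩
  have hd0 : d = 0 := φ.eq_zero_of_sq hd (Complex.ext (le_antisymm h0 hp.1) hp.2)
  rw [hd0, smul_zero, add_zero] at hdec
  rw [← hdec]
  exact ha

theorem tendsto_mul_of_isSelfAdjoint {ι : Type*} {𝒰 : Ultrafilter ι} {y : ι → M} {l c : M}
    {R : ℝ} (hy : ∀ i, IsSelfAdjoint (y i)) (hR : ∀ i, ‖y i‖ ≤ R)
    (hl : WeakStarTendsto e y 𝒰 l) (hc : IsSelfAdjoint c) :
    Tendsto (fun i => φ.toDual (c * y i)) 𝒰 (𝓝 (φ.toDual (c * l))) := by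
  have h1 := φ.tendsto_re_mul_of_isSelfAdjoint hy hR hl hc
  have hls := φ.isSelfAdjoint_of_tendsto hy hR hl
  have h2 : ∀ x : M, IsSelfAdjoint x → φ.toDual (c * x) = ((φ.toDual (c * x)).re : ℂ) :=
    fun x hx => Complex.ext rfl (by rw [Complex.ofReal_im, φ.mul_im hc hx])
  rw [h2 l hls]
  exact ((Complex.continuous_ofReal.tendsto _).comp h1).congr fun i => (h2 _ (hy i)).symm

/-- The functionals `φ (x ∘ ·)` are normal. -/
theorem exists_predual_translate [CompleteSpace P] (x : M) :
    ∃ ω : P, predualInclusion e ω = φ.translate x := by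
  suffices h : ∀ c : M, IsSelfAdjoint c → ∃ ω : P, predualInclusion e ω = φ.translate c by
    obtain ⟨ω₁, h₁⟩ := h _ (realPart x).2
    obtain ⟨ω₂, h₂⟩ := h _ (imaginaryPart x).2
    refine ⟨ω₁ + Complex.I • ω₂, ?_⟩
    rw [map_add, map_smul, h₁, h₂, ← map_smul, ← map_add, realPart_add_I_smul_imaginaryPart]
  intro c hc
  obtain ⟨ω, hω⟩ := mem_range_predual e (φ.translate c) (fun 𝒰 l h1 hl => by
    -- Restricting the ultrafilter to the unit ball makes the norm bound valid at every index, as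
    -- the lemmas on selfadjoint families require.
    have hr : Set.range (Subtype.val : {y : M // ‖y‖ ≤ 1} → M) ∈ (𝒰 : Filter M) := by
      filter_upwards [h1] with y hy using ⟨⟨y, hy⟩, rfl⟩
    have hsub : ∃ 𝒱 : Ultrafilter {y : M // ‖y‖ ≤ 1}, 𝒱.map Subtype.val = 𝒰 :=
      ⟨𝒰.comap Subtype.val_injective hr, by
        refine Ultrafilter.coe_injective ?_
        rw [Ultrafilter.coe_map, Ultrafilter.coe_comap]
        exact Filter.map_comap_of_mem hr⟩
    obtain ⟨𝒱, rfl⟩ := hsub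
    have hl' : WeakStarTendsto e (fun y : {y : M // ‖y‖ ≤ 1} => (y : M)) 𝒱 l := fun ω => by
      have := hl ω
      rwa [Ultrafilter.coe_map, tendsto_map'_iff] at this
    have hra : ∀ y : {y : M // ‖y‖ ≤ 1}, ‖(realPart (y : M) : M)‖ ≤ 1 := fun y =>
      (norm_realPart_le _).trans y.2
    have hrb : ∀ y : {y : M // ‖y‖ ≤ 1}, ‖(imaginaryPart (y : M) : M)‖ ≤ 1 := fun y =>
      (norm_imaginaryPart_le _).trans y.2
    obtain ⟨a, ha⟩ := exists_weakStarTendsto e 𝒱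
      (fun y : {y : M // ‖y‖ ≤ 1} => (realPart (y : M) : M)) (.of_forall hra)
    obtain ⟨b, hb⟩ := exists_weakStarTendsto e 𝒱
      (fun y : {y : M // ‖y‖ ≤ 1} => (imaginaryPart (y : M) : M)) (.of_forall hrb)
    -- Real and imaginary parts converge separately by compactness, so the selfadjoint case applies
    -- to each of them.
    have hab : l = a + Complex.I • b := by
      refine hl'.unique ?_
      have := ha.add (hb.smul Complex.I)
      simpa only [realPart_add_I_smul_imaginaryPart] using this
    have h2 := (φ.tendsto_mul_of_isSelfAdjoint (y := fun y : {y : M // ‖y‖ ≤ 1} => (realPart (y : M) : M))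
      (fun y => (realPart (y : M)).2) hra ha hc).add
      ((φ.tendsto_mul_of_isSelfAdjoint (y := fun y : {y : M // ‖y‖ ≤ 1} =>
        (imaginaryPart (y : M) : M)) (fun y => (imaginaryPart (y : M)).2) hrb hb hc).const_mul
        Complex.I)
    rw [Ultrafilter.coe_map, tendsto_map'_iff, hab, translate_apply, mul_add, mul_smul_comm,
      map_add, map_smul, smul_eq_mul]
    refine h2.congr fun y => ?_
    rw [Function.comp_apply, translate_apply]
    conv_rhs => rw [← realPart_add_I_smul_imaginaryPart (y : M)]
    rw [mul_add, mul_smul_comm, map_add, map_smul, smul_eq_mul])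
  exact ⟨ω, ContinuousLinearMap.ext fun y => (hω y).symm⟩

theorem norm_predualInclusion (e : M ≃ₗᵢ[ℂ] StrongDual ℂ P) (ω : P) :
    ‖predualInclusion e ω‖ = ‖ω‖ := by
  refine le_antisymm ?_ ?_
  · refine ContinuousLinearMap.opNorm_le_bound _ (norm_nonneg ω) fun x => ?_
    rw [mul_comm, ← e.norm_map x]
    exact (e x).le_opNorm ω
  · refine NormedSpace.norm_le_dual_bound ℂ ω (norm_nonneg _) fun f => ?_
    have h := (predualInclusion e ω).le_opNorm (e.symm f)
    have h' : predualInclusion e ω (e.symm f) = f ω := by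
      show e (e.symm f) ω = f ω
      rw [e.apply_symm_apply]
    rwa [h', e.symm.norm_map] at h

/-- The embedding `M → M_*`, `x ↦ φ_x`. -/
def toPredual [CompleteSpace P] : M →L[ℂ] P :=
  LinearMap.mkContinuous
    { toFun := fun x => Classical.choose (φ.exists_predual_translate x)
      map_add' := fun x y => predualInclusion_injective e <| by
        have h := fun z => Classical.choose_spec (φ.exists_predual_translate z)
        refine (h (x + y)).trans ?_
        rw [map_add, map_add]
        exact congrArg₂ (· + ·) (h x).symm (h y).symm
      map_smul' := fun c x => predualInclusion_injective e <| by
        have h := fun z => Classical.choose_spec (φ.exists_predual_translate z)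
        refine (h (c • x)).trans ?_
        rw [map_smul, map_smul]
        exact congrArg (c • ·) (h x).symm }
    ‖φ.translate‖ fun x => by
      rw [← norm_predualInclusion e]
      refine (congrArg norm (Classical.choose_spec (φ.exists_predual_translate x))).trans_le ?_
      exact φ.translate.le_opNorm x

theorem predualInclusion_toPredual [CompleteSpace P] (x : M) :
    predualInclusion e (φ.toPredual x) = φ.translate x :=
  Classical.choose_spec (φ.exists_predual_translate x)

theorem apply_toPredual [CompleteSpace P] (x y : M) : e y (φ.toPredual x) = φ.toDual (x * y) :=
  DFunLike.congr_fun (φ.predualInclusion_toPredual x) y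

end NormalFaithfulState

/-! ### The strip: three lines theorem and contour shift -/

/-- The open strip `0 < Re z < 1`. -/
abbrev strip : Set ℂ := Complex.HadamardThreeLines.verticalStrip 0 1

/-- The closed strip `0 ≤ Re z ≤ 1`. -/
abbrev closedStrip : Set ℂ := Complex.HadamardThreeLines.verticalClosedStrip 0 1

theorem mem_strip {z : ℂ} : z ∈ strip ↔ 0 < z.re ∧ z.re < 1 := Iff.rfl

theorem mem_closedStrip {z : ℂ} : z ∈ closedStrip ↔ 0 ≤ z.re ∧ z.re ≤ 1 := Iff.rfl

theorem closure_strip : closure strip = closedStrip := by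
  rw [strip, Complex.HadamardThreeLines.verticalStrip, Complex.closure_preimage_re,
    closure_Ioo zero_ne_one]
  rfl

theorem isOpen_strip : IsOpen strip := isOpen_Ioo.preimage Complex.continuous_re

theorem strip_subset_closedStrip : strip ⊆ closedStrip := fun _ h => ⟨h.1.le, h.2.le⟩

theorem ofReal_mul_I_mem_closedStrip (t : ℝ) : (t : ℂ) * Complex.I ∈ closedStrip := by
  simp [mem_closedStrip]

theorem one_add_mul_I_mem_closedStrip (t : ℝ) : 1 + (t : ℂ) * Complex.I ∈ closedStrip := by
  simp [mem_closedStrip]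

theorem ofReal_mem_strip {θ : ℝ} (h0 : 0 < θ) (h1 : θ < 1) : (θ : ℂ) ∈ strip := by
  simp [mem_strip, h0, h1]

section ThreeLines

variable {E : Type*} [NormedAddCommGroup E] [NormedSpace ℂ E]

theorem norm_le_rpow_mul_rpow_of_strip {f : ℂ → E} (hf : DiffContOnCl ℂ f strip)
    (hb : ∃ K, ∀ z ∈ closedStrip, ‖f z‖ ≤ K) {a b : ℝ}
    (h0 : ∀ t : ℝ, ‖f (t * Complex.I)‖ ≤ a) (h1 : ∀ t : ℝ, ‖f (1 + t * Complex.I)‖ ≤ b)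
    {z : ℂ} (hz : z ∈ closedStrip) : ‖f z‖ ≤ a ^ (1 - z.re) * b ^ z.re := by
  obtain ⟨K, hK⟩ := hb
  refine Complex.HadamardThreeLines.norm_le_interp_of_mem_verticalClosedStrip₀₁' f hz hf
    ⟨K, ?_⟩ ?_ ?_
  · rintro _ ⟨w, hw, rfl⟩
    exact hK w hw
  · intro w hw
    have hw' : w = (w.im : ℂ) * Complex.I := by
      apply Complex.ext <;> simp
      exact hw
    rw [hw']
    exact h0 _
  · intro w hw
    have hw' : w = 1 + (w.im : ℂ) * Complex.I := by
      apply Complex.ext <;> simp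
      exact hw
    rw [hw']
    exact h1 _

theorem norm_le_of_strip {f : ℂ → E} (hf : DiffContOnCl ℂ f strip)
    (hb : ∃ K, ∀ z ∈ closedStrip, ‖f z‖ ≤ K) {C : ℝ}
    (h0 : ∀ t : ℝ, ‖f (t * Complex.I)‖ ≤ C) (h1 : ∀ t : ℝ, ‖f (1 + t * Complex.I)‖ ≤ C)
    {z : ℂ} (hz : z ∈ closedStrip) : ‖f z‖ ≤ C := by
  refine (norm_le_rpow_mul_rpow_of_strip hf hb h0 h1 hz).trans (le_of_eq ?_)
  rw [← Real.rpow_add_of_nonneg ((norm_nonneg _).trans (h0 0)) (by simpa using hz.2)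
    (by simpa using hz.1)]
  simp

end ThreeLines

section ContourShift

variable {E : Type*} [NormedAddCommGroup E] [NormedSpace ℂ E] [CompleteSpace E]

/-- Shifting the line of integration across the strip. -/
theorem integral_left_eq_integral_right {f : ℂ → E} (hf : DiffContOnCl ℂ f strip)
    (h0 : Integrable fun t : ℝ => f (t * Complex.I))
    (h1 : Integrable fun t : ℝ => f (1 + t * Complex.I)) {g : ℝ → ℝ}
    (hg : Tendsto g atTop (𝓝 0)) {T₀ : ℝ}
    (hb : ∀ z ∈ closedStrip, T₀ ≤ |z.im| → ‖f z‖ ≤ g |z.im|) :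
    ∫ t : ℝ, f (t * Complex.I) = ∫ t : ℝ, f (1 + t * Complex.I) := by
  -- Cauchy's theorem on the rectangle with corners -Ti and 1 + Ti. Each horizontal side has length
  -- 1 and contributes at most g(T).
  have hrect : ∀ T : ℝ, 0 ≤ T → T₀ ≤ T → ‖(∫ t in (-T)..T, f (1 + t * Complex.I)) -
      ∫ t in (-T)..T, f (t * Complex.I)‖ ≤ 2 * g T := by
    intro T hT hT₀
    have hc : ContinuousOn f closedStrip := closure_strip ▸ hf.continuousOn
    have h := Complex.integral_boundary_rect_eq_zero_of_continuousOn_of_differentiableOn f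
      (-(T * Complex.I)) (1 + T * Complex.I) (hc.mono ?_) (hf.differentiableOn.mono ?_)
    · simp only [Complex.neg_re, Complex.mul_re, Complex.ofReal_re, Complex.I_re, mul_zero,
        Complex.ofReal_im, Complex.I_im, mul_one, sub_self, neg_zero, Complex.add_re,
        Complex.one_re, add_zero, Complex.neg_im, Complex.mul_im, Complex.add_im,
        Complex.one_im, zero_add, Complex.ofReal_zero, Complex.ofReal_one] at h
      rw [add_sub_assoc, ← smul_sub, add_comm] at h
      have h' := eq_neg_of_add_eq_zero_left h
      have hn := congrArg norm h'
      rw [norm_smul, Complex.norm_I, one_mul, norm_neg] at hn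
      rw [hn]
      refine (norm_sub_le _ _).trans ?_
      rw [two_mul]
      refine add_le_add ?_ ?_
      · refine (intervalIntegral.norm_integral_le_of_norm_le_const (C := g T) ?_).trans
          (by simp)
        intro x hx
        rw [Set.uIoc_of_le zero_le_one] at hx
        simpa [abs_of_nonneg hT] using
          hb (x + ((-T : ℝ) : ℂ) * Complex.I) (by simp [mem_closedStrip, hx.1.le, hx.2])
            (by simpa [abs_of_nonneg hT] using hT₀)
      · refine (intervalIntegral.norm_integral_le_of_norm_le_const (C := g T) ?_).trans
          (by simp)
        intro x hx
        rw [Set.uIoc_of_le zero_le_one] at hx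
        simpa [abs_of_nonneg hT] using
          hb (x + (T : ℂ) * Complex.I) (by simp [mem_closedStrip, hx.1.le, hx.2])
            (by simpa [abs_of_nonneg hT] using hT₀)
    · intro z hz
      have hz1 := hz.1
      simpa [Set.uIcc_of_le (zero_le_one (α := ℝ)), mem_closedStrip] using hz1
    · intro z hz
      have hz1 := hz.1
      simpa [mem_strip] using hz1
  have l0 := intervalIntegral_tendsto_integral h0 tendsto_neg_atTop_atBot tendsto_id
  have l1 := intervalIntegral_tendsto_integral h1 tendsto_neg_atTop_atBot tendsto_id
  have l2 : Tendsto (fun T : ℝ => (∫ t in (-T)..T, f (1 + t * Complex.I)) -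
      ∫ t in (-T)..T, f (t * Complex.I)) atTop (𝓝 0) := by
    refine squeeze_zero_norm' (a := fun T => 2 * g T) ?_ (by simpa using hg.const_mul 2)
    filter_upwards [eventually_ge_atTop 0, eventually_ge_atTop T₀] with T hT hT₀
    exact hrect T hT hT₀
  exact (sub_eq_zero.mp (tendsto_nhds_unique (l1.sub l0) l2)).symm

end ContourShift

/-! ### The Poisson kernel and the Poisson formula -/

/-- The Poisson kernel of the strip `0 < Re z < 1`: the density of the harmonic measure of the
line `Re z = 1` at the point `c`. -/
def pois (c t : ℝ) : ℝ :=
  Real.sin (Real.pi * c) / (2 * (Real.cosh (Real.pi * t) + Real.cos (Real.pi * c)))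

section Pois

variable {c : ℝ}

theorem sin_pi_mul_pos (h0 : 0 < c) (h1 : c < 1) : 0 < Real.sin (Real.pi * c) :=
  Real.sin_pos_of_pos_of_lt_pi (by positivity) (by nlinarith [Real.pi_pos])

theorem cosh_add_cos_pos (h0 : 0 < c) (h1 : c < 1) (t : ℝ) :
    0 < Real.cosh (Real.pi * t) + Real.cos (Real.pi * c) := by
  have h2 := Real.one_le_cosh (Real.pi * t)
  have h3 := sin_pi_mul_pos h0 h1
  have h4 := Real.sin_sq_add_cos_sq (Real.pi * c)
  nlinarith

theorem pois_pos (h0 : 0 < c) (h1 : c < 1) (t : ℝ) : 0 < pois c t :=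
  div_pos (sin_pi_mul_pos h0 h1) (mul_pos two_pos (cosh_add_cos_pos h0 h1 t))

theorem pois_neg (c t : ℝ) : pois c (-t) = pois c t := by
  simp [pois, Real.cosh_neg]

theorem continuous_pois (h0 : 0 < c) (h1 : c < 1) : Continuous (pois c) := by
  unfold pois
  refine Continuous.div continuous_const (by fun_prop) fun t => ?_
  exact (mul_pos two_pos (cosh_add_cos_pos h0 h1 t)).ne'

/-- An explicit primitive of the kernel. Its limits 1/2 - c and 1/2 at the two ends give
integrability and the total mass c. -/
theorem hasDerivAt_pois (h0 : 0 < c) (h1 : c < 1) (t : ℝ) :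
    HasDerivAt (fun t => Real.arctan ((Real.exp (Real.pi * t) + Real.cos (Real.pi * c)) /
      Real.sin (Real.pi * c)) / Real.pi) (pois c t) t := by
  have hs := sin_pi_mul_pos h0 h1
  have hd : HasDerivAt (fun t => (Real.exp (Real.pi * t) + Real.cos (Real.pi * c)) /
      Real.sin (Real.pi * c)) (Real.exp (Real.pi * t) * Real.pi / Real.sin (Real.pi * c)) t := by
    have := (((hasDerivAt_id t).const_mul Real.pi).exp.add_const
      (Real.cos (Real.pi * c))).div_const (Real.sin (Real.pi * c))
    simpa using this
  refine (hd.arctan.div_const Real.pi).congr_deriv (Eq.symm ?_)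
  have hcs := Real.sin_sq_add_cos_sq (Real.pi * c)
  have hp := cosh_add_cos_pos h0 h1 t
  have he := Real.exp_pos (Real.pi * t)
  have hd' : 0 < Real.sin (Real.pi * c) ^ 2 +
      (Real.exp (Real.pi * t) + Real.cos (Real.pi * c)) ^ 2 := by positivity
  have hkey : 2 * (Real.cosh (Real.pi * t) + Real.cos (Real.pi * c)) * Real.exp (Real.pi * t) =
      Real.sin (Real.pi * c) ^ 2 + (Real.exp (Real.pi * t) + Real.cos (Real.pi * c)) ^ 2 := by
    have : Real.exp (Real.pi * t) * Real.exp (-(Real.pi * t)) = 1 := by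
      rw [← Real.exp_add]; simp
    rw [Real.cosh_eq]
    linear_combination this - hcs
  unfold pois
  have hpi := Real.pi_pos
  rw [div_eq_iff (by positivity)]
  have : 1 + ((Real.exp (Real.pi * t) + Real.cos (Real.pi * c)) / Real.sin (Real.pi * c)) ^ 2 =
      2 * (Real.cosh (Real.pi * t) + Real.cos (Real.pi * c)) * Real.exp (Real.pi * t) /
        Real.sin (Real.pi * c) ^ 2 := by
    rw [hkey]; field_simp
  rw [this]
  field_simp

theorem tendsto_pois_atTop (h0 : 0 < c) (h1 : c < 1) :
    Tendsto (fun t => Real.arctan ((Real.exp (Real.pi * t) + Real.cos (Real.pi * c)) /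
      Real.sin (Real.pi * c)) / Real.pi) atTop (𝓝 (1 / 2)) := by
  have h : Tendsto (fun t => (Real.exp (Real.pi * t) + Real.cos (Real.pi * c)) /
      Real.sin (Real.pi * c)) atTop atTop :=
    (tendsto_atTop_add_const_right _ _ (Real.tendsto_exp_atTop.comp
      (tendsto_id.const_mul_atTop Real.pi_pos))).atTop_div_const (sin_pi_mul_pos h0 h1)
  have h2 := ((Real.tendsto_arctan_atTop.mono_right nhdsWithin_le_nhds).comp h).div_const
    Real.pi
  have h3 : Real.pi / 2 / Real.pi = 1 / 2 := by field_simp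
  rwa [h3] at h2

theorem tendsto_pois_atBot (h0 : 0 < c) (h1 : c < 1) :
    Tendsto (fun t => Real.arctan ((Real.exp (Real.pi * t) + Real.cos (Real.pi * c)) /
      Real.sin (Real.pi * c)) / Real.pi) atBot (𝓝 (1 / 2 - c)) := by
  have h : Tendsto (fun t => (Real.exp (Real.pi * t) + Real.cos (Real.pi * c)) /
      Real.sin (Real.pi * c)) atBot (𝓝 ((0 + Real.cos (Real.pi * c)) /
      Real.sin (Real.pi * c))) :=
    ((Real.tendsto_exp_atBot.comp (tendsto_id.const_mul_atBot Real.pi_pos)).add_const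
      _).div_const _
  have h2 := ((Real.continuous_arctan.tendsto _).comp h).div_const Real.pi
  have h3 : (0 + Real.cos (Real.pi * c)) / Real.sin (Real.pi * c) =
      Real.tan (Real.pi / 2 - Real.pi * c) := by
    rw [Real.tan_pi_div_two_sub, Real.tan_eq_sin_div_cos, inv_div, zero_add]
  rw [h3, Real.arctan_tan (by nlinarith [Real.pi_pos]) (by nlinarith [Real.pi_pos])] at h2
  have h4 : (Real.pi / 2 - Real.pi * c) / Real.pi = 1 / 2 - c := by field_simp
  rwa [h4] at h2

theorem integrable_pois (h0 : 0 < c) (h1 : c < 1) : Integrable (pois c) := by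
  have hpos : IntegrableOn (pois c) (Set.Ioi 0) :=
    integrableOn_Ioi_deriv_of_nonneg' (fun t _ => hasDerivAt_pois h0 h1 t)
      (fun t _ => (pois_pos h0 h1 t).le) (tendsto_pois_atTop h0 h1)
  have hneg : IntegrableOn (pois c) (Set.Iio 0) := by
    have := ((Measure.measurePreserving_neg volume).integrableOn_comp_preimage
      (Homeomorph.neg ℝ).measurableEmbedding (s := Set.Ioi 0)).mpr hpos
    simpa [Function.comp_def, pois_neg] using this
  have hIic : IntegrableOn (pois c) (Set.Iic 0) :=
    (integrableOn_Iic_iff_integrableOn_Iio).mpr hneg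
  rw [← integrableOn_univ, ← Set.Iic_union_Ioi (a := (0 : ℝ))]
  exact hIic.union hpos

theorem integral_pois (h0 : 0 < c) (h1 : c < 1) : ∫ t, pois c t = c := by
  rw [integral_of_hasDerivAt_of_tendsto (hasDerivAt_pois h0 h1) (integrable_pois h0 h1)
    (tendsto_pois_atBot h0 h1) (tendsto_pois_atTop h0 h1)]
  ring

end Pois

section Weight

variable (θ : ℝ)

/-- The entire function, vanishing at `θ`, that equals the reciprocal of the Poisson kernel on
the line `Re z = 1` and its negative on `Re z = 0`. -/
def poisInv (z : ℂ) : ℂ :=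
  2 * (Complex.cos (Real.pi * θ) - Complex.cos (Real.pi * z)) / Complex.sin (Real.pi * θ)

theorem poisInv_self : poisInv θ θ = 0 := by simp [poisInv]

theorem differentiable_poisInv : Differentiable ℂ (poisInv θ) := by
  unfold poisInv; fun_prop

variable {θ}

theorem poisInv_right (t : ℝ) :
    poisInv θ (1 + t * Complex.I) = ((pois θ t)⁻¹ : ℝ) := by
  have h : Complex.cos (Real.pi * (1 + t * Complex.I)) = -Complex.cosh (Real.pi * t) := by
    rw [mul_add, mul_one, add_comm, Complex.cos_add_pi, ← mul_assoc, Complex.cos_mul_I]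
  unfold poisInv pois
  rw [h]
  push_cast
  rw [inv_div]
  ring

theorem poisInv_left (t : ℝ) :
    poisInv θ (t * Complex.I) = -((pois (1 - θ) t)⁻¹ : ℝ) := by
  have h : Complex.cos (Real.pi * (t * Complex.I)) = Complex.cosh (Real.pi * t) := by
    rw [← mul_assoc, Complex.cos_mul_I]
  have hs : Real.sin (Real.pi * (1 - θ)) = Real.sin (Real.pi * θ) := by
    rw [mul_sub, mul_one, Real.sin_pi_sub]
  have hc : Real.cos (Real.pi * (1 - θ)) = -Real.cos (Real.pi * θ) := by
    rw [mul_sub, mul_one, Real.cos_pi_sub]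
  unfold poisInv pois
  rw [h, hs, hc]
  push_cast
  rw [inv_div]
  ring

theorem deriv_poisInv_ne_zero (h0 : 0 < θ) (h1 : θ < 1) : deriv (poisInv θ) θ ≠ 0 := by
  have hs : Complex.sin (Real.pi * θ) ≠ 0 := by
    exact_mod_cast (sin_pi_mul_pos h0 h1).ne'
  have hd : HasDerivAt (poisInv θ) (2 * Real.pi) θ := by
    have := ((((hasDerivAt_id (θ : ℂ)).const_mul (Real.pi : ℂ)).ccos.const_sub
      (Complex.cos (Real.pi * θ))).const_mul 2).div_const (Complex.sin (Real.pi * θ))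
    refine this.congr_deriv ?_
    simp only [id]
    field_simp
  rw [hd.deriv]
  exact mul_ne_zero two_ne_zero (by exact_mod_cast Real.pi_ne_zero)

/-- The equation cos πz = cos πθ has only the solutions 2k ± θ with k an integer, and of these only
θ lies in the closed strip. -/
theorem poisInv_ne_zero (h0 : 0 < θ) (h1 : θ < 1) {z : ℂ} (hz : z ∈ closedStrip)
    (hne : z ≠ θ) : poisInv θ z ≠ 0 := by
  have hs : Complex.sin (Real.pi * θ) ≠ 0 := by
    exact_mod_cast (sin_pi_mul_pos h0 h1).ne'
  have hpi : (Real.pi : ℂ) ≠ 0 := by exact_mod_cast Real.pi_ne_zero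
  intro h
  unfold poisInv at h
  rw [div_eq_zero_iff, or_iff_left hs, mul_eq_zero, or_iff_right two_ne_zero, sub_eq_zero,
    Complex.cos_eq_cos_iff] at h
  obtain ⟨k, h | h⟩ := h
  · have h2 : z = 2 * k + θ := by
      refine mul_left_cancel₀ hpi ?_
      rw [h]; ring
    have hre := congrArg Complex.re h2
    simp at hre
    have hk1 : (k : ℝ) < 1 := by linarith [hz.2]
    have hk2 : (-1 : ℝ) < k := by linarith [hz.1]
    have hk : k = 0 := by
      have a : k < 1 := by exact_mod_cast hk1
      have b : -1 < k := by exact_mod_cast hk2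
      omega
    subst hk
    exact hne (by simpa using h2)
  · have h2 : z = 2 * k - θ := by
      refine mul_left_cancel₀ hpi ?_
      rw [h]; ring
    have hre := congrArg Complex.re h2
    simp at hre
    have hk1 : (k : ℝ) < 1 := by linarith [hz.2]
    have hk2 : (0 : ℝ) < k := by linarith [hz.1]
    have a : k < 1 := by exact_mod_cast hk1
    have b : 0 < k := by exact_mod_cast hk2
    omega

/-- |cos πz| ≥ |sinh(π Im z)| ≥ π|Im z|. A linear lower bound suffices to make the horizontal sides
vanish in the contour shift. -/
theorem le_norm_poisInv (h0 : 0 < θ) (h1 : θ < 1) (z : ℂ) :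
    Real.pi * |z.im| - 1 ≤ ‖poisInv θ z‖ := by
  have hc : Real.pi * |z.im| ≤ ‖Complex.cos (Real.pi * z)‖ := by
    have hz : (Real.pi : ℂ) * z =
        ((Real.pi * z.re : ℝ) : ℂ) + ((Real.pi * z.im : ℝ) : ℂ) * Complex.I := by
      apply Complex.ext <;> simp
    have hsq : ‖Complex.cos (Real.pi * z)‖ ^ 2 =
        Real.cos (Real.pi * z.re) ^ 2 + Real.sinh (Real.pi * z.im) ^ 2 := by
      rw [hz, Complex.cos_add_mul_I, ← Complex.normSq_eq_norm_sq, Complex.normSq_apply]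
      simp only [← Complex.ofReal_cos, ← Complex.ofReal_cosh, ← Complex.ofReal_sin,
        ← Complex.ofReal_sinh]
      have hn : ∀ a b c d : ℝ, ((a : ℂ) * b - c * d * Complex.I).re = a * b ∧
          ((a : ℂ) * b - c * d * Complex.I).im = -(c * d) := fun a b c d => by simp
      rw [(hn _ _ _ _).1, (hn _ _ _ _).2]
      have h1 := Real.sin_sq_add_cos_sq (Real.pi * z.re)
      have h2 := Real.cosh_sq (Real.pi * z.im)
      linear_combination Real.cos (Real.pi * z.re) ^ 2 * h2 +
        Real.sinh (Real.pi * z.im) ^ 2 * h1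
    have h3 : |Real.pi * z.im| ≤ |Real.sinh (Real.pi * z.im)| := by
      rw [Real.abs_sinh]
      exact Real.self_le_sinh_iff.mpr (abs_nonneg _)
    rw [abs_mul, abs_of_pos Real.pi_pos] at h3
    refine h3.trans (abs_le_of_sq_le_sq ?_ (norm_nonneg _))
    linarith [sq_nonneg (Real.cos (Real.pi * z.re))]
  have hs := sin_pi_mul_pos h0 h1
  have hcos : ‖Complex.cos (Real.pi * θ)‖ ≤ 1 := by
    rw [← Complex.ofReal_mul, ← Complex.ofReal_cos, Complex.norm_real]
    exact Real.abs_cos_le_one _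
  have hsin : ‖Complex.sin (Real.pi * θ)‖ ≤ 1 := by
    rw [← Complex.ofReal_mul, ← Complex.ofReal_sin, Complex.norm_real]
    exact Real.abs_sin_le_one _
  have hsin0 : 0 < ‖Complex.sin (Real.pi * θ)‖ := by
    rw [← Complex.ofReal_mul, ← Complex.ofReal_sin, Complex.norm_real]
    exact abs_pos.mpr hs.ne'
  have htri := norm_sub_norm_le (Complex.cos (Real.pi * z)) (Complex.cos (Real.pi * θ))
  rw [norm_sub_rev] at htri
  unfold poisInv
  rw [norm_div, norm_mul, le_div_iff₀ hsin0, Complex.norm_two]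
  nlinarith [norm_nonneg (Complex.cos (Real.pi * θ) - Complex.cos (Real.pi * z))]

end Weight

theorem integrable_pois_mul {E : Type*} [NormedAddCommGroup E] [NormedSpace ℝ E] {c : ℝ}
    (h0 : 0 < c) (h1 : c < 1) {f : ℝ → E} (hf : Continuous f) {K : ℝ} (hK : ∀ t, ‖f t‖ ≤ K) :
    Integrable fun t => pois c t • f t :=
  (integrable_pois h0 h1).smul_bdd K hf.aestronglyMeasurable (.of_forall hK)

/-- The Poisson formula in the strip. -/
theorem poisson_formula {θ : ℝ} (h0 : 0 < θ) (h1 : θ < 1) {b : ℂ → ℂ}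
    (hb : DiffContOnCl ℂ b strip) (hbdd : ∃ K, ∀ z ∈ closedStrip, ‖b z‖ ≤ K) :
    b θ = (∫ t : ℝ, pois (1 - θ) t • b (t * Complex.I)) +
      ∫ t : ℝ, pois θ t • b (1 + t * Complex.I) := by
  obtain ⟨K, hK⟩ := hbdd
  have hθ : (θ : ℂ) ∈ strip := ofReal_mem_strip h0 h1
  have hnhds : strip ∈ 𝓝 (θ : ℂ) := isOpen_strip.mem_nhds hθ
  have hnhds' : closedStrip ∈ 𝓝 (θ : ℂ) := mem_of_superset hnhds strip_subset_closedStrip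
  have hθ' : (θ : ℂ) ∈ closedStrip := strip_subset_closedStrip hθ
  have hbc : ContinuousOn b closedStrip := closure_strip ▸ hb.continuousOn
  have hcont : ∀ g : ℝ → ℂ, Continuous g → (∀ t, g t ∈ closedStrip) →
      Continuous fun t => b (g t) := fun g hg hm =>
    hbc.comp_continuous hg hm
  have hc0 := hcont (fun t : ℝ => (t : ℂ) * Complex.I) (by fun_prop) ofReal_mul_I_mem_closedStrip
  have hc1 := hcont (fun t : ℝ => 1 + (t : ℂ) * Complex.I) (by fun_prop)
    one_add_mul_I_mem_closedStrip
  -- This is (b(z) - b(θ)) / `poisInv θ z` with the singularity at θ removed. On the boundary lines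
  -- it is b - b(θ) times the Poisson densities, with opposite signs, so the contour shift is the
  -- Poisson formula.
  set f : ℂ → ℂ := fun z => dslope b θ z / dslope (poisInv θ) θ z with hf
  have hE : ∀ z ∈ closedStrip, dslope (poisInv θ) θ z ≠ 0 := by
    intro z hz
    by_cases hzθ : z = θ
    · rw [hzθ, dslope_same]
      exact deriv_poisInv_ne_zero h0 h1
    · rw [dslope_of_ne _ hzθ, slope_def_field, poisInv_self, sub_zero]
      exact div_ne_zero (poisInv_ne_zero h0 h1 hz hzθ) (sub_ne_zero.mpr hzθ)
  have hfz : ∀ z : ℂ, z ≠ θ → f z = (b z - b θ) / poisInv θ z := by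
    intro z hz
    have : z - θ ≠ 0 := sub_ne_zero.mpr hz
    simp only [hf, dslope_of_ne _ hz, slope_def_field, poisInv_self, sub_zero]
    rw [div_div_div_cancel_right₀ this]
  have hd : DiffContOnCl ℂ f strip := by
    refine ⟨DifferentiableOn.div ((Complex.differentiableOn_dslope hnhds).mpr hb.differentiableOn)
      ((Complex.differentiableOn_dslope hnhds).mpr
        (differentiable_poisInv θ).differentiableOn)
      fun z hz => hE z (strip_subset_closedStrip hz), ?_⟩
    rw [closure_strip]
    exact ((continuousOn_dslope hnhds').mpr ⟨hbc, hb.differentiableAt isOpen_strip hθ⟩).div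
      ((continuousOn_dslope hnhds').mpr ⟨(differentiable_poisInv θ).continuous.continuousOn,
        differentiable_poisInv θ _⟩) hE
  have hne0 : ∀ t : ℝ, (t : ℂ) * Complex.I ≠ θ := by
    intro t h
    have := congrArg Complex.re h
    simp at this
    exact h0.ne this
  have hne1 : ∀ t : ℝ, 1 + (t : ℂ) * Complex.I ≠ θ := by
    intro t h
    have := congrArg Complex.re h
    simp at this
    exact h1.ne' this
  have hf0 : ∀ t : ℝ, f (t * Complex.I) =
      -(pois (1 - θ) t • b (t * Complex.I) - pois (1 - θ) t • b θ) := by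
    intro t
    rw [hfz _ (hne0 t), poisInv_left, ← smul_sub, Complex.real_smul]
    push_cast
    rw [div_neg, div_inv_eq_mul]
    ring
  have hf1 : ∀ t : ℝ, f (1 + t * Complex.I) =
      pois θ t • b (1 + t * Complex.I) - pois θ t • b θ := by
    intro t
    rw [hfz _ (hne1 t), poisInv_right, ← smul_sub, Complex.real_smul]
    push_cast
    rw [div_inv_eq_mul]
    ring
  have i0 := integrable_pois_mul (c := 1 - θ) (by linarith) (by linarith) hc0
    (fun t => hK _ (ofReal_mul_I_mem_closedStrip t))
  have i1 := integrable_pois_mul h0 h1 hc1 (fun t => hK _ (one_add_mul_I_mem_closedStrip t))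
  have j0 : Integrable fun t => pois (1 - θ) t • b θ :=
    (integrable_pois (c := 1 - θ) (by linarith) (by linarith)).smul_const _
  have j1 : Integrable fun t => pois θ t • b θ := (integrable_pois h0 h1).smul_const _
  have h := integral_left_eq_integral_right hd
    ((i0.sub j0).neg.congr (.of_forall fun t => (hf0 t).symm))
    ((i1.sub j1).congr (.of_forall fun t => (hf1 t).symm))
    (g := fun T => 2 * K / (Real.pi * T - 1)) (T₀ := 1) ?_ ?_
  · simp_rw [hf0, hf1] at h
    rw [integral_neg, integral_sub i0 j0, integral_sub i1 j1, integral_smul_const,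
      integral_smul_const, integral_pois h0 h1, integral_pois (by linarith) (by linarith)] at h
    simp only [Complex.real_smul] at h ⊢
    push_cast at h
    linear_combination h
  · refine Tendsto.const_div_atTop (tendsto_atTop_add_const_right _ _
      (tendsto_id.const_mul_atTop Real.pi_pos)) _
  · intro z hz him
    have hzθ : z ≠ θ := by
      rintro rfl
      simp at him
      linarith
    have hp : 0 < Real.pi * |z.im| - 1 := by nlinarith [Real.pi_gt_three]
    rw [hfz z hzθ, norm_div]
    refine div_le_div₀ (by linarith [norm_nonneg (b θ), hK _ hθ']) ?_ hp
      (le_norm_poisInv h0 h1 z)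
    exact (norm_sub_le _ _).trans (by linarith [hK z hz, hK _ hθ'])

/-! ### Real parts of bounded analytic functions with prescribed boundary values -/

section Weierstrass

-- Characters of negative frequency are conjugates of powers of the coordinate, so a trigonometric
-- polynomial is q + conj r with q and r analytic polynomials.
open Polynomial in
theorem exists_polynomial_of_mem_span_fourier {T : ℝ} {f : C(AddCircle T, ℂ)}
    (hf : f ∈ Submodule.span ℂ (Set.range (fourier (T := T)))) :
    ∃ q r : ℂ[X], ∀ x : AddCircle T, f x =
      q.eval (AddCircle.toCircle x : ℂ) +
        (starRingEnd ℂ) (r.eval (AddCircle.toCircle x : ℂ)) := by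
  induction hf using Submodule.span_induction with
  | mem f hf =>
    obtain ⟨n, rfl⟩ := hf
    obtain ⟨m, rfl | rfl⟩ := n.eq_nat_or_neg
    · exact ⟨X ^ m, 0, fun x => by simp [fourier_apply, AddCircle.toCircle_nsmul]⟩
    · refine ⟨0, X ^ m, fun x => ?_⟩
      simp [fourier_apply, ← Circle.coe_inv_eq_conj, AddCircle.toCircle_nsmul,
        AddCircle.toCircle_neg]
  | zero => exact ⟨0, 0, by simp⟩
  | add f g _ _ hf hg =>
    obtain ⟨q, r, h⟩ := hf
    obtain ⟨q', r', h'⟩ := hg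
    refine ⟨q + q', r + r', fun x => ?_⟩
    simp only [ContinuousMap.add_apply, h, h', eval_add, map_add]
    ring
  | smul a f _ hf =>
    obtain ⟨q, r, h⟩ := hf
    refine ⟨C a * q, C ((starRingEnd ℂ) a) * r, fun x => ?_⟩
    simp only [ContinuousMap.smul_apply, h, eval_mul, eval_C, map_mul, smul_eq_mul,
      Complex.conj_conj]
    ring

open Polynomial in
/-- A continuous real function on the unit circle is uniformly approximated by real parts of
polynomials. -/
theorem exists_polynomial_re_near {Ψ : Circle → ℝ} (hΨ : Continuous Ψ) {ε : ℝ} (hε : 0 < ε) :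
    ∃ q : ℂ[X], ∀ w : Circle, |(q.eval (w : ℂ)).re - Ψ w| < ε := by
  have : Fact ((0 : ℝ) < 1) := ⟨one_pos⟩
  let f : C(AddCircle (1 : ℝ), ℂ) :=
    ⟨fun x => (Ψ (AddCircle.homeomorphCircle one_ne_zero x) : ℂ), by fun_prop⟩
  have hf : f ∈ (Submodule.span ℂ (Set.range (fourier (T := 1)))).topologicalClosure := by
    rw [span_fourier_closure_eq_top]; trivial
  obtain ⟨g, hg, hfg⟩ := Metric.mem_closure_iff.mp hf ε hε
  obtain ⟨q, r, hqr⟩ := exists_polynomial_of_mem_span_fourier hg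
  -- Conjugation does not change real parts, so q + r has the same real part as q + conj r.
  refine ⟨q + r, fun w => ?_⟩
  obtain ⟨x, rfl⟩ := (AddCircle.homeomorphCircle (one_ne_zero (α := ℝ))).surjective w
  have h1 : ‖(g - f) x‖ < ε := by
    refine (ContinuousMap.norm_coe_le_norm (g - f) x).trans_lt ?_
    rwa [← dist_eq_norm, dist_comm]
  have h2 : ((g - f) x).re = ((q + r).eval
      ((AddCircle.homeomorphCircle one_ne_zero x : Circle) : ℂ)).re - Ψ (AddCircle.homeomorphCircle one_ne_zero x) := by
    have : AddCircle.homeomorphCircle one_ne_zero x = AddCircle.toCircle x :=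
      AddCircle.homeomorphCircle_apply _ x
    simp only [ContinuousMap.sub_apply, hqr, this, eval_add]
    simp [f, this]
  rw [← h2]
  exact (Complex.abs_re_le_norm _).trans_lt h1

end Weierstrass

section StripToDisc

variable {θ : ℝ}

/-- The conformal map of the strip onto the unit disc that maps `θ` to `0`. -/
def stripToDisc (θ : ℝ) (z : ℂ) : ℂ :=
  (Complex.exp (Real.pi * z * Complex.I) - Complex.exp (Real.pi * θ * Complex.I)) /
    (Complex.exp (Real.pi * z * Complex.I) - (starRingEnd ℂ) (Complex.exp (Real.pi * θ * Complex.I)))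

theorem im_exp_pi_mul (z : ℂ) : (Complex.exp (Real.pi * z * Complex.I)).im =
    Real.exp (-(Real.pi * z.im)) * Real.sin (Real.pi * z.re) := by
  rw [Complex.exp_im]
  simp

theorem im_exp_pi_pos (h0 : 0 < θ) (h1 : θ < 1) :
    0 < (Complex.exp (Real.pi * θ * Complex.I)).im := by
  rw [im_exp_pi_mul]
  simpa using sin_pi_mul_pos h0 h1

theorem im_exp_pi_mul_nonneg {z : ℂ} (hz : z ∈ closedStrip) :
    0 ≤ (Complex.exp (Real.pi * z * Complex.I)).im := by
  rw [im_exp_pi_mul]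
  exact mul_nonneg (Real.exp_pos _).le (Real.sin_nonneg_of_nonneg_of_le_pi
    (mul_nonneg Real.pi_pos.le hz.1) (by nlinarith [Real.pi_pos, hz.2]))

theorem sub_conj_ne_zero {a x : ℂ} (ha : 0 < a.im) (hx : 0 ≤ x.im) :
    x - (starRingEnd ℂ) a ≠ 0 := by
  intro h
  have := congrArg Complex.im h
  simp at this
  linarith

theorem norm_sub_div_sub_conj_le {a x : ℂ} (ha : 0 < a.im) (hx : 0 ≤ x.im) :
    ‖(x - a) / (x - (starRingEnd ℂ) a)‖ ≤ 1 := by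
  rw [norm_div]
  refine div_le_one_of_le₀ ?_ (norm_nonneg _)
  refine le_of_sq_le_sq ?_ (norm_nonneg _)
  rw [← Complex.normSq_eq_norm_sq, ← Complex.normSq_eq_norm_sq, Complex.normSq_apply,
    Complex.normSq_apply]
  simp
  nlinarith

theorem norm_sub_div_sub_conj_eq {a : ℂ} (ha : 0 < a.im) (x : ℝ) :
    ‖((x : ℂ) - a) / (x - (starRingEnd ℂ) a)‖ = 1 := by
  have h : (x : ℂ) - (starRingEnd ℂ) a = (starRingEnd ℂ) ((x : ℂ) - a) := by simp
  have h2 := sub_conj_ne_zero ha (x := x) (by simp)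
  rw [h] at h2 ⊢
  rw [norm_div, Complex.norm_conj, div_self]
  rw [← Complex.norm_conj]
  exact norm_ne_zero_iff.mpr h2

theorem exp_left (t : ℝ) : Complex.exp (Real.pi * (t * Complex.I) * Complex.I) =
    (Real.exp (-(Real.pi * t)) : ℝ) := by
  rw [mul_assoc, mul_assoc, Complex.I_mul_I]
  push_cast
  ring_nf

theorem exp_right (t : ℝ) : Complex.exp (Real.pi * (1 + t * Complex.I) * Complex.I) =
    (-Real.exp (-(Real.pi * t)) : ℝ) := by
  rw [mul_add, add_mul, Complex.exp_add, exp_left, mul_one, Complex.exp_pi_mul_I]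
  push_cast
  ring

/-- The function on the real line, seen as the boundary of the upper half plane, that corresponds
to `ψ₀` and `ψ₁` on the boundary of the strip. -/
def glueBoundary (ψ₀ ψ₁ : ℝ → ℝ) (x : ℝ) : ℝ :=
  if 0 < x then ψ₀ (-Real.log x / Real.pi) else if x < 0 then ψ₁ (-Real.log x / Real.pi) else 0

variable {ψ₀ ψ₁ : ℝ → ℝ}

theorem abs_glueBoundary_le (x : ℝ) : |glueBoundary ψ₀ ψ₁ x| ≤
    |ψ₀ (-Real.log x / Real.pi)| + |ψ₁ (-Real.log x / Real.pi)| := by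
  unfold glueBoundary
  split_ifs
  · linarith [abs_nonneg (ψ₁ (-Real.log x / Real.pi))]
  · linarith [abs_nonneg (ψ₀ (-Real.log x / Real.pi))]
  · rw [abs_zero]; positivity

/-- The points 0 and ∞ of the real line correspond to the two ends of the strip, where log |x| is
unbounded and ψ₀, ψ₁ vanish. This one estimate covers both points. -/
theorem tendsto_glueBoundary_of_log (h0 : Tendsto ψ₀ (cocompact ℝ) (𝓝 0))
    (h1 : Tendsto ψ₁ (cocompact ℝ) (𝓝 0)) {l : Filter ℝ}
    (hl : Tendsto (fun x => -Real.log x / Real.pi) l (cocompact ℝ)) :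
    Tendsto (glueBoundary ψ₀ ψ₁) l (𝓝 0) := by
  refine squeeze_zero_norm (fun x => abs_glueBoundary_le x) ?_
  simpa using (h0.comp hl).abs.add (h1.comp hl).abs

theorem tendsto_glueBoundary_cocompact (h0 : Tendsto ψ₀ (cocompact ℝ) (𝓝 0))
    (h1 : Tendsto ψ₁ (cocompact ℝ) (𝓝 0)) :
    Tendsto (glueBoundary ψ₀ ψ₁) (cocompact ℝ) (𝓝 0) := by
  refine tendsto_glueBoundary_of_log h0 h1 ?_
  have h : Tendsto Real.log (cocompact ℝ) atTop := by
    refine (Real.tendsto_log_atTop.comp (tendsto_norm_cocompact_atTop (E := ℝ))).congr fun x => ?_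
    simp [Real.log_abs]
  exact ((tendsto_neg_atTop_atBot.comp h).atBot_div_const Real.pi_pos).mono_right
    atBot_le_cocompact

theorem continuous_glueBoundary (c0 : Continuous ψ₀) (c1 : Continuous ψ₁)
    (h0 : Tendsto ψ₀ (cocompact ℝ) (𝓝 0)) (h1 : Tendsto ψ₁ (cocompact ℝ) (𝓝 0)) :
    Continuous (glueBoundary ψ₀ ψ₁) := by
  rw [continuous_iff_continuousAt]
  intro x
  rcases lt_trichotomy x 0 with hx | rfl | hx
  · have he : glueBoundary ψ₀ ψ₁ =ᶠ[𝓝 x] fun x => ψ₁ (-Real.log x / Real.pi) := by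
      filter_upwards [Iio_mem_nhds hx] with y hy
      have hy' : y < 0 := hy
      simp [glueBoundary, hy', hy'.le.not_gt]
    refine ContinuousAt.congr ?_ he.symm
    exact c1.continuousAt.comp ((Real.continuousAt_log hx.ne).neg.div_const _)
  · rw [← continuousWithinAt_compl_self]
    have hz : glueBoundary ψ₀ ψ₁ 0 = 0 := by simp [glueBoundary]
    unfold ContinuousWithinAt
    rw [hz]
    exact tendsto_glueBoundary_of_log h0 h1
      (((tendsto_neg_atBot_atTop.comp Real.tendsto_log_nhdsNE_zero).atTop_div_const
        Real.pi_pos).mono_right atTop_le_cocompact)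
  · have he : glueBoundary ψ₀ ψ₁ =ᶠ[𝓝 x] fun x => ψ₀ (-Real.log x / Real.pi) := by
      filter_upwards [Ioi_mem_nhds hx] with y hy
      have hy' : 0 < y := hy
      simp [glueBoundary, hy']
    refine ContinuousAt.congr ?_ he.symm
    exact c0.continuousAt.comp ((Real.continuousAt_log hx.ne').neg.div_const _)

/-- The point of the real line that corresponds to a point of the circle. -/
def circleToLine (a : ℂ) (w : Circle) : ℂ := (a - w * (starRingEnd ℂ) a) / (1 - w)

theorem conj_circleToLine (a : ℂ) {w : Circle} (hw : w ≠ 1) :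
    (starRingEnd ℂ) (circleToLine a w) = circleToLine a w := by
  have hw1 : (1 : ℂ) - w ≠ 0 := by
    rw [sub_ne_zero]
    exact fun h => hw (Circle.ext h.symm)
  have hw0 : (w : ℂ) ≠ 0 := Circle.coe_ne_zero w
  have hw2 : (w : ℂ) - 1 ≠ 0 := by rw [← neg_ne_zero]; simpa using hw1
  unfold circleToLine
  rw [map_div₀, map_sub, map_sub, map_mul, Complex.conj_conj, map_one, ← Circle.coe_inv_eq_conj,
    Circle.coe_inv, div_eq_div_iff ?_ hw1]
  · field_simp
    ring
  · intro h
    apply hw2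
    field_simp at h
    simpa using h

/-- The point 1 of the circle corresponds to ∞ on the line: the denominator tends to 0 there, while
the numerator tends to a - conj a, which is not 0. -/
theorem tendsto_circleToLine {a : ℂ} (ha : 0 < a.im) :
    Tendsto (fun w : Circle => (circleToLine a w).re) (𝓝[≠] 1) (cocompact ℝ) := by
  rw [← Metric.cobounded_eq_cocompact, ← comap_norm_atTop, tendsto_comap_iff]
  have hnum : Tendsto (fun w : Circle => ‖a - w * (starRingEnd ℂ) a‖) (𝓝[≠] 1)
      (𝓝 ‖a - (1 : Circle) * (starRingEnd ℂ) a‖) := by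
    refine Tendsto.mono_left ?_ nhdsWithin_le_nhds
    exact (by fun_prop : Continuous fun w : Circle => ‖a - w * (starRingEnd ℂ) a‖).tendsto 1
  have hden : Tendsto (fun w : Circle => ‖(1 : ℂ) - w‖) (𝓝[≠] 1) (𝓝[>] 0) := by
    refine tendsto_nhdsWithin_iff.mpr ⟨?_, ?_⟩
    · have : Tendsto (fun w : Circle => ‖(1 : ℂ) - w‖) (𝓝 1) (𝓝 ‖(1 : ℂ) - (1 : Circle)‖) :=
        (by fun_prop : Continuous fun w : Circle => ‖(1 : ℂ) - w‖).tendsto 1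
      simpa using this.mono_left nhdsWithin_le_nhds
    · filter_upwards [self_mem_nhdsWithin] with w hw
      refine norm_pos_iff.mpr ?_
      rw [sub_ne_zero]
      exact fun h => hw (Circle.ext h.symm)
  have hpos : 0 < ‖a - (1 : Circle) * (starRingEnd ℂ) a‖ := by
    refine norm_pos_iff.mpr fun h => ?_
    have := congrArg Complex.im h
    simp at this
    linarith
  refine (hnum.pos_mul_atTop hpos hden.inv_tendsto_nhdsGT_zero).congr' ?_
  filter_upwards [self_mem_nhdsWithin] with w hw
  have h := Complex.conj_eq_iff_re.mp (conj_circleToLine a hw)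
  have h2 : ‖circleToLine a w‖ = ‖(circleToLine a w).re‖ := by
    conv_lhs => rw [← h]
    simp
  rw [Function.comp, ← h2, circleToLine, norm_div, Pi.inv_apply, div_eq_mul_inv]

open Classical in
/-- Every pair of continuous functions on the two boundary lines vanishing at infinity is
uniformly close to the boundary values of the real part of a bounded analytic function. -/
theorem exists_analytic_re_near (h0 : 0 < θ) (h1 : θ < 1) (c0 : Continuous ψ₀)
    (c1 : Continuous ψ₁) (l0 : Tendsto ψ₀ (cocompact ℝ) (𝓝 0))
    (l1 : Tendsto ψ₁ (cocompact ℝ) (𝓝 0)) {ε : ℝ} (hε : 0 < ε) :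
    ∃ h : ℂ → ℂ, DiffContOnCl ℂ h strip ∧ (∃ K, ∀ z ∈ closedStrip, ‖h z‖ ≤ K) ∧
      (∀ t : ℝ, |(h (t * Complex.I)).re - ψ₀ t| < ε) ∧
      ∀ t : ℝ, |(h (1 + t * Complex.I)).re - ψ₁ t| < ε := by
  set a : ℂ := Complex.exp (Real.pi * θ * Complex.I) with ha
  have hapos : 0 < a.im := im_exp_pi_pos h0 h1
  -- The boundary data carried to the circle, with value 0 at the point at infinity; decay of ψ₀ and
  -- ψ₁ makes it continuous. A polynomial approximating it on the circle is pulled back by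
  -- `stripToDisc`.
  set Ψ : Circle → ℝ := fun w => if w = 1 then 0 else
    glueBoundary ψ₀ ψ₁ (circleToLine a w).re with hΨ
  have hcont : Continuous Ψ := by
    rw [continuous_iff_continuousAt]
    intro w
    by_cases hw : w = 1
    · rw [hw, ← continuousWithinAt_compl_self]
      unfold ContinuousWithinAt
      have : Ψ 1 = 0 := by simp [hΨ]
      rw [this]
      refine ((tendsto_glueBoundary_cocompact l0 l1).comp (tendsto_circleToLine hapos)).congr' ?_
      filter_upwards [self_mem_nhdsWithin] with w hw
      have hw' : w ≠ 1 := hw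
      simp [hΨ, hw']
    · have he : Ψ =ᶠ[𝓝 w] fun w => glueBoundary ψ₀ ψ₁ (circleToLine a w).re := by
        filter_upwards [isOpen_ne.mem_nhds hw] with v hv
        have hv' : v ≠ 1 := hv
        simp [hΨ, hv']
      refine ContinuousAt.congr ?_ he.symm
      refine (continuous_glueBoundary c0 c1 l0 l1).continuousAt.comp
        (Complex.continuous_re.continuousAt.comp ?_)
      unfold circleToLine
      refine ContinuousAt.div (by fun_prop) (by fun_prop) ?_
      rw [sub_ne_zero]
      exact fun h => hw (Circle.ext h.symm)
  obtain ⟨q, hq⟩ := exists_polynomial_re_near hcont hε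
  have hbd : ∀ x : ℝ, x ≠ 0 → |(q.eval (((x : ℂ) - a) / (x - (starRingEnd ℂ) a))).re -
      glueBoundary ψ₀ ψ₁ x| < ε := by
    intro x _
    let w : Circle := ⟨((x : ℂ) - a) / (x - (starRingEnd ℂ) a),
      mem_sphere_zero_iff_norm.mpr (norm_sub_div_sub_conj_eq hapos x)⟩
    have hd := sub_conj_ne_zero hapos (x := x) (by simp)
    have haa : a - (starRingEnd ℂ) a ≠ 0 := sub_conj_ne_zero hapos hapos.le
    have hw : 1 - (w : ℂ) = (a - (starRingEnd ℂ) a) / (x - (starRingEnd ℂ) a) := by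
      show 1 - ((x : ℂ) - a) / (x - (starRingEnd ℂ) a) = _
      field_simp
      ring
    have hw1 : w ≠ 1 := by
      intro h
      rw [h] at hw
      simp only [Circle.coe_one, sub_self] at hw
      exact div_ne_zero haa hd hw.symm
    have hline : circleToLine a w = x := by
      unfold circleToLine
      rw [hw]
      show (a - ((x : ℂ) - a) / (x - (starRingEnd ℂ) a) * (starRingEnd ℂ) a) / _ = _
      field_simp
      ring
    have := hq w
    simpa [hΨ, hw1, hline, w] using this
  have hdiff : DifferentiableOn ℂ (fun z => q.eval (stripToDisc θ z)) closedStrip := by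
    refine q.differentiable.comp_differentiableOn ?_
    unfold stripToDisc
    refine DifferentiableOn.div (by fun_prop) (by fun_prop) fun z hz => ?_
    exact sub_conj_ne_zero hapos (im_exp_pi_mul_nonneg hz)
  refine ⟨fun z => q.eval (stripToDisc θ z),
    ⟨hdiff.mono strip_subset_closedStrip, closure_strip ▸ hdiff.continuousOn⟩, ?_, ?_, ?_⟩
  · obtain ⟨K, hK⟩ := (isCompact_closedBall (0 : ℂ) 1).exists_bound_of_continuousOn
      q.continuous.continuousOn
    refine ⟨K, fun z hz => hK _ ?_⟩
    rw [mem_closedBall_zero_iff]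
    exact norm_sub_div_sub_conj_le hapos (im_exp_pi_mul_nonneg hz)
  · intro t
    have hx := Real.exp_pos (-(Real.pi * t))
    have := hbd _ hx.ne'
    have hg : glueBoundary ψ₀ ψ₁ (Real.exp (-(Real.pi * t))) = ψ₀ t := by
      simp only [glueBoundary, hx, if_true, Real.log_exp, neg_neg]
      rw [mul_div_cancel_left₀ _ Real.pi_ne_zero]
    rw [hg] at this
    simpa only [stripToDisc, exp_left] using this
  · intro t
    have hx := Real.exp_pos (-(Real.pi * t))
    have := hbd _ (neg_ne_zero.mpr hx.ne')
    have hg : glueBoundary ψ₀ ψ₁ (-Real.exp (-(Real.pi * t))) = ψ₁ t := by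
      simp only [glueBoundary, neg_pos, hx.le.not_gt, if_false, neg_lt_zero, hx, if_true,
        Real.log_neg_eq_log, Real.log_exp, neg_neg]
      rw [mul_div_cancel_left₀ _ Real.pi_ne_zero]
    rw [hg] at this
    simpa only [stripToDisc, exp_right] using this

/-- The real part of a bounded analytic function is bounded below by its boundary values. -/
theorem le_re_of_strip {h : ℂ → ℂ} (hd : DiffContOnCl ℂ h strip)
    (hb : ∃ K, ∀ z ∈ closedStrip, ‖h z‖ ≤ K) {m : ℝ}
    (h0 : ∀ t : ℝ, m ≤ (h (t * Complex.I)).re) (h1 : ∀ t : ℝ, m ≤ (h (1 + t * Complex.I)).re)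
    {z : ℂ} (hz : z ∈ closedStrip) : m ≤ (h z).re := by
  -- As |exp(-h)| = exp(-Re h), the maximum principle for this function is a minimum principle for
  -- Re h.
  have hd' : DiffContOnCl ℂ (fun z => Complex.exp (-h z)) strip :=
    ⟨hd.differentiableOn.neg.cexp, (hd.continuousOn.neg).cexp⟩
  obtain ⟨K, hK⟩ := hb
  have := norm_le_of_strip hd' (C := Real.exp (-m)) ⟨Real.exp K, fun z hz => ?_⟩ ?_ ?_ hz
  · rw [Complex.norm_exp, Real.exp_le_exp] at this
    simpa using this
  · rw [Complex.norm_exp, Real.exp_le_exp, Complex.neg_re]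
    exact (neg_le_abs _).trans ((Complex.abs_re_le_norm _).trans (hK z hz))
  · intro t
    rw [Complex.norm_exp, Real.exp_le_exp, Complex.neg_re]
    linarith [h0 t]
  · intro t
    rw [Complex.norm_exp, Real.exp_le_exp, Complex.neg_re]
    linarith [h1 t]

theorem exists_bound_of_tendsto_cocompact {ψ : ℝ → ℝ} (c : Continuous ψ)
    (l : Tendsto ψ (cocompact ℝ) (𝓝 0)) : ∃ K, ∀ t, ‖ψ t‖ ≤ K :=
  ⟨_, fun t => (⟨⟨ψ, c⟩, l⟩ : C₀(ℝ, ℝ)).toBCF.norm_coe_le_norm t⟩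

theorem re_integral_pois_le {c : ℝ} (h0 : 0 < c) (h1 : c < 1) {g : ℝ → ℂ} (hg : Continuous g)
    {K : ℝ} (hK : ∀ t, ‖g t‖ ≤ K) {ψ : ℝ → ℝ} (hψ : Continuous ψ) {K' : ℝ}
    (hK' : ∀ t, ‖ψ t‖ ≤ K') {ε : ℝ} (h : ∀ t, (g t).re ≤ ψ t + ε) :
    (∫ t, pois c t • g t).re ≤ (∫ t, pois c t * ψ t) + c * ε := by
  have i := integrable_pois_mul h0 h1 hg hK
  have j : Integrable fun t => pois c t * ψ t := integrable_pois_mul h0 h1 hψ hK'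
  have k := (integrable_pois h0 h1).mul_const ε
  have e1 : ∫ t, (pois c t • g t).re = (∫ t, pois c t • g t).re := integral_re i
  have e2 : (∫ t, pois c t * ψ t) + c * ε = ∫ t, (pois c t * ψ t + pois c t * ε) := by
    rw [integral_add j k, integral_mul_const, integral_pois h0 h1]
  rw [← e1, e2]
  refine integral_mono i.re (j.add k) fun t => ?_
  have := mul_le_mul_of_nonneg_left (h t) (pois_pos h0 h1 t).le
  simpa [mul_add] using this

/-- A bounded analytic function with positive real part that dominates given boundary values,
with almost optimal value at `θ`. -/
theorem exists_analytic_majorant (h0 : 0 < θ) (h1 : θ < 1) (c0 : Continuous ψ₀)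
    (c1 : Continuous ψ₁) (l0 : Tendsto ψ₀ (cocompact ℝ) (𝓝 0))
    (l1 : Tendsto ψ₁ (cocompact ℝ) (𝓝 0)) (p0 : ∀ t, 0 ≤ ψ₀ t) (p1 : ∀ t, 0 ≤ ψ₁ t)
    {ε : ℝ} (hε : 0 < ε) :
    ∃ h : ℂ → ℂ, DiffContOnCl ℂ h strip ∧ (∃ K, ∀ z ∈ closedStrip, ‖h z‖ ≤ K) ∧
      (∃ m, 0 < m ∧ ∀ z ∈ closedStrip, m ≤ (h z).re) ∧
      (∀ t : ℝ, ψ₀ t ≤ (h (t * Complex.I)).re) ∧ (∀ t : ℝ, ψ₁ t ≤ (h (1 + t * Complex.I)).re) ∧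
      ‖h θ‖ ≤ (∫ t, pois (1 - θ) t * ψ₀ t) + (∫ t, pois θ t * ψ₁ t) + ε := by
  obtain ⟨g, gd, ⟨K, gK⟩, g0, g1⟩ :=
    exists_analytic_re_near h0 h1 c0 c1 l0 l1 (ε := ε / 3) (by positivity)
  have hθ : (θ : ℂ) ∈ closedStrip := strip_subset_closedStrip (ofReal_mem_strip h0 h1)
  -- The real part lifts the approximation above the boundary data by at least ε/3, and by at most
  -- ε. The imaginary part makes the value at θ real, so that its modulus is the real part given by
  -- the Poisson formula.
  set a : ℂ := ((2 * ε / 3 : ℝ) : ℂ) - ((g θ).im : ℝ) * Complex.I with ha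
  have hare : a.re = 2 * ε / 3 := by simp [ha]
  have haim : a.im = -(g θ).im := by simp [ha]
  set h : ℂ → ℂ := fun z => g z + a with hh
  have hd : DiffContOnCl ℂ h strip := gd.add_const a
  have hK : ∀ z ∈ closedStrip, ‖h z‖ ≤ K + ‖a‖ := fun z hz =>
    (norm_add_le _ _).trans (by linarith [gK z hz])
  have hre : ∀ z, (h z).re = (g z).re + 2 * ε / 3 := fun z => by simp [hh, hare]
  have b0 : ∀ t : ℝ, ψ₀ t + ε / 3 ≤ (h (t * Complex.I)).re := fun t => by
    have := (abs_lt.mp (g0 t)).1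
    rw [hre]; linarith
  have b1 : ∀ t : ℝ, ψ₁ t + ε / 3 ≤ (h (1 + t * Complex.I)).re := fun t => by
    have := (abs_lt.mp (g1 t)).1
    rw [hre]; linarith
  have u0 : ∀ t : ℝ, (h (t * Complex.I)).re ≤ ψ₀ t + ε := fun t => by
    have := (abs_lt.mp (g0 t)).2
    rw [hre]; linarith
  have u1 : ∀ t : ℝ, (h (1 + t * Complex.I)).re ≤ ψ₁ t + ε := fun t => by
    have := (abs_lt.mp (g1 t)).2
    rw [hre]; linarith
  have hpos : ∀ z ∈ closedStrip, ε / 3 ≤ (h z).re := fun z hz =>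
    le_re_of_strip hd ⟨_, hK⟩ (fun t => by linarith [b0 t, p0 t])
      (fun t => by linarith [b1 t, p1 t]) hz
  refine ⟨h, hd, ⟨_, hK⟩, ⟨ε / 3, by positivity, hpos⟩, fun t => by linarith [b0 t],
    fun t => by linarith [b1 t], ?_⟩
  have him : (h θ).im = 0 := by simp [hh, haim]
  have hnorm : ‖h θ‖ = (h θ).re := by
    have : h θ = ((h θ).re : ℂ) := Complex.ext (by simp) (by simp [him])
    rw [this, Complex.norm_real, Complex.ofReal_re, Real.norm_of_nonneg]
    linarith [hpos _ hθ]
  have q0 : 0 < 1 - θ := by linarith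
  have q1 : 1 - θ < 1 := by linarith
  have hc : ContinuousOn h closedStrip := closure_strip ▸ hd.continuousOn
  have hc0 : Continuous fun t : ℝ => h (t * Complex.I) :=
    hc.comp_continuous (by fun_prop) ofReal_mul_I_mem_closedStrip
  have hc1 : Continuous fun t : ℝ => h (1 + t * Complex.I) :=
    hc.comp_continuous (by fun_prop) one_add_mul_I_mem_closedStrip
  obtain ⟨K0, hK0⟩ := exists_bound_of_tendsto_cocompact c0 l0
  obtain ⟨K1, hK1⟩ := exists_bound_of_tendsto_cocompact c1 l1
  have r0 := re_integral_pois_le q0 q1 hc0 (fun t => hK _ (ofReal_mul_I_mem_closedStrip t)) c0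
    hK0 u0
  have r1 := re_integral_pois_le h0 h1 hc1 (fun t => hK _ (one_add_mul_I_mem_closedStrip t)) c1
    hK1 u1
  rw [hnorm, poisson_formula h0 h1 hd ⟨_, hK⟩, Complex.add_re]
  linarith

end StripToDisc

/-! ### Interpolation spaces inside the predual -/

theorem norm_exp_gauss_le {δ θ : ℝ} (hδ : 0 ≤ δ) (hθ : θ ∈ Set.Icc (0 : ℝ) 1) {z : ℂ}
    (hz : z ∈ closedStrip) :
    ‖Complex.exp (δ * (z - θ) ^ 2)‖ ≤ Real.exp δ * Real.exp (-(δ * z.im ^ 2)) := by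
  rw [Complex.norm_exp, ← Real.exp_add, Real.exp_le_exp]
  have h : ((δ : ℂ) * (z - θ) ^ 2).re = δ * ((z.re - θ) ^ 2 - z.im ^ 2) := by
    simp [sq, Complex.mul_re]
  rw [h]
  have h2 : (z.re - θ) ^ 2 ≤ 1 := by
    rw [sq_le_one_iff_abs_le_one, abs_le]
    constructor <;> linarith [hz.1, hz.2, hθ.1, hθ.2]
  nlinarith

theorem tendsto_exp_neg_mul_sq_cocompact {δ : ℝ} (hδ : 0 < δ) :
    Tendsto (fun t : ℝ => Real.exp (-(δ * t ^ 2))) (cocompact ℝ) (𝓝 0) := by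
  refine Real.tendsto_exp_neg_atTop_nhds_zero.comp (Tendsto.const_mul_atTop hδ ?_)
  refine ((tendsto_pow_atTop two_ne_zero).comp (tendsto_norm_cocompact_atTop (E := ℝ))).congr
    fun t => ?_
  simp

namespace NormalFaithfulState

variable {M P : Type*} [JBStarAlgebra M] [NormedAddCommGroup P] [NormedSpace ℂ P]
  [CompleteSpace P] {e : M ≃ₗᵢ[ℂ] StrongDual ℂ P} (φ : NormalFaithfulState e)

theorem inl_eq_inr (x : M) : φ.couple.inl x = φ.couple.inr (φ.toPredual x) := by
  unfold InterpolationCouple.inl InterpolationCouple.inr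
  rw [Submodule.mkQ_apply, Submodule.mkQ_apply, Submodule.Quotient.eq, ← WithLp.toLp_sub]
  show φ.couple.addMap _ = 0
  simp [InterpolationCouple.addMap, couple, predualInclusion_toPredual]

theorem norm_translate_le (x : M) : ‖φ.translate x‖ ≤ ‖x‖ := by
  refine ContinuousLinearMap.opNorm_le_bound _ (norm_nonneg x) fun y => ?_
  rw [translate_apply]
  exact (φ.norm_toDual_le _).trans (JBStarAlgebra.norm_mul_le' x y)

theorem norm_addMap_le (w : WithLp 1 (M × P)) : ‖φ.couple.addMap w‖ ≤ ‖w‖ := by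
  rw [WithLp.prod_norm_eq_of_L1]
  have : φ.couple.addMap w = φ.translate w.fst + predualInclusion e w.snd := rfl
  rw [this]
  exact (norm_add_le _ _).trans (add_le_add (φ.norm_translate_le _)
    (norm_predualInclusion e _).le)

/-- As x ↦ φ_x is contractive, no decomposition of ω into a summand from M and one from M_* has a
smaller total norm than ω itself. -/
theorem norm_inr (ω : P) : ‖φ.couple.inr ω‖ = ‖ω‖ := by
  refine le_antisymm (φ.couple.norm_inr_le ω) (le_of_forall_pos_le_add fun ε hε => ?_)
  obtain ⟨w, hw, hlt⟩ := Submodule.Quotient.norm_mk_lt (φ.couple.inr ω) hε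
  have h1 : φ.couple.addMap w = predualInclusion e ω := by
    have h2 : w - WithLp.toLp 1 (0, ω) ∈ φ.couple.addMap.ker :=
      (Submodule.Quotient.eq _).mp hw
    have h3 : φ.couple.addMap (w - WithLp.toLp 1 (0, ω)) = 0 := h2
    rw [map_sub, sub_eq_zero] at h3
    rw [h3]
    simp [InterpolationCouple.addMap, couple]
  rw [← norm_predualInclusion e ω, ← h1]
  exact (φ.norm_addMap_le w).trans hlt.le

/-- The sum `M + M_*` is the predual `M_*`. -/
def predualEquivSum : P ≃ₗᵢ[ℂ] φ.couple.Sum :=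
  LinearIsometryEquiv.ofSurjective
    { toFun := φ.couple.inr
      map_add' := φ.couple.inr_add
      map_smul' := φ.couple.inr_smul
      norm_map' := φ.norm_inr } fun s => by
    obtain ⟨w, rfl⟩ := Submodule.Quotient.mk_surjective _ s
    refine ⟨φ.toPredual w.fst + w.snd, ?_⟩
    show φ.couple.inr _ = _
    rw [φ.couple.inr_add, ← φ.inl_eq_inr]
    unfold InterpolationCouple.inl InterpolationCouple.inr
    rw [← map_add, ← WithLp.toLp_add]
    simp only [Prod.mk_add_mk, add_zero, zero_add]
    rfl

variable {θ : Set.Icc (0 : ℝ) 1}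

/-- The inclusion of an interpolation space into the predual. -/
def val : φ.couple.Interpolation θ →ₗ[ℂ] P :=
  φ.predualEquivSum.symm.toLinearEquiv.toLinearMap ∘ₗ InterpolationCouple.Interpolation.toSum

theorem inr_val (h : φ.couple.Interpolation θ) :
    φ.couple.inr (φ.val h) = InterpolationCouple.Interpolation.toSum h :=
  φ.predualEquivSum.apply_symm_apply _

theorem val_injective : Function.Injective (φ.val (θ := θ)) := fun _ _ h =>
  Subtype.ext (φ.predualEquivSum.symm.injective h)

theorem norm_val_le (h : φ.couple.Interpolation θ) : ‖φ.val h‖ ≤ ‖h‖ := by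
  rw [← φ.norm_inr, φ.inr_val]
  refine InterpolationCouple.Interpolation.le_norm h _ fun f hf => ?_
  rw [← hf]
  exact f.norm_apply_le _ (by simpa using θ.2.1) (by simpa using θ.2.2)

/-- A bounded continuous function on the closed strip, holomorphic inside, with values in the
predual, whose values on `Re z = 0` come from a continuous function `u` to `M`, and whose two
boundary functions are bounded by `C`. -/
structure BddStrip (F : ℂ → P) (u : ℝ → M) (C : ℝ) : Prop where
  diff : DiffContOnCl ℂ F strip
  bdd : ∃ K, ∀ z ∈ closedStrip, ‖F z‖ ≤ K
  cont : Continuous u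
  left : ∀ t : ℝ, F (t * Complex.I) = φ.toPredual (u t)
  norm_left : ∀ t, ‖u t‖ ≤ C
  norm_right : ∀ t : ℝ, ‖F (1 + t * Complex.I)‖ ≤ C

theorem norm_toPredual_le (x : M) : ‖φ.toPredual x‖ ≤ ‖x‖ := by
  rw [← φ.norm_inr, ← φ.inl_eq_inr]
  exact φ.couple.norm_inl_le x

namespace BddStrip

variable {φ} {F : ℂ → P} {u : ℝ → M} {C : ℝ}

theorem continuousOn (hF : φ.BddStrip F u C) : ContinuousOn F closedStrip :=
  closure_strip ▸ hF.diff.continuousOn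

theorem continuous_right (hF : φ.BddStrip F u C) :
    Continuous fun t : ℝ => F (1 + t * Complex.I) :=
  hF.continuousOn.comp_continuous (by fun_prop) one_add_mul_I_mem_closedStrip

theorem nonneg (hF : φ.BddStrip F u C) : 0 ≤ C := (norm_nonneg _).trans (hF.norm_left 0)

theorem norm_le (hF : φ.BddStrip F u C) {z : ℂ} (hz : z ∈ closedStrip) : ‖F z‖ ≤ C :=
  norm_le_of_strip hF.diff hF.bdd
    (fun t => by rw [hF.left]; exact (φ.norm_toPredual_le _).trans (hF.norm_left t))
    hF.norm_right hz

/-- The product with a bounded analytic function. -/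
theorem smul (hF : φ.BddStrip F u C) {g : ℂ → ℂ} (hg : DiffContOnCl ℂ g strip)
    (hb : ∃ K, ∀ z ∈ closedStrip, ‖g z‖ ≤ K) {C' : ℝ}
    (h0 : ∀ t : ℝ, ‖g (t * Complex.I) • u t‖ ≤ C')
    (h1 : ∀ t : ℝ, ‖g (1 + t * Complex.I) • F (1 + t * Complex.I)‖ ≤ C') :
    φ.BddStrip (fun z => g z • F z) (fun t => g (t * Complex.I) • u t) C' where
  diff := hg.smul hF.diff
  bdd := by
    obtain ⟨K, hK⟩ := hb
    refine ⟨K * C, fun z hz => ?_⟩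
    rw [norm_smul]
    exact mul_le_mul (hK z hz) (hF.norm_le hz) (norm_nonneg _)
      ((norm_nonneg _).trans (hK z hz))
  cont := by
    have : ContinuousOn g closedStrip := closure_strip ▸ hg.continuousOn
    exact (this.comp_continuous (by fun_prop) ofReal_mul_I_mem_closedStrip).smul hF.cont
  left t := by rw [hF.left, map_smul]
  norm_left := h0
  norm_right := h1

theorem add (hF : φ.BddStrip F u C) {F' : ℂ → P} {u' : ℝ → M} {C' : ℝ}
    (hF' : φ.BddStrip F' u' C') :
    φ.BddStrip (fun z => F z + F' z) (fun t => u t + u' t) (C + C') where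
  diff := hF.diff.add hF'.diff
  bdd := ⟨C + C', fun z hz => (norm_add_le _ _).trans (add_le_add (hF.norm_le hz)
    (hF'.norm_le hz))⟩
  cont := hF.cont.add hF'.cont
  left t := by rw [hF.left, hF'.left, map_add]
  norm_left t := (norm_add_le _ _).trans (add_le_add (hF.norm_left t) (hF'.norm_left t))
  norm_right t := (norm_add_le _ _).trans (add_le_add (hF.norm_right t) (hF'.norm_right t))

end BddStrip

theorem diffContOnCl_gauss (δ θ : ℝ) :
    DiffContOnCl ℂ (fun z : ℂ => Complex.exp (δ * (z - θ) ^ 2)) strip :=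
  Differentiable.diffContOnCl (by fun_prop)

/-- Multiplying by a Gaussian turns a bounded strip function into one with decay. -/
theorem BddStrip.exists_stripFunction {F : ℂ → P} {u : ℝ → M} {C : ℝ}
    (hF : φ.BddStrip F u C) (hθ : (θ : ℝ) ∈ Set.Icc (0 : ℝ) 1) {δ : ℝ} (hδ : 0 < δ) :
    ∃ f : φ.couple.StripFunction, f.toFun ((θ : ℝ) : ℂ) = φ.couple.inr (F (θ : ℝ)) ∧
      f.norm ≤ Real.exp δ * C := by
  set g : ℂ → ℂ := fun z => Complex.exp (δ * (z - (θ : ℝ)) ^ 2) with hg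
  have hgd : DiffContOnCl ℂ g strip := diffContOnCl_gauss δ θ
  have hgc : Continuous g := by rw [hg]; fun_prop
  have hgb : ∀ z ∈ closedStrip, ‖g z‖ ≤ Real.exp δ * Real.exp (-(δ * z.im ^ 2)) :=
    fun z hz => norm_exp_gauss_le hδ.le hθ hz
  have hgb' : ∀ z ∈ closedStrip, ‖g z‖ ≤ Real.exp δ := fun z hz => (hgb z hz).trans
    (mul_le_of_le_one_right (Real.exp_pos _).le (Real.exp_le_one_iff.mpr (by
      have : 0 ≤ δ * z.im ^ 2 := by positivity
      linarith)))
  have hC := hF.nonneg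
  have b0 : ∀ t : ℝ, ‖g (t * Complex.I) • u t‖ ≤ Real.exp δ * C := fun t => by
    rw [norm_smul]
    exact mul_le_mul (hgb' _ (ofReal_mul_I_mem_closedStrip t)) (hF.norm_left t) (norm_nonneg _)
      (Real.exp_pos _).le
  have b1 : ∀ t : ℝ, ‖g (1 + t * Complex.I) • F (1 + t * Complex.I)‖ ≤ Real.exp δ * C :=
    fun t => by
    rw [norm_smul]
    exact mul_le_mul (hgb' _ (one_add_mul_I_mem_closedStrip t)) (hF.norm_right t) (norm_nonneg _)
      (Real.exp_pos _).le
  have hG := hF.smul hgd ⟨_, hgb'⟩ b0 b1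
  have hlim : Tendsto (fun t : ℝ => Real.exp δ * Real.exp (-(δ * t ^ 2)) * C) (cocompact ℝ)
      (𝓝 0) := by
    simpa using ((tendsto_exp_neg_mul_sq_cocompact hδ).const_mul (Real.exp δ)).mul_const C
  let f : φ.couple.StripFunction :=
    { toFun := fun z => φ.predualEquivSum (g z • F z)
      continuousOn := φ.predualEquivSum.continuous.comp_continuousOn hG.continuousOn
      bounded := ⟨Real.exp δ * C, fun z h0 h1 => by
        rw [LinearIsometryEquiv.norm_map]; exact hG.norm_le ⟨h0, h1⟩⟩
      holomorphic := φ.predualEquivSum.toContinuousLinearEquiv.differentiable.comp_differentiableOn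
        hG.diff.differentiableOn
      leftBoundary := ⟨⟨fun t => g (t * Complex.I) • u t, hG.cont⟩, by
        refine squeeze_zero_norm (fun t => ?_) hlim
        show ‖g (t * Complex.I) • u t‖ ≤ _
        rw [norm_smul]
        have := hgb _ (ofReal_mul_I_mem_closedStrip t)
        simp only [Complex.mul_im, Complex.ofReal_re, Complex.I_im, mul_one, Complex.ofReal_im,
          Complex.I_re, mul_zero, add_zero] at this
        exact mul_le_mul this (hF.norm_left t) (norm_nonneg _) (by positivity)⟩
      rightBoundary := ⟨⟨fun t => g (1 + t * Complex.I) • F (1 + t * Complex.I),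
          hG.continuous_right⟩, by
        refine squeeze_zero_norm (fun t => ?_) hlim
        show ‖g (1 + t * Complex.I) • F (1 + t * Complex.I)‖ ≤ _
        rw [norm_smul]
        have := hgb _ (one_add_mul_I_mem_closedStrip t)
        simp only [Complex.add_im, Complex.one_im, Complex.mul_im, Complex.ofReal_re,
          Complex.I_im, mul_one, Complex.ofReal_im, Complex.I_re, mul_zero, add_zero,
          zero_add] at this
        exact mul_le_mul this (hF.norm_right t) (norm_nonneg _) (by positivity)⟩
      left_eq := fun t => by
        rw [φ.inl_eq_inr]
        show φ.couple.inr _ = _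
        rw [hG.left]
        rfl
      right_eq := fun t => rfl }
  refine ⟨f, ?_, ?_⟩
  · show φ.couple.inr (g (θ : ℝ) • F (θ : ℝ)) = _
    simp [hg]
  · refine max_le ?_ ?_
    · exact (BoundedContinuousFunction.norm_le (by positivity)).mpr b0
    · exact (BoundedContinuousFunction.norm_le (by positivity)).mpr b1

/-- The Gaussian factor is 1 at θ and costs only e^δ, which tends to 1. Hence decay at infinity may
be dropped from the definition of the interpolation norm, and constants become admissible. -/
theorem BddStrip.exists_val {F : ℂ → P} {u : ℝ → M} {C : ℝ} (hF : φ.BddStrip F u C)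
    (θ : Set.Icc (0 : ℝ) 1) :
    ∃ h : φ.couple.Interpolation θ, φ.val h = F (θ : ℝ) ∧ ‖h‖ ≤ C := by
  obtain ⟨f, hf, -⟩ := BddStrip.exists_stripFunction φ hF θ.2 one_pos
  let h : φ.couple.Interpolation θ := ⟨φ.couple.inr (F (θ : ℝ)), f, hf⟩
  refine ⟨h, φ.predualEquivSum.symm_apply_apply _, ?_⟩
  have hlim : Tendsto (fun δ : ℝ => Real.exp δ * C) (𝓝[>] 0) (𝓝 (Real.exp 0 * C)) :=
    (by fun_prop : Continuous fun δ : ℝ => Real.exp δ * C).continuousAt.tendsto.mono_left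
      nhdsWithin_le_nhds
  rw [Real.exp_zero, one_mul] at hlim
  refine ge_of_tendsto hlim ?_
  filter_upwards [self_mem_nhdsWithin] with δ hδ
  obtain ⟨f, hf, hn⟩ := BddStrip.exists_stripFunction φ hF θ.2 hδ
  exact (InterpolationCouple.Interpolation.norm_le h f hf).trans hn

theorem BddStrip.norm_le_of_val_eq {F : ℂ → P} {u : ℝ → M} {C : ℝ} (hF : φ.BddStrip F u C)
    {h : φ.couple.Interpolation θ} (hh : φ.val h = F (θ : ℝ)) : ‖h‖ ≤ C := by
  obtain ⟨k, hk, hn⟩ := BddStrip.exists_val φ hF θ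
  rwa [φ.val_injective (hh.trans hk.symm)]

theorem exists_bddStrip (h : φ.couple.Interpolation θ) {C : ℝ} (hC : ‖h‖ < C) :
    ∃ F u, φ.BddStrip F u C ∧ F (θ : ℝ) = φ.val h ∧ Tendsto u (cocompact ℝ) (𝓝 0) ∧
      Tendsto (fun t : ℝ => F (1 + t * Complex.I)) (cocompact ℝ) (𝓝 0) := by
  obtain ⟨f, hf, hn⟩ : ∃ f : φ.couple.StripFunction,
      f.toFun ((θ : ℝ) : ℂ) = InterpolationCouple.Interpolation.toSum h ∧ f.norm < C := by
    by_contra! hcon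
    exact hC.not_ge (InterpolationCouple.Interpolation.le_norm h C hcon)
  have hright : ∀ t : ℝ, φ.predualEquivSum.symm (f.toFun (1 + t * Complex.I)) =
      f.rightBoundary t := fun t => by
    rw [f.right_eq]
    exact φ.predualEquivSum.symm_apply_apply _
  refine ⟨fun z => φ.predualEquivSum.symm (f.toFun z), f.leftBoundary, ⟨⟨?_, ?_⟩, ?_, ?_, ?_, ?_,
    ?_⟩, ?_, f.leftBoundary.zero_at_infty', ?_⟩
  · exact φ.predualEquivSum.symm.toContinuousLinearEquiv.differentiable.comp_differentiableOn
      f.holomorphic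
  · rw [closure_strip]
    exact φ.predualEquivSum.symm.continuous.comp_continuousOn f.continuousOn
  · exact ⟨f.norm, fun z hz => by
      rw [LinearIsometryEquiv.norm_map]; exact f.norm_apply_le z hz.1 hz.2⟩
  · exact f.leftBoundary.continuous
  · intro t
    rw [f.left_eq, φ.inl_eq_inr]
    exact φ.predualEquivSum.symm_apply_apply _
  · intro t
    exact (f.leftBoundary.toBCF.norm_coe_le_norm t).trans ((le_max_left _ _).trans hn.le)
  · intro t
    rw [hright]
    exact (f.rightBoundary.toBCF.norm_coe_le_norm t).trans ((le_max_right _ _).trans hn.le)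
  · show φ.predualEquivSum.symm (f.toFun (θ : ℝ)) = _
    rw [hf]; rfl
  · simp_rw [hright]
    exact f.rightBoundary.zero_at_infty'

/-- The interpolation norm is dominated by the `L¹`-norm of the boundary values with respect to
harmonic measure. -/
theorem BddStrip.norm_le_integral {F : ℂ → P} {u : ℝ → M} {C : ℝ} (hF : φ.BddStrip F u C)
    (h0 : 0 < (θ : ℝ)) (h1 : (θ : ℝ) < 1) {h : φ.couple.Interpolation θ}
    (hh : φ.val h = F (θ : ℝ)) :
    ‖h‖ ≤ (∫ t, pois (1 - θ) t * ‖u t‖) + ∫ t : ℝ, pois θ t * ‖F (1 + t * Complex.I)‖ := by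
  have q0 : 0 < 1 - (θ : ℝ) := by linarith
  have q1 : 1 - (θ : ℝ) < 1 := by linarith
  set N := (∫ t, pois (1 - θ) t * ‖u t‖) + ∫ t : ℝ, pois θ t * ‖F (1 + t * Complex.I)‖ with hN
  have key : ∀ δ : ℝ, 0 < δ → ‖h‖ ≤ Real.exp δ * N + δ := by
    intro δ hδ
    set g : ℂ → ℂ := fun z => Complex.exp (δ * (z - (θ : ℝ)) ^ 2) with hg
    have hgd : DiffContOnCl ℂ g strip := diffContOnCl_gauss δ θ
    have hgc : Continuous g := by rw [hg]; fun_prop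
    have hgb : ∀ z ∈ closedStrip, ‖g z‖ ≤ Real.exp δ * Real.exp (-(δ * z.im ^ 2)) :=
      fun z hz => norm_exp_gauss_le hδ.le θ.2 hz
    have hgb' : ∀ z ∈ closedStrip, ‖g z‖ ≤ Real.exp δ := fun z hz => (hgb z hz).trans
      (mul_le_of_le_one_right (Real.exp_pos _).le (Real.exp_le_one_iff.mpr (by
        have : 0 ≤ δ * z.im ^ 2 := by positivity
        linarith)))
    have hC := hF.nonneg
    have hlim : Tendsto (fun t : ℝ => Real.exp δ * Real.exp (-(δ * t ^ 2)) * C) (cocompact ℝ)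
        (𝓝 0) := by
      simpa using ((tendsto_exp_neg_mul_sq_cocompact hδ).const_mul (Real.exp δ)).mul_const C
    -- The scalar function m dominates the damped norms on the boundary. Dividing by m gives a strip
    -- function of norm at most 1, so ‖h‖ ≤ |m(θ)|, and m(θ) is nearly the Poisson average.
    obtain ⟨m, md, ⟨K, mK⟩, ⟨r, rpos, hr⟩, m0, m1, mθ⟩ := exists_analytic_majorant h0 h1
      (ψ₀ := fun t => ‖g (t * Complex.I)‖ * ‖u t‖)
      (ψ₁ := fun t => ‖g (1 + t * Complex.I)‖ * ‖F (1 + t * Complex.I)‖)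
      (((hgc.comp (by fun_prop)).norm).mul hF.cont.norm)
      (((hgc.comp (by fun_prop)).norm).mul hF.continuous_right.norm)
      (squeeze_zero (fun t => by positivity) (fun t => by
        have := hgb _ (ofReal_mul_I_mem_closedStrip t)
        simp only [Complex.mul_im, Complex.ofReal_re, Complex.I_im, mul_one, Complex.ofReal_im,
          Complex.I_re, mul_zero, add_zero] at this
        exact mul_le_mul this (hF.norm_left t) (norm_nonneg _) (by positivity)) hlim)
      (squeeze_zero (fun t => by positivity) (fun t => by
        have := hgb _ (one_add_mul_I_mem_closedStrip t)
        simp only [Complex.add_im, Complex.one_im, Complex.mul_im, Complex.ofReal_re,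
          Complex.I_im, mul_one, Complex.ofReal_im, Complex.I_re, mul_zero, add_zero,
          zero_add] at this
        exact mul_le_mul this (hF.norm_right t) (norm_nonneg _) (by positivity)) hlim)
      (fun t => by positivity) (fun t => by positivity) hδ
    have hre : ∀ z, (m z).re ≤ ‖m z‖ := fun z => Complex.re_le_norm _
    have hmpos : ∀ z ∈ closedStrip, 0 < ‖m z‖ := fun z hz => rpos.trans_le
      ((hr z hz).trans (hre z))
    have hm0 : ∀ z ∈ closedStrip, m z ≠ 0 := fun z hz => norm_pos_iff.mp (hmpos z hz)
    have hqd : DiffContOnCl ℂ (fun z => g z / m z) strip :=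
      ⟨hgd.differentiableOn.div md.differentiableOn
        fun z hz => hm0 z (strip_subset_closedStrip hz),
        hgd.continuousOn.div md.continuousOn fun z hz => hm0 z (closure_strip ▸ hz)⟩
    have hG := hF.smul hqd (C' := 1) ⟨Real.exp δ / r, fun z hz => by
        rw [norm_div]
        exact div_le_div₀ (Real.exp_pos _).le (hgb' z hz) rpos ((hr z hz).trans (hre z))⟩
      (fun t => by
        rw [norm_smul, norm_div, div_mul_eq_mul_div]
        exact div_le_one_of_le₀ ((m0 t).trans (hre _)) (norm_nonneg _))
      (fun t => by
        rw [norm_smul, norm_div, div_mul_eq_mul_div]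
        exact div_le_one_of_le₀ ((m1 t).trans (hre _)) (norm_nonneg _))
    have hθ : ((θ : ℝ) : ℂ) ∈ closedStrip := strip_subset_closedStrip (ofReal_mem_strip h0 h1)
    have hval : φ.val ((m (θ : ℝ))⁻¹ • h) = (g (θ : ℝ) / m (θ : ℝ)) • F (θ : ℝ) := by
      rw [map_smul, hh]
      simp [hg]
    have hle := BddStrip.norm_le_of_val_eq φ hG hval
    rw [norm_smul, norm_inv, inv_mul_le_iff₀ (hmpos _ hθ), mul_one] at hle
    refine hle.trans (mθ.trans ?_)
    have i0 : Integrable fun t => pois (1 - θ) t * ‖u t‖ :=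
      integrable_pois_mul q0 q1 hF.cont.norm (K := C) fun t => by simpa using hF.norm_left t
    have i1 : Integrable fun t : ℝ => pois θ t * ‖F (1 + t * Complex.I)‖ :=
      integrable_pois_mul h0 h1 hF.continuous_right.norm (K := C) fun t => by
        simpa using hF.norm_right t
    rw [hN, mul_add, ← integral_const_mul, ← integral_const_mul]
    refine add_le_add (add_le_add ?_ ?_) le_rfl
    · refine integral_mono_of_nonneg (.of_forall fun t => ?_) (i0.const_mul _)
        (.of_forall fun t => ?_)
      · exact mul_nonneg (pois_pos q0 q1 t).le (by positivity)
      · have := mul_le_mul_of_nonneg_right (hgb' _ (ofReal_mul_I_mem_closedStrip t))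
          (mul_nonneg (pois_pos q0 q1 t).le (norm_nonneg (u t)))
        simp only
        linarith
    · refine integral_mono_of_nonneg (.of_forall fun t => ?_) (i1.const_mul _)
        (.of_forall fun t => ?_)
      · exact mul_nonneg (pois_pos h0 h1 t).le (by positivity)
      · have := mul_le_mul_of_nonneg_right (hgb' _ (one_add_mul_I_mem_closedStrip t))
          (mul_nonneg (pois_pos h0 h1 t).le (norm_nonneg (F (1 + t * Complex.I))))
        simp only
        linarith
  have hlim : Tendsto (fun δ : ℝ => Real.exp δ * N + δ) (𝓝[>] 0) (𝓝 (Real.exp 0 * N + 0)) :=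
    (by fun_prop : Continuous fun δ : ℝ => Real.exp δ * N + δ).continuousAt.tendsto.mono_left
      nhdsWithin_le_nhds
  rw [Real.exp_zero, one_mul, add_zero] at hlim
  refine ge_of_tendsto hlim ?_
  filter_upwards [self_mem_nhdsWithin] with δ hδ using key δ hδ

end NormalFaithfulState

/-! ### Entire families of rapidly decaying functions and Gaussian smoothing -/

section RapidDecay

/-- Continuous functions that decay faster than every exponential. -/
structure RapidDecay (W : ℝ → ℂ) : Prop where
  cont : Continuous W
  bdd : ∀ r : ℝ, ∃ K, ∀ t, Real.exp (r * |t|) * ‖W t‖ ≤ K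

variable {W : ℝ → ℂ}

theorem RapidDecay.of_le (hc : Continuous W) {b : ℝ} (hb : 0 < b) {A m : ℝ}
    (h : ∀ t, ‖W t‖ ≤ A * (Real.exp (m * |t|) * Real.exp (-(b * t ^ 2)))) : RapidDecay W := by
  refine ⟨hc, fun r => ⟨|A| * Real.exp ((r + m) ^ 2 / (4 * b)), fun t => ?_⟩⟩
  have h1 : Real.exp (r * |t|) * (Real.exp (m * |t|) * Real.exp (-(b * t ^ 2))) ≤
      Real.exp ((r + m) ^ 2 / (4 * b)) := by
    rw [← Real.exp_add, ← Real.exp_add, Real.exp_le_exp, le_div_iff₀ (by positivity)]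
    rw [← sq_abs t]
    linarith [sq_nonneg (2 * b * |t| - (r + m))]
  calc Real.exp (r * |t|) * ‖W t‖
      ≤ Real.exp (r * |t|) * (A * (Real.exp (m * |t|) * Real.exp (-(b * t ^ 2)))) :=
        mul_le_mul_of_nonneg_left (h t) (Real.exp_pos _).le
    _ = A * (Real.exp (r * |t|) * (Real.exp (m * |t|) * Real.exp (-(b * t ^ 2)))) := by ring
    _ ≤ |A| * (Real.exp (r * |t|) * (Real.exp (m * |t|) * Real.exp (-(b * t ^ 2)))) :=
        mul_le_mul_of_nonneg_right (le_abs_self A) (by positivity)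
    _ ≤ _ := mul_le_mul_of_nonneg_left h1 (abs_nonneg A)

theorem norm_exp_mul_ofReal_le (z : ℂ) (t : ℝ) : ‖Complex.exp (z * t)‖ ≤ Real.exp (‖z‖ * |t|) := by
  refine (Complex.norm_exp_le_exp_norm _).trans (le_of_eq ?_)
  rw [norm_mul, Complex.norm_real, Real.norm_eq_abs]

theorem RapidDecay.mul_id (hW : RapidDecay W) : RapidDecay fun t => t * W t := by
  refine ⟨by have := hW.cont; fun_prop, fun r => ?_⟩
  obtain ⟨K, hK⟩ := hW.bdd (r + 1)
  refine ⟨K, fun t => le_trans ?_ (hK t)⟩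
  rw [norm_mul, Complex.norm_real, Real.norm_eq_abs, ← mul_assoc]
  refine mul_le_mul_of_nonneg_right ?_ (norm_nonneg _)
  rw [add_mul, one_mul, Real.exp_add]
  exact mul_le_mul_of_nonneg_left (by linarith [Real.add_one_le_exp |t|]) (Real.exp_pos _).le

/-- The bounded function `t ↦ exp (z t) W t`. -/
def expBCF (hW : RapidDecay W) (z : ℂ) : ℝ →ᵇ ℂ :=
  BoundedContinuousFunction.ofNormedAddCommGroup (fun t : ℝ => Complex.exp (z * t) * W t)
    (by have := hW.cont; fun_prop) (Classical.choose (hW.bdd ‖z‖)) fun t => by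
      refine le_trans ?_ (Classical.choose_spec (hW.bdd ‖z‖) t)
      rw [norm_mul]
      exact mul_le_mul_of_nonneg_right (norm_exp_mul_ofReal_le z t) (norm_nonneg _)

theorem expBCF_apply (hW : RapidDecay W) (z : ℂ) (t : ℝ) :
    expBCF hW z t = Complex.exp (z * t) * W t := rfl

/-- Differentiability is in the supremum norm, so any bounded linear map applied to this family
yields an entire function. The derivative is the same family with weight t·W(t). -/
theorem differentiable_expBCF (hW : RapidDecay W) : Differentiable ℂ (expBCF hW) := by
  intro z
  refine HasDerivAt.differentiableAt (f' := expBCF hW.mul_id z) ?_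
  rw [hasDerivAt_iff_isLittleO_nhds_zero]
  -- The additional 2 in the exponent absorbs the factor t² and the factor e^{|ht|} ≤ e^{|t|} of the
  -- Taylor remainder.
  obtain ⟨K, hK⟩ := hW.bdd (‖z‖ + 2)
  have hK0 : 0 ≤ K := le_trans (by positivity) (hK 0)
  refine (Asymptotics.IsBigO.of_bound (2 * K) ?_).trans_isLittleO
    (Asymptotics.isLittleO_pow_id (𝕜 := ℂ) one_lt_two)
  filter_upwards [Metric.ball_mem_nhds (0 : ℂ) one_pos] with h hh
  rw [mem_ball_zero_iff] at hh
  refine (BoundedContinuousFunction.norm_le (by positivity)).mpr fun t => ?_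
  have heq : (expBCF hW (z + h) - expBCF hW z - h • expBCF hW.mul_id z) t =
      Complex.exp (z * t) * (Complex.exp (h * t) -
        ∑ m ∈ Finset.range 2, (h * t) ^ m / m.factorial) * W t := by
    simp only [BoundedContinuousFunction.coe_sub, BoundedContinuousFunction.coe_smul,
      Pi.sub_apply, expBCF_apply, add_mul, Complex.exp_add, smul_eq_mul]
    simp [Finset.sum_range_succ]
    ring
  rw [heq, norm_mul, norm_mul]
  have h1 := Complex.norm_exp_sub_sum_le_norm_mul_exp (h * t) 2
  have h2 : ‖h * t‖ ^ 2 * Real.exp ‖h * t‖ ≤ 2 * ‖h‖ ^ 2 * Real.exp (2 * |t|) := by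
    rw [norm_mul, Complex.norm_real, Real.norm_eq_abs, mul_pow]
    have h3 : |t| ^ 2 ≤ 2 * Real.exp |t| := by
      have := Real.quadratic_le_exp_of_nonneg (abs_nonneg t)
      nlinarith [abs_nonneg t]
    have h4 : Real.exp (‖h‖ * |t|) ≤ Real.exp |t| :=
      Real.exp_le_exp.mpr (mul_le_of_le_one_left (abs_nonneg t) hh.le)
    calc ‖h‖ ^ 2 * |t| ^ 2 * Real.exp (‖h‖ * |t|)
        ≤ ‖h‖ ^ 2 * (2 * Real.exp |t|) * Real.exp |t| := by gcongr
      _ = 2 * ‖h‖ ^ 2 * Real.exp (2 * |t|) := by rw [two_mul |t|, Real.exp_add]; ring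
  calc ‖Complex.exp (z * t)‖ * ‖Complex.exp (h * t) -
        ∑ m ∈ Finset.range 2, (h * t) ^ m / m.factorial‖ * ‖W t‖
      ≤ Real.exp (‖z‖ * |t|) * (2 * ‖h‖ ^ 2 * Real.exp (2 * |t|)) * ‖W t‖ := by
        gcongr
        · exact norm_exp_mul_ofReal_le z t
        · exact h1.trans h2
    _ = 2 * ‖h‖ ^ 2 * (Real.exp ((‖z‖ + 2) * |t|) * ‖W t‖) := by
        rw [add_mul, Real.exp_add]; ring
    _ ≤ 2 * ‖h‖ ^ 2 * K := mul_le_mul_of_nonneg_left (hK t) (by positivity)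
    _ = 2 * K * ‖h ^ 2‖ := by rw [norm_pow]; ring

end RapidDecay

section Gauss

/-- The Gaussian probability density with exponent `-b t ^ 2`. -/
def gauss (b t : ℝ) : ℝ := √(b / Real.pi) * Real.exp (-(b * t ^ 2))

/-- The entire extension of the Gaussian density, rotated so that the kernel
`cgauss b (z - w)` is `gauss b (s - t)` for `z - w = (s - t) i`. -/
def cgauss (b : ℝ) (z : ℂ) : ℂ := (√(b / Real.pi) : ℝ) * Complex.exp (b * z ^ 2)

variable {b : ℝ}

theorem gauss_nonneg (b t : ℝ) : 0 ≤ gauss b t := by unfold gauss; positivity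

theorem gauss_neg (b t : ℝ) : gauss b (-t) = gauss b t := by simp [gauss]

theorem integrable_gauss (hb : 0 < b) : Integrable (gauss b) := by
  unfold gauss
  simpa [neg_mul] using (integrable_exp_neg_mul_sq hb).const_mul (√(b / Real.pi))

theorem integral_gauss_eq (hb : 0 < b) : ∫ t, gauss b t = 1 := by
  unfold gauss
  have := integral_gaussian b
  simp only [neg_mul] at this
  rw [integral_const_mul, this, ← Real.sqrt_mul (by positivity)]
  rw [div_mul_div_comm, mul_comm b, div_self (by positivity), Real.sqrt_one]

theorem differentiable_cgauss (b : ℝ) : Differentiable ℂ (cgauss b) := by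
  unfold cgauss; fun_prop

theorem norm_cgauss (b : ℝ) (z : ℂ) : ‖cgauss b z‖ = Real.exp (b * z.re ^ 2) * gauss b z.im := by
  unfold cgauss gauss
  have h : ((b : ℂ) * z ^ 2).re = b * z.re ^ 2 + -(b * z.im ^ 2) := by
    simp [sq, Complex.mul_re]; ring
  rw [norm_mul, Complex.norm_exp, h, Real.exp_add, Complex.norm_real, Real.norm_eq_abs,
    abs_of_nonneg (Real.sqrt_nonneg _)]
  ring

theorem cgauss_mul_I (b t : ℝ) : cgauss b (t * Complex.I) = gauss b t := by
  unfold cgauss gauss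
  rw [mul_pow, Complex.I_sq]
  push_cast
  ring_nf

/-- Half of the exponent pays for the factor t². The constant is (3/2)·(2/b), where 3/2 ≥ √2
accounts for the change of normalization. -/
theorem gauss_mul_sq_le (hb : 0 < b) (t : ℝ) : gauss b t * t ^ 2 ≤ 3 / b * gauss (b / 2) t := by
  unfold gauss
  have h1 : b / 2 * t ^ 2 ≤ Real.exp (b / 2 * t ^ 2) := by
    linarith [Real.add_one_le_exp (b / 2 * t ^ 2)]
  have h2 : Real.exp (-(b * t ^ 2)) = Real.exp (-(b / 2 * t ^ 2)) *
      (Real.exp (b / 2 * t ^ 2))⁻¹ := by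
    rw [← Real.exp_neg, ← Real.exp_add]; ring_nf
  have h3 : √(b / Real.pi) ≤ 3 / 2 * √(b / 2 / Real.pi) := by
    have : b / Real.pi = 2 * (b / 2 / Real.pi) := by ring
    rw [this, Real.sqrt_mul zero_le_two]
    gcongr
    rw [Real.sqrt_le_left (by norm_num)]
    norm_num
  have h4 : t ^ 2 * (Real.exp (b / 2 * t ^ 2))⁻¹ ≤ 2 / b := by
    rw [mul_inv_le_iff₀ (Real.exp_pos _), div_mul_eq_mul_div, le_div_iff₀ hb]
    linarith
  calc √(b / Real.pi) * Real.exp (-(b * t ^ 2)) * t ^ 2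
      = √(b / Real.pi) * Real.exp (-(b / 2 * t ^ 2)) *
          (t ^ 2 * (Real.exp (b / 2 * t ^ 2))⁻¹) := by rw [h2]; ring
    _ ≤ (3 / 2 * √(b / 2 / Real.pi)) * Real.exp (-(b / 2 * t ^ 2)) * (2 / b) := by gcongr
    _ = _ := by ring

variable {E : Type*} [NormedAddCommGroup E] [NormedSpace ℝ E]

theorem integrable_gauss_smul (hb : 0 < b) {v : ℝ → E} (hv : Continuous v) {C : ℝ}
    (hC : ∀ t, ‖v t‖ ≤ C) (s : ℝ) : Integrable fun t => gauss b (s - t) • v t :=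
  ((integrable_gauss hb).comp_sub_left s).smul_bdd C hv.aestronglyMeasurable (.of_forall hC)

theorem norm_integral_gauss_le (hb : 0 < b) {v : ℝ → E} {C : ℝ}
    (hC : ∀ t, ‖v t‖ ≤ C) (s : ℝ) : ‖∫ t, gauss b (s - t) • v t‖ ≤ C := by
  have h1 : ∫ t, gauss b (s - t) * C = C := by
    rw [integral_mul_const, integral_sub_left_eq_self (gauss b), integral_gauss_eq hb, one_mul]
  conv_rhs => rw [← h1]
  refine norm_integral_le_of_norm_le (((integrable_gauss hb).comp_sub_left s).mul_const C)
    (.of_forall fun t => ?_)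
  rw [norm_smul, Real.norm_of_nonneg (gauss_nonneg _ _)]
  exact mul_le_mul_of_nonneg_left (hC t) (gauss_nonneg _ _)

variable [CompleteSpace E]

/-- With a modulus of the form ε + K(s - t)² the approximation error is read off from the second
moment of the Gaussian, and no splitting of the integral is needed. -/
theorem norm_integral_gauss_sub_le (hb : 0 < b) {v : ℝ → E} (hv : Continuous v) {C : ℝ}
    (hC : ∀ t, ‖v t‖ ≤ C) {s ε K : ℝ} (hK : ∀ t, ‖v t - v s‖ ≤ ε + K * (s - t) ^ 2)
    (hK0 : 0 ≤ K) : ‖(∫ t, gauss b (s - t) • v t) - v s‖ ≤ ε + K * (3 / b) := by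
  have i1 := integrable_gauss_smul hb hv hC s
  have i2 : Integrable fun t => gauss b (s - t) • v s :=
    ((integrable_gauss hb).comp_sub_left s).smul_const _
  have h1 : v s = ∫ t, gauss b (s - t) • v s := by
    rw [integral_smul_const, integral_sub_left_eq_self (gauss b), integral_gauss_eq hb, one_smul]
  have hb2 : 0 < b / 2 := by positivity
  have i3 : Integrable fun t => gauss b (s - t) * ε + K * (3 / b) * gauss (b / 2) (s - t) :=
    (((integrable_gauss hb).comp_sub_left s).mul_const ε).add
      (((integrable_gauss hb2).comp_sub_left s).const_mul _)
  have h2 : ∫ t, (gauss b (s - t) * ε + K * (3 / b) * gauss (b / 2) (s - t)) =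
      ε + K * (3 / b) := by
    rw [integral_add (((integrable_gauss hb).comp_sub_left s).mul_const ε)
      (((integrable_gauss hb2).comp_sub_left s).const_mul _), integral_mul_const,
      integral_const_mul, integral_sub_left_eq_self (gauss b),
      integral_sub_left_eq_self (gauss (b / 2)), integral_gauss_eq hb, integral_gauss_eq hb2]
    ring
  conv_lhs => rw [h1]
  rw [← integral_sub i1 i2, ← h2]
  refine norm_integral_le_of_norm_le i3 (.of_forall fun t => ?_)
  rw [← smul_sub, norm_smul, Real.norm_of_nonneg (gauss_nonneg _ _)]
  have h3 := mul_le_mul_of_nonneg_left (hK t) (gauss_nonneg b (s - t))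
  have h4 := mul_le_mul_of_nonneg_left (gauss_mul_sq_le hb (s - t)) hK0
  nlinarith

/-- Within distance δ, uniform continuity gives ε. Beyond it, the trivial bound 2C is at most
(2C/δ²)(s - t)². -/
theorem exists_quadratic_modulus {v : ℝ → E} (hv : UniformContinuous v) {C : ℝ}
    (hC : ∀ t, ‖v t‖ ≤ C) {ε : ℝ} (hε : 0 < ε) :
    ∃ K, 0 ≤ K ∧ ∀ s t, ‖v t - v s‖ ≤ ε + K * (s - t) ^ 2 := by
  obtain ⟨δ, hδ, h⟩ := Metric.uniformContinuous_iff.mp hv ε hε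
  have hC0 : 0 ≤ C := (norm_nonneg _).trans (hC 0)
  refine ⟨2 * C / δ ^ 2, by positivity, fun s t => ?_⟩
  by_cases hst : dist t s < δ
  · have := h hst
    rw [dist_eq_norm] at this
    have : 0 ≤ 2 * C / δ ^ 2 * (s - t) ^ 2 := by positivity
    linarith
  · rw [not_lt, Real.dist_eq] at hst
    have h1 : δ ^ 2 ≤ (s - t) ^ 2 := by
      rw [← sq_abs (s - t), abs_sub_comm]
      gcongr
    have h2 : 2 * C ≤ 2 * C / δ ^ 2 * (s - t) ^ 2 := by
      rw [div_mul_eq_mul_div, le_div_iff₀ (by positivity)]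
      exact mul_le_mul_of_nonneg_left h1 (by positivity)
    exact (norm_sub_le _ _).trans (by linarith [hC t, hC s])

end Gauss

section Smoothing

variable {E : Type*} [NormedAddCommGroup E] [NormedSpace ℂ E] [CompleteSpace E] {b : ℝ}

/-- The entire function obtained from a function on the line `Re z = 0` by convolution with a
Gaussian. -/
def smoothing (b : ℝ) (v : ℝ → E) (z : ℂ) : E := ∫ t : ℝ, cgauss b (z - t * Complex.I) • v t

theorem smoothing_mul_I (b : ℝ) (v : ℝ → E) (s : ℝ) :
    smoothing b v (s * Complex.I) = ∫ t, gauss b (s - t) • v t := by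
  unfold smoothing
  refine integral_congr_ae (.of_forall fun t => ?_)
  simp only
  rw [← sub_mul, ← Complex.ofReal_sub, cgauss_mul_I]
  rfl

theorem norm_smoothing_le (hb : 0 < b) {v : ℝ → E} {C : ℝ} (hC : ∀ t, ‖v t‖ ≤ C) (z : ℂ) :
    ‖smoothing b v z‖ ≤ Real.exp (b * z.re ^ 2) * C := by
  have h1 : ∫ t, Real.exp (b * z.re ^ 2) * (gauss b (z.im - t) * C) =
      Real.exp (b * z.re ^ 2) * C := by
    rw [integral_const_mul, integral_mul_const, integral_sub_left_eq_self (gauss b),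
      integral_gauss_eq hb, one_mul]
  rw [← h1]
  refine norm_integral_le_of_norm_le
    ((((integrable_gauss hb).comp_sub_left _).mul_const C).const_mul _) (.of_forall fun t => ?_)
  rw [norm_smul, norm_cgauss]
  have hre : (z - t * Complex.I).re = z.re := by simp
  have him : (z - t * Complex.I).im = z.im - t := by simp
  rw [hre, him, mul_assoc]
  exact mul_le_mul_of_nonneg_left (mul_le_mul_of_nonneg_left (hC t) (gauss_nonneg _ _))
    (Real.exp_pos _).le

theorem rapidDecay_gauss_weight (hb : 0 < b) :
    RapidDecay fun t : ℝ => ((1 + t ^ 2 : ℝ) : ℂ) * Real.exp (-(b * t ^ 2)) := by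
  refine RapidDecay.of_le (by fun_prop) hb (A := 2) (m := 1) fun t => ?_
  rw [norm_mul, Complex.norm_real, Complex.norm_real, Real.norm_of_nonneg (by positivity),
    Real.norm_of_nonneg (by positivity), one_mul, ← mul_assoc]
  refine mul_le_mul_of_nonneg_right ?_ (Real.exp_pos _).le
  have := Real.quadratic_le_exp_of_nonneg (abs_nonneg t)
  rw [sq_abs] at this
  nlinarith [abs_nonneg t]

/-- Expanding (z - ti)² separates the kernel into a scalar entire factor and `expBCF`. Integration
against v with density 1/(1 + t²) is a bounded operator on bounded functions; the weight 1 + t²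
compensates for this density. -/
theorem differentiable_smoothing (hb : 0 < b) {v : ℝ → E} (hv : Continuous v) {C : ℝ}
    (hC : ∀ t, ‖v t‖ ≤ C) : Differentiable ℂ (smoothing b v) := by
  have hC0 : 0 ≤ C := (norm_nonneg _).trans (hC 0)
  have hInt : ∀ w : ℝ →ᵇ ℂ, Integrable fun t : ℝ => ((1 + t ^ 2)⁻¹ : ℝ) • (w t • v t) :=
    fun w => integrable_inv_one_add_sq.smul_bdd (‖w‖ * C)
      (w.continuous.smul hv).aestronglyMeasurable (.of_forall fun t => by
        rw [norm_smul]
        exact mul_le_mul (w.norm_coe_le_norm t) (hC t) (norm_nonneg _) (norm_nonneg _))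
  let L : (ℝ →ᵇ ℂ) →L[ℂ] E := LinearMap.mkContinuous
    { toFun := fun w => ∫ t : ℝ, ((1 + t ^ 2)⁻¹ : ℝ) • (w t • v t)
      map_add' := fun w w' => by
        rw [← integral_add (hInt w) (hInt w')]
        simp [add_smul, smul_add]
      map_smul' := fun a w => by
        rw [RingHom.id_apply, ← integral_smul]
        refine integral_congr_ae (.of_forall fun t => ?_)
        simp only [BoundedContinuousFunction.coe_smul, smul_eq_mul]
        rw [mul_smul, smul_comm] }
    (Real.pi * C) fun w => by
      have h1 : ∫ t : ℝ, (1 + t ^ 2)⁻¹ * (‖w‖ * C) = Real.pi * C * ‖w‖ := by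
        rw [integral_mul_const, integral_univ_inv_one_add_sq]; ring
      rw [← h1]
      refine norm_integral_le_of_norm_le (integrable_inv_one_add_sq.mul_const _)
        (.of_forall fun t => ?_)
      rw [norm_smul, norm_smul, Real.norm_of_nonneg (by positivity)]
      have h2 : ‖w t‖ * ‖v t‖ ≤ ‖w‖ * C :=
        mul_le_mul (w.norm_coe_le_norm t) (hC t) (norm_nonneg _) (norm_nonneg _)
      exact mul_le_mul_of_nonneg_left h2 (by positivity)
  have heq : smoothing b v = fun z => ((√(b / Real.pi) : ℝ) * Complex.exp (b * z ^ 2)) •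
      L (expBCF (rapidDecay_gauss_weight hb) (-(2 * b * Complex.I * z))) := by
    funext z
    show ∫ t : ℝ, cgauss b (z - t * Complex.I) • v t = _ • ∫ t : ℝ, _
    rw [← integral_smul]
    refine integral_congr_ae (.of_forall fun t => ?_)
    simp only
    rw [expBCF_apply, ← Complex.coe_smul, smul_smul, smul_smul]
    congr 1
    unfold cgauss
    have h1 : (b : ℂ) * (z - t * Complex.I) ^ 2 =
        b * z ^ 2 + -(2 * b * Complex.I * z) * t + -(b * t ^ 2) := by
      linear_combination (b : ℂ) * t ^ 2 * Complex.I_sq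
    have h2 : ((1 + t ^ 2 : ℝ) : ℂ) ≠ 0 := by
      exact_mod_cast (by positivity : (1 + t ^ 2 : ℝ) ≠ 0)
    rw [h1, Complex.exp_add, Complex.exp_add]
    push_cast at h2 ⊢
    field_simp
  rw [heq]
  refine Differentiable.smul (by fun_prop) (L.differentiable.comp
    ((differentiable_expBCF _).comp (by fun_prop)))

end Smoothing

section Smoothing

variable {E : Type*} [NormedAddCommGroup E] [NormedSpace ℂ E] {b : ℝ}

theorem tendsto_gauss_atTop (hb : 0 < b) (s : ℝ) :
    Tendsto (fun T => gauss b (T - s)) atTop (𝓝 0) := by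
  have h := ((tendsto_exp_neg_mul_sq_cocompact hb).mono_left atTop_le_cocompact).comp
    (tendsto_atTop_add_const_right atTop (-s) tendsto_id)
  simpa [gauss, sub_eq_add_neg, Function.comp_def] using h.const_mul (√(b / Real.pi))

theorem gauss_le_gauss (hb : 0 ≤ b) {s t : ℝ} (h : s ^ 2 ≤ t ^ 2) : gauss b t ≤ gauss b s := by
  unfold gauss
  gcongr

theorem integrable_cgauss_smul (hb : 0 < b) {v : ℝ → E} (hv : Continuous v) {C : ℝ}
    (hC : ∀ t, ‖v t‖ ≤ C) (z : ℂ) :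
    Integrable fun t : ℝ => cgauss b (z - t * Complex.I) • v t := by
  have hc := (differentiable_cgauss b).continuous
  refine ((((integrable_gauss hb).comp_sub_left z.im).mul_const C).const_mul
    (Real.exp (b * z.re ^ 2))).mono' (Continuous.aestronglyMeasurable (by fun_prop))
    (.of_forall fun t => ?_)
  rw [norm_smul, norm_cgauss]
  have hre : (z - t * Complex.I).re = z.re := by simp
  have him : (z - t * Complex.I).im = z.im - t := by simp
  rw [hre, him, mul_assoc]
  exact mul_le_mul_of_nonneg_left (mul_le_mul_of_nonneg_left (hC t) (gauss_nonneg _ _))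
    (Real.exp_pos _).le

variable [CompleteSpace E]

/-- The smoothing of the boundary values of an analytic function on `Re z = 0` agrees on
`Re z = 1` with the smoothing of the boundary values on that line. -/
theorem smoothing_one_add_mul_I (hb : 0 < b) {F : ℂ → E} (hF : DiffContOnCl ℂ F strip) {C : ℝ}
    (hC : ∀ z ∈ closedStrip, ‖F z‖ ≤ C) (s : ℝ) :
    smoothing b (fun t => F (t * Complex.I)) (1 + s * Complex.I) =
      ∫ t, gauss b (s - t) • F (1 + t * Complex.I) := by
  have hC0 : 0 ≤ C := (norm_nonneg _).trans (hC 0 (by simp [mem_closedStrip]))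
  have hFc : ContinuousOn F closedStrip := closure_strip ▸ hF.continuousOn
  have hc0 : Continuous fun t : ℝ => F (t * Complex.I) :=
    hFc.comp_continuous (by fun_prop) ofReal_mul_I_mem_closedStrip
  have hc1 : Continuous fun t : ℝ => F (1 + t * Complex.I) :=
    hFc.comp_continuous (by fun_prop) one_add_mul_I_mem_closedStrip
  -- The kernel is analytic in the variable of integration as well, so the contour moves from Re w =
  -- 0 to Re w = 1, where the kernel becomes the real Gaussian.
  set f : ℂ → E := fun w => cgauss b (1 + s * Complex.I - w) • F w with hf
  have hfd : DiffContOnCl ℂ f strip :=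
    (Differentiable.diffContOnCl ((differentiable_cgauss b).comp (by fun_prop))).smul hF
  have hf1 : ∀ t : ℝ, f (1 + t * Complex.I) = gauss b (s - t) • F (1 + t * Complex.I) := by
    intro t
    simp only [hf]
    rw [add_sub_add_left_eq_sub, ← sub_mul, ← Complex.ofReal_sub, cgauss_mul_I]
    rfl
  have h := integral_left_eq_integral_right hfd
    (integrable_cgauss_smul hb hc0 (fun t => hC _ (ofReal_mul_I_mem_closedStrip t)) _)
    ((integrable_gauss_smul hb hc1 (fun t => hC _ (one_add_mul_I_mem_closedStrip t)) s).congr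
      (.of_forall fun t => (hf1 t).symm))
    (g := fun T => Real.exp b * gauss b (T - |s|) * C) (T₀ := 0)
    (by simpa using ((tendsto_gauss_atTop hb |s|).const_mul (Real.exp b)).mul_const C) ?_
  · simp_rw [hf1] at h
    exact h
  · intro w hw _
    simp only [hf]
    rw [norm_smul, norm_cgauss]
    have hre : (1 + s * Complex.I - w).re = 1 - w.re := by simp
    have him : (1 + s * Complex.I - w).im = s - w.im := by simp
    rw [hre, him]
    have h1 : Real.exp (b * (1 - w.re) ^ 2) ≤ Real.exp b := by
      refine Real.exp_le_exp.mpr (mul_le_of_le_one_right hb.le ?_)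
      nlinarith [hw.1, hw.2]
    have h2 : gauss b (s - w.im) ≤ gauss b (|w.im| - |s|) := by
      refine gauss_le_gauss hb.le (sq_le_sq.mpr ?_)
      rw [abs_sub_comm s]
      exact abs_abs_sub_abs_le_abs_sub _ _
    exact mul_le_mul (mul_le_mul h1 h2 (gauss_nonneg _ _) (Real.exp_pos _).le) (hC w hw)
      (norm_nonneg _) (mul_nonneg (Real.exp_pos _).le (gauss_nonneg _ _))

end Smoothing

theorem uniformContinuous_of_tendsto_cocompact {E : Type*} [NormedAddCommGroup E] {v : ℝ → E}
    (hv : Continuous v) (h : Tendsto v (cocompact ℝ) (𝓝 0)) : UniformContinuous v :=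
  ZeroAtInftyContinuousMap.uniformContinuous (⟨⟨v, hv⟩, h⟩ : C₀(ℝ, E))

theorem one_sub_mem_closedStrip {z : ℂ} (hz : z ∈ closedStrip) : 1 - z ∈ closedStrip := by
  rw [mem_closedStrip] at hz ⊢
  simp only [Complex.sub_re, Complex.one_re]
  constructor <;> linarith [hz.1, hz.2]

theorem diffContOnCl_comp_one_sub {E : Type*} [NormedAddCommGroup E] [NormedSpace ℂ E]
    {g : ℂ → E} (hg : DiffContOnCl ℂ g strip) : DiffContOnCl ℂ (fun z => g (1 - z)) strip := by
  refine hg.comp (g := fun z => 1 - z) (Differentiable.diffContOnCl (by fun_prop)) fun z hz => ?_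
  rw [mem_strip] at hz ⊢
  simp only [Complex.sub_re, Complex.one_re]
  constructor <;> linarith [hz.1, hz.2]

/-! ### Density of the algebra and the duality pairing -/

namespace NormalFaithfulState

variable {M P : Type*} [JBStarAlgebra M] [NormedAddCommGroup P] [NormedSpace ℂ P]
  [CompleteSpace P] {e : M ≃ₗᵢ[ℂ] StrongDual ℂ P} (φ : NormalFaithfulState e)

/-- A bounded continuous function on the closed strip, holomorphic inside, with values in `M`,
that is bounded by `C` in `M` on `Re z = 0` and in the predual on `Re z = 1`. -/
structure NiceStrip (g : ℂ → M) (C : ℝ) : Prop where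
  diff : DiffContOnCl ℂ g strip
  bdd : ∃ K, ∀ z ∈ closedStrip, ‖g z‖ ≤ K
  norm_left : ∀ t : ℝ, ‖g (t * Complex.I)‖ ≤ C
  norm_right : ∀ t : ℝ, ‖φ.toPredual (g (1 + t * Complex.I))‖ ≤ C

variable {φ} in
theorem NiceStrip.continuousOn {g : ℂ → M} {C : ℝ} (hg : φ.NiceStrip g C) :
    ContinuousOn g closedStrip := closure_strip ▸ hg.diff.continuousOn

variable {φ} in
theorem NiceStrip.bddStrip {g : ℂ → M} {C : ℝ} (hg : φ.NiceStrip g C) :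
    φ.BddStrip (fun z => φ.toPredual (g z)) (fun t => g (t * Complex.I)) C where
  diff := φ.toPredual.differentiable.comp_diffContOnCl hg.diff
  bdd := by
    obtain ⟨K, hK⟩ := hg.bdd
    exact ⟨K, fun z hz => (φ.norm_toPredual_le _).trans (hK z hz)⟩
  cont := hg.continuousOn.comp_continuous (by fun_prop) ofReal_mul_I_mem_closedStrip
  left _ := rfl
  norm_left := hg.norm_left
  norm_right := hg.norm_right

/-- Approximation of strip functions by functions with values in `M`. -/
theorem BddStrip.exists_niceStrip {F : ℂ → P} {u : ℝ → M} {C : ℝ} (hF : φ.BddStrip F u C)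
    (hu : Tendsto u (cocompact ℝ) (𝓝 0))
    (hr : Tendsto (fun t : ℝ => F (1 + t * Complex.I)) (cocompact ℝ) (𝓝 0)) {ε : ℝ}
    (hε : 0 < ε) :
    ∃ g : ℂ → M, φ.NiceStrip g C ∧
      φ.BddStrip (fun z => F z - φ.toPredual (g z)) (fun t => u t - g (t * Complex.I)) ε := by
  obtain ⟨K0, k0, hK0⟩ := exists_quadratic_modulus
    (uniformContinuous_of_tendsto_cocompact hF.cont hu) hF.norm_left (half_pos hε)
  obtain ⟨K1, k1, hK1⟩ := exists_quadratic_modulus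
    (uniformContinuous_of_tendsto_cocompact hF.continuous_right hr) hF.norm_right (half_pos hε)
  -- Chosen so that 3K/b ≤ ε/2 for both quadratic moduli K₀ and K₁.
  set b : ℝ := 6 * (K0 + K1 + 1) / ε with hb
  have hbpos : 0 < b := by positivity
  have hb0 : ∀ K, 0 ≤ K → K ≤ K0 + K1 → ε / 2 + K * (3 / b) ≤ ε := by
    intro K h0 hK
    have : K * (3 / b) = K / (K0 + K1 + 1) * (ε / 2) := by
      rw [hb]; field_simp; ring
    rw [this]
    have h2 : K / (K0 + K1 + 1) ≤ 1 := div_le_one_of_le₀ (by linarith) (by linarith)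
    nlinarith
  have hCnn := hF.nonneg
  -- The smoothing uses only the M-valued data on Re z = 0, so it stays in M. By the contour shift
  -- its values on Re z = 1 are Gaussian averages of F on that line, hence bounded by C in the
  -- predual.
  have hright : ∀ s : ℝ, φ.toPredual (smoothing b u (1 + s * Complex.I)) =
      ∫ t, gauss b (s - t) • F (1 + t * Complex.I) := by
    intro s
    rw [← smoothing_one_add_mul_I hbpos hF.diff (fun z hz => hF.norm_le hz)]
    unfold smoothing
    rw [← ContinuousLinearMap.integral_comp_comm _
      (integrable_cgauss_smul hbpos hF.cont hF.norm_left _)]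
    simp_rw [map_smul, hF.left]
  have hg : φ.NiceStrip (smoothing b u) C :=
    { diff := (differentiable_smoothing hbpos hF.cont hF.norm_left).diffContOnCl
      bdd := ⟨Real.exp b * C, fun z hz => (norm_smoothing_le hbpos hF.norm_left z).trans (by
        refine mul_le_mul_of_nonneg_right (Real.exp_le_exp.mpr
          (mul_le_of_le_one_right hbpos.le ?_)) hCnn
        nlinarith [hz.1, hz.2])⟩
      norm_left := fun t => by
        rw [smoothing_mul_I]; exact norm_integral_gauss_le hbpos hF.norm_left t
      norm_right := fun t => by
        rw [hright]; exact norm_integral_gauss_le hbpos hF.norm_right t }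
  refine ⟨smoothing b u, hg, ⟨hF.diff.sub hg.bddStrip.diff, ⟨C + C, fun z hz => ?_⟩,
    hF.cont.sub hg.bddStrip.cont, fun t => ?_, fun t => ?_, fun t => ?_⟩⟩
  · exact (norm_sub_le _ _).trans (add_le_add (hF.norm_le hz) (hg.bddStrip.norm_le hz))
  · rw [hF.left, map_sub]
  · rw [norm_sub_rev, smoothing_mul_I]
    exact (norm_integral_gauss_sub_le hbpos hF.cont hF.norm_left (hK0 t) k0).trans
      (hb0 K0 k0 (by linarith))
  · rw [norm_sub_rev, hright]
    exact (norm_integral_gauss_sub_le hbpos hF.continuous_right hF.norm_right (hK1 t) k1).trans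
      (hb0 K1 k1 (by linarith))

variable (θ : Set.Icc (0 : ℝ) 1)

theorem bddStrip_const (x : M) :
    φ.BddStrip (fun _ => φ.toPredual x) (fun _ => x) ‖x‖ where
  diff := diffContOnCl_const
  bdd := ⟨‖x‖, fun _ _ => φ.norm_toPredual_le x⟩
  cont := continuous_const
  left _ := rfl
  norm_left _ := le_rfl
  norm_right _ := φ.norm_toPredual_le x

/-- The inclusion of `M` in an interpolation space. -/
def ofAlgebra : M →ₗ[ℂ] φ.couple.Interpolation θ where
  toFun x := Classical.choose (BddStrip.exists_val φ (φ.bddStrip_const x) θ)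
  map_add' x y := φ.val_injective (by
    have h := fun z => (Classical.choose_spec (BddStrip.exists_val φ (φ.bddStrip_const z) θ)).1
    exact (h (x + y)).trans (by
      rw [map_add, map_add]; exact congrArg₂ (· + ·) (h x).symm (h y).symm))
  map_smul' a x := φ.val_injective (by
    have h := fun z => (Classical.choose_spec (BddStrip.exists_val φ (φ.bddStrip_const z) θ)).1
    exact (h (a • x)).trans (by
      rw [RingHom.id_apply, map_smul, map_smul]; exact congrArg (a • ·) (h x).symm))

theorem val_ofAlgebra (x : M) : φ.val (φ.ofAlgebra θ x) = φ.toPredual x :=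
  (Classical.choose_spec (BddStrip.exists_val φ (φ.bddStrip_const x) θ)).1

variable {θ} in
theorem exists_niceStrip (h : φ.couple.Interpolation θ) {C : ℝ} (hC : ‖h‖ < C) {ε : ℝ}
    (hε : 0 < ε) :
    ∃ g : ℂ → M, φ.NiceStrip g C ∧ ‖h - φ.ofAlgebra θ (g (θ : ℝ))‖ ≤ ε := by
  obtain ⟨F, u, hF, hFθ, hu, hr⟩ := φ.exists_bddStrip h hC
  obtain ⟨g, hg, hd⟩ := BddStrip.exists_niceStrip φ hF hu hr hε
  refine ⟨g, hg, BddStrip.norm_le_of_val_eq φ hd ?_⟩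
  rw [map_sub, val_ofAlgebra, hFθ]

theorem denseRange_ofAlgebra : DenseRange (φ.ofAlgebra θ) := by
  intro h
  rw [Metric.mem_closure_iff]
  intro ε hε
  obtain ⟨g, -, hd⟩ := φ.exists_niceStrip h (lt_add_one _) (half_pos hε)
  refine ⟨_, ⟨g (θ : ℝ), rfl⟩, ?_⟩
  rw [dist_eq_norm]
  linarith

theorem apply_toPredual_comm (x y : M) : e y (φ.toPredual x) = e x (φ.toPredual y) := by
  rw [apply_toPredual, apply_toPredual, mul_comm]

/-- The pairing of strip functions is bounded by the product of their norms. -/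
theorem norm_pairing_le {F : ℂ → P} {u : ℝ → M} {C C' : ℝ} (hF : φ.BddStrip F u C) {g : ℂ → M}
    (hg : φ.NiceStrip g C') :
    DiffContOnCl ℂ (fun z => e (g (1 - z)) (F z)) strip ∧
    (∃ K, ∀ z ∈ closedStrip, ‖e (g (1 - z)) (F z)‖ ≤ K) ∧
    (∀ t : ℝ, ‖e (g (1 - t * Complex.I)) (F (t * Complex.I))‖ ≤ C * C') ∧
    ∀ t : ℝ, ‖e (g (1 - (1 + t * Complex.I))) (F (1 + t * Complex.I))‖ ≤ C * C' := by
  have hC := hF.nonneg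
  have hd := diffContOnCl_comp_one_sub hg.diff
  have hle : ∀ (y : M) (ω : P), ‖e y ω‖ ≤ ‖y‖ * ‖ω‖ := fun y ω =>
    ((e y).le_opNorm ω).trans_eq (by rw [LinearIsometryEquiv.norm_map])
  have he : DiffContOnCl ℂ (fun z => e (g (1 - z))) strip :=
    e.toContinuousLinearEquiv.differentiable.comp_diffContOnCl hd
  refine ⟨⟨he.differentiableOn.clm_apply hF.diff.differentiableOn,
    he.continuousOn.clm_apply hF.diff.continuousOn⟩, ?_, fun t => ?_, fun t => ?_⟩
  · obtain ⟨K, hK⟩ := hg.bdd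
    refine ⟨K * C, fun z hz => (hle _ _).trans ?_⟩
    exact mul_le_mul (hK _ (one_sub_mem_closedStrip hz)) (hF.norm_le hz) (norm_nonneg _)
      ((norm_nonneg _).trans (hK _ (one_sub_mem_closedStrip hz)))
  -- On this line F takes values in M, while g(1 - z) is bounded only in the predual. Symmetry of
  -- φ(x ∘ y) exchanges the two roles.
  · rw [hF.left, apply_toPredual_comm]
    refine (hle _ _).trans (mul_le_mul (hF.norm_left t) ?_ (norm_nonneg _) hC)
    have := hg.norm_right (-t)
    rwa [Complex.ofReal_neg, neg_mul, ← sub_eq_add_neg] at this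
  · have h1 : 1 - (1 + t * Complex.I) = ((-t : ℝ) : ℂ) * Complex.I := by push_cast; ring
    rw [h1, mul_comm C]
    refine (hle _ _).trans (mul_le_mul (hg.norm_left _) (hF.norm_right t) (norm_nonneg _) ?_)
    exact (norm_nonneg _).trans (hg.norm_left 0)

variable {θ} {θ' : Set.Icc (0 : ℝ) 1}

/-- The three lines theorem for the pairing, evaluated at θ. Replacing y by the value of a strip
function with values in M costs an error of at most ‖x‖ε, since x is itself in M. -/
theorem norm_apply_toPredual_le (hθ : (θ' : ℝ) = 1 - θ) (x y : M) :
    ‖e y (φ.toPredual x)‖ ≤ ‖φ.ofAlgebra θ x‖ * ‖φ.ofAlgebra θ' y‖ := by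
  have key : ∀ ε : ℝ, 0 < ε → ‖e y (φ.toPredual x)‖ ≤
      (‖φ.ofAlgebra θ x‖ + ε) * (‖φ.ofAlgebra θ' y‖ + ε) + ‖x‖ * ε := by
    intro ε hε
    obtain ⟨g, hg, hd⟩ := φ.exists_niceStrip (φ.ofAlgebra θ' y)
      (lt_add_of_pos_right _ hε) hε
    obtain ⟨F, u, hF, hFθ, -, -⟩ := φ.exists_bddStrip (φ.ofAlgebra θ x)
      (lt_add_of_pos_right _ hε)
    rw [val_ofAlgebra] at hFθ
    obtain ⟨p1, p2, p3, p4⟩ := φ.norm_pairing_le hF hg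
    have h1 := norm_le_of_strip p1 p2 p3 p4 (z := (θ : ℝ))
      ⟨θ.2.1, θ.2.2⟩
    have h2 : (1 : ℂ) - ((θ : ℝ) : ℂ) = ((θ' : ℝ) : ℂ) := by rw [hθ]; push_cast; ring
    rw [h2, hFθ] at h1
    have h3 : ‖e (y - g (θ' : ℝ)) (φ.toPredual x)‖ ≤ ‖x‖ * ε := by
      rw [apply_toPredual_comm]
      refine ((e x).le_opNorm _).trans ?_
      rw [LinearIsometryEquiv.norm_map]
      refine mul_le_mul_of_nonneg_left ?_ (norm_nonneg _)
      rw [← φ.val_ofAlgebra θ', map_sub]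
      exact (φ.norm_val_le _).trans hd
    have h4 : e y (φ.toPredual x) = e (g (θ' : ℝ)) (φ.toPredual x) +
        e (y - g (θ' : ℝ)) (φ.toPredual x) := by
      rw [map_sub, sub_apply]; ring
    rw [h4]
    exact (norm_add_le _ _).trans (add_le_add h1 h3)
  have hlim : Tendsto (fun ε : ℝ => (‖φ.ofAlgebra θ x‖ + ε) * (‖φ.ofAlgebra θ' y‖ + ε) +
      ‖x‖ * ε) (𝓝[>] 0) (𝓝 ((‖φ.ofAlgebra θ x‖ + 0) * (‖φ.ofAlgebra θ' y‖ + 0) + ‖x‖ * 0)) :=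
    (by fun_prop : Continuous fun ε : ℝ => (‖φ.ofAlgebra θ x‖ + ε) *
      (‖φ.ofAlgebra θ' y‖ + ε) + ‖x‖ * ε).continuousAt.tendsto.mono_left nhdsWithin_le_nhds
  rw [add_zero, add_zero, mul_zero, add_zero] at hlim
  refine ge_of_tendsto hlim ?_
  filter_upwards [self_mem_nhdsWithin] with ε hε using key ε hε

theorem continuous_val : Continuous (φ.val (θ := θ)) :=
  AddMonoidHomClass.continuous_of_bound (φ.val (θ := θ)) 1 fun h => by
    simpa using φ.norm_val_le h

theorem norm_apply_val_le (hθ : (θ' : ℝ) = 1 - θ) (h : φ.couple.Interpolation θ) (y : M) :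
    ‖e y (φ.val h)‖ ≤ ‖h‖ * ‖φ.ofAlgebra θ' y‖ := by
  have hc := φ.continuous_val (θ := θ)
  refine (φ.denseRange_ofAlgebra θ).induction_on (p := fun h => ‖e y (φ.val h)‖ ≤
    ‖h‖ * ‖φ.ofAlgebra θ' y‖) h ?_ fun x => ?_
  · exact isClosed_le (by fun_prop) (by fun_prop)
  · rw [val_ofAlgebra]
    exact φ.norm_apply_toPredual_le hθ x y

/-- The functional on an interpolation space given by an element of `M`. -/
def pairing (θ : Set.Icc (0 : ℝ) 1) : M →ₗ[ℂ] StrongDual ℂ (φ.couple.Interpolation θ) where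
  toFun y := (e y).comp ⟨φ.val, φ.continuous_val⟩
  map_add' x y := by ext h; simp
  map_smul' a y := by ext h; simp

theorem pairing_apply (y : M) (h : φ.couple.Interpolation θ) :
    φ.pairing θ y h = e y (φ.val h) := rfl

theorem norm_pairing_apply_le (hθ : (θ' : ℝ) = 1 - θ) (y : M) :
    ‖φ.pairing θ y‖ ≤ ‖φ.ofAlgebra θ' y‖ :=
  ContinuousLinearMap.opNorm_le_bound _ (norm_nonneg _) fun h => by
    rw [pairing_apply, mul_comm]
    exact φ.norm_apply_val_le hθ h y

end NormalFaithfulState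

/-! ### Gaussian approximate identities and kernels relative to the Poisson density -/

section ApproximateIdentity

theorem exists_quadratic_modulus_at {E : Type*} [NormedAddCommGroup E] {v : ℝ → E} {s : ℝ}
    (hv : ContinuousAt v s) {C : ℝ} (hC : ∀ t, ‖v t‖ ≤ C) {ε : ℝ} (hε : 0 < ε) :
    ∃ K, 0 ≤ K ∧ ∀ t, ‖v t - v s‖ ≤ ε + K * (s - t) ^ 2 := by
  obtain ⟨δ, hδ, h⟩ := Metric.continuousAt_iff.mp hv ε hε
  have hC0 : 0 ≤ C := (norm_nonneg _).trans (hC 0)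
  refine ⟨2 * C / δ ^ 2, by positivity, fun t => ?_⟩
  by_cases hst : dist t s < δ
  · have := h hst
    rw [dist_eq_norm] at this
    have : 0 ≤ 2 * C / δ ^ 2 * (s - t) ^ 2 := by positivity
    linarith
  · rw [not_lt, Real.dist_eq] at hst
    have h1 : δ ^ 2 ≤ (s - t) ^ 2 := by
      rw [← sq_abs (s - t), abs_sub_comm]
      gcongr
    have h2 : 2 * C ≤ 2 * C / δ ^ 2 * (s - t) ^ 2 := by
      rw [div_mul_eq_mul_div, le_div_iff₀ (by positivity)]
      exact mul_le_mul_of_nonneg_left h1 (by positivity)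
    exact (norm_sub_le _ _).trans (by linarith [hC t, hC s])

/-- By Peetre's inequality 1/(1 + s²) ≤ 2(1 + (t - s)²)/(1 + t²), and the second moment of the
Gaussian is bounded for b ≥ 1. The result is an integrable majorant independent of b. -/
theorem norm_integral_gauss_le_inv_one_add_sq {b : ℝ} (hb : 1 ≤ b) {c : ℝ → ℂ} {A : ℝ}
    (hA : ∀ t, ‖c t‖ ≤ A * (1 + t ^ 2)⁻¹) (t : ℝ) :
    ‖∫ s, gauss b (t - s) • c s‖ ≤ 8 * A * (1 + t ^ 2)⁻¹ := by
  have hb0 : 0 < b := by linarith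
  have hb2 : 0 < b / 2 := by linarith
  have hA0 : 0 ≤ A := by
    have := (norm_nonneg _).trans (hA 0)
    simpa using this
  have hI : ∫ s, 2 * A * (1 + t ^ 2)⁻¹ * (gauss b (t - s) + 3 / b * gauss (b / 2) (t - s)) =
      2 * A * (1 + t ^ 2)⁻¹ * (1 + 3 / b) := by
    rw [integral_const_mul, integral_add ((integrable_gauss hb0).comp_sub_left t)
      (((integrable_gauss hb2).comp_sub_left t).const_mul _), integral_const_mul,
      integral_sub_left_eq_self (gauss b), integral_sub_left_eq_self (gauss (b / 2)),
      integral_gauss_eq hb0, integral_gauss_eq hb2, mul_one]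
  have h3 : 3 / b ≤ 3 := by rw [div_le_iff₀ hb0]; linarith
  have hpos : 0 ≤ 2 * A * (1 + t ^ 2)⁻¹ := by positivity
  refine (norm_integral_le_of_norm_le ((((integrable_gauss hb0).comp_sub_left t).add
    (((integrable_gauss hb2).comp_sub_left t).const_mul (3 / b))).const_mul
      (2 * A * (1 + t ^ 2)⁻¹)) (.of_forall fun s => ?_)).trans (hI.le.trans ?_)
  · rw [norm_smul, Real.norm_of_nonneg (gauss_nonneg _ _)]
    have h4 : (1 + s ^ 2)⁻¹ ≤ 2 * (1 + t ^ 2)⁻¹ * (1 + (t - s) ^ 2) := by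
      rw [inv_le_iff_one_le_mul₀ (by positivity), mul_assoc, mul_right_comm, ← div_eq_mul_inv,
        le_div_iff₀ (by positivity)]
      nlinarith [sq_nonneg (t - 2 * s), sq_nonneg ((t - s) * s)]
    have h5 := gauss_mul_sq_le hb0 (t - s)
    have h6 := gauss_nonneg b (t - s)
    calc gauss b (t - s) * ‖c s‖
        ≤ gauss b (t - s) * (A * (2 * (1 + t ^ 2)⁻¹ * (1 + (t - s) ^ 2))) :=
          mul_le_mul_of_nonneg_left ((hA s).trans (mul_le_mul_of_nonneg_left h4 hA0)) h6
      _ = 2 * A * (1 + t ^ 2)⁻¹ * (gauss b (t - s) + gauss b (t - s) * (t - s) ^ 2) := by ring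
      _ ≤ _ := mul_le_mul_of_nonneg_left (by simpa using h5) hpos
  · nlinarith

/-- Gaussian convolutions converge in `L¹`. -/
theorem tendsto_integral_norm_gauss_sub {c : ℝ → ℂ} (hc : Continuous c) {A : ℝ}
    (hA : ∀ t, ‖c t‖ ≤ A * (1 + t ^ 2)⁻¹) :
    Tendsto (fun b => ∫ t, ‖(∫ s, gauss b (t - s) • c s) - c t‖) atTop (𝓝 0) := by
  have hA0 : 0 ≤ A := by
    have := (norm_nonneg _).trans (hA 0)
    simpa using this
  have hC : ∀ t, ‖c t‖ ≤ A := fun t => (hA t).trans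
    (mul_le_of_le_one_right hA0 (inv_le_one_of_one_le₀ (by nlinarith)))
  have h0 : ∫ t : ℝ, (0 : ℝ) = 0 := integral_zero _ _
  rw [← h0]
  refine tendsto_integral_filter_of_dominated_convergence
    (fun t => 9 * A * (1 + t ^ 2)⁻¹) ?_ ?_ (integrable_inv_one_add_sq.const_mul _) ?_
  · filter_upwards [eventually_ge_atTop 1] with b hb
    have hb0 : 0 < b := by linarith
    have hsm := (differentiable_smoothing hb0 hc hC).continuous
    have hcont : Continuous fun t : ℝ => ∫ s, gauss b (t - s) • c s := by
      simp_rw [← smoothing_mul_I]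
      exact hsm.comp (by fun_prop)
    exact (hcont.sub hc).norm.aestronglyMeasurable
  · filter_upwards [eventually_ge_atTop 1] with b hb
    refine .of_forall fun t => ?_
    rw [norm_norm]
    refine (norm_sub_le _ _).trans ?_
    have := norm_integral_gauss_le_inv_one_add_sq hb hA t
    linarith [hA t]
  · refine .of_forall fun t => ?_
    rw [Metric.tendsto_atTop]
    intro ε hε
    obtain ⟨K, hK0, hK⟩ := exists_quadratic_modulus_at hc.continuousAt hC (s := t) (half_pos hε)
    refine ⟨6 * (K + 1) / ε, fun b hb => ?_⟩
    have hb0 : 0 < b := lt_of_lt_of_le (by positivity) hb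
    have h := norm_integral_gauss_sub_le hb0 hc hC hK hK0
    rw [dist_zero_right, norm_norm]
    refine h.trans_lt ?_
    have h2 : 6 * (K + 1) ≤ b * ε := by rwa [ge_iff_le, div_le_iff₀ hε] at hb
    have h3 : K * (3 / b) < ε / 2 := by
      rw [mul_div_assoc', div_lt_iff₀ hb0]
      linarith
    linarith

end ApproximateIdentity

section Kernel

variable {b c : ℝ}

theorem inv_pois_le (h0 : 0 < c) (h1 : c < 1) (t : ℝ) :
    (pois c t)⁻¹ ≤ 4 / Real.sin (Real.pi * c) * Real.exp (Real.pi * |t|) := by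
  unfold pois
  rw [inv_div, div_mul_eq_mul_div]
  refine div_le_div_of_nonneg_right ?_ (sin_pi_mul_pos h0 h1).le
  have h2 : Real.cosh (Real.pi * t) ≤ Real.exp (Real.pi * |t|) := by
    rw [← Real.cosh_abs, abs_mul, abs_of_pos Real.pi_pos, Real.cosh_eq]
    have : Real.exp (-(Real.pi * |t|)) ≤ Real.exp (Real.pi * |t|) :=
      Real.exp_le_exp.mpr (by nlinarith [Real.pi_pos, abs_nonneg t])
    linarith
  have h3 : Real.cos (Real.pi * c) ≤ 1 := Real.cos_le_one _
  have h4 : 1 ≤ Real.exp (Real.pi * |t|) := Real.one_le_exp (by positivity)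
  linarith

/-- The reciprocal of the Poisson kernel grows only like e^{π|t|}, which the Gaussian absorbs. So
the kernel divided by the Poisson density is an entire family of bounded functions. -/
theorem rapidDecay_inv_pois (hb : 0 < b) (h0 : 0 < c) (h1 : c < 1) :
    RapidDecay fun t : ℝ => (((pois c t)⁻¹ : ℝ) : ℂ) * Real.exp (-(b * t ^ 2)) := by
  have hc := (continuous_pois h0 h1).inv₀ fun t => (pois_pos h0 h1 t).ne'
  refine RapidDecay.of_le ((Complex.continuous_ofReal.comp hc).mul (by fun_prop)) hb
    (A := 4 / Real.sin (Real.pi * c)) (m := Real.pi)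
    fun t => ?_
  rw [norm_mul, Complex.norm_real, Complex.norm_real,
    Real.norm_of_nonneg (inv_nonneg.mpr (pois_pos h0 h1 t).le),
    Real.norm_of_nonneg (by positivity), ← mul_assoc]
  exact mul_le_mul_of_nonneg_right (inv_pois_le h0 h1 t) (Real.exp_pos _).le

/-- The bounded function `t ↦ cgauss b (z - t i) / pois c t`. -/
def gaussKernel (hb : 0 < b) (h0 : 0 < c) (h1 : c < 1) (z : ℂ) : ℝ →ᵇ ℂ :=
  ((√(b / Real.pi) : ℝ) * Complex.exp (b * z ^ 2) : ℂ) •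
    expBCF (rapidDecay_inv_pois hb h0 h1) (-(2 * b * Complex.I * z))

theorem gaussKernel_apply (hb : 0 < b) (h0 : 0 < c) (h1 : c < 1) (z : ℂ) (t : ℝ) :
    gaussKernel hb h0 h1 z t = cgauss b (z - t * Complex.I) * ((pois c t)⁻¹ : ℝ) := by
  unfold gaussKernel cgauss
  rw [BoundedContinuousFunction.smul_apply, expBCF_apply]
  have h2 : (b : ℂ) * (z - t * Complex.I) ^ 2 =
      b * z ^ 2 + -(2 * b * Complex.I * z) * t + -(b * t ^ 2) := by
    linear_combination (b : ℂ) * t ^ 2 * Complex.I_sq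
  rw [h2, Complex.exp_add, Complex.exp_add, smul_eq_mul]
  push_cast
  ring

theorem differentiable_gaussKernel (hb : 0 < b) (h0 : 0 < c) (h1 : c < 1) :
    Differentiable ℂ (gaussKernel hb h0 h1) := by
  have h : Differentiable ℂ fun z : ℂ =>
      expBCF (rapidDecay_inv_pois hb h0 h1) (-(2 * b * Complex.I * z)) :=
    (differentiable_expBCF _).comp (by fun_prop)
  show Differentiable ℂ fun z : ℂ => ((√(b / Real.pi) : ℝ) * Complex.exp (b * z ^ 2) : ℂ) •
    expBCF (rapidDecay_inv_pois hb h0 h1) (-(2 * b * Complex.I * z))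
  have h' : Differentiable ℂ fun z : ℂ =>
      ((√(b / Real.pi) : ℝ) * Complex.exp (b * z ^ 2) : ℂ) := by fun_prop
  exact h'.smul h

/-- The Poisson weight cancels, so the weighted L¹-norm of the kernel is exactly exp(b (Re z)²), and
in particular 1 on the line Re z = 0. -/
theorem pois_mul_norm_gaussKernel (hb : 0 < b) (h0 : 0 < c) (h1 : c < 1) (z : ℂ) (t : ℝ) :
    pois c t * ‖gaussKernel hb h0 h1 z t‖ = Real.exp (b * z.re ^ 2) * gauss b (z.im - t) := by
  have hp := pois_pos h0 h1 t
  have hre : (z - t * Complex.I).re = z.re := by simp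
  have him : (z - t * Complex.I).im = z.im - t := by simp
  rw [gaussKernel_apply, norm_mul, norm_cgauss, hre, him, Complex.norm_real,
    Real.norm_of_nonneg (inv_nonneg.mpr hp.le)]
  field_simp

/-- Needed for Bochner integrability in the supremum norm: multiplied by a function with Gaussian
decay, the kernels become an integrable family. -/
theorem norm_gaussKernel_mul_I_le (hb : 0 < b) (h0 : 0 < c) (h1 : c < 1) :
    ∃ A, 0 ≤ A ∧ ∀ s : ℝ, ‖gaussKernel hb h0 h1 (s * Complex.I)‖ ≤
      A * Real.exp (Real.pi * |s|) := by
  have hs := sin_pi_mul_pos h0 h1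
  refine ⟨√(b / Real.pi) * (4 / Real.sin (Real.pi * c)) * Real.exp (Real.pi ^ 2 / (4 * b)),
    by positivity, fun s => (BoundedContinuousFunction.norm_le (by positivity)).mpr fun t => ?_⟩
  have hp := pois_pos h0 h1 t
  rw [gaussKernel_apply, ← sub_mul, ← Complex.ofReal_sub, cgauss_mul_I, norm_mul,
    Complex.norm_real, Complex.norm_real, Real.norm_of_nonneg (gauss_nonneg _ _),
    Real.norm_of_nonneg (inv_nonneg.mpr hp.le)]
  have h2 : Real.exp (-(b * (s - t) ^ 2)) * Real.exp (Real.pi * |t|) ≤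
      Real.exp (Real.pi ^ 2 / (4 * b)) * Real.exp (Real.pi * |s|) := by
    rw [← Real.exp_add, ← Real.exp_add, Real.exp_le_exp]
    have h3 : |t| ≤ |s| + |s - t| := by
      have := abs_sub_abs_le_abs_sub t s
      rw [abs_sub_comm] at this
      linarith
    have h4 : Real.pi * |s - t| - b * |s - t| ^ 2 ≤ Real.pi ^ 2 / (4 * b) := by
      rw [le_div_iff₀ (by positivity)]
      linarith [sq_nonneg (2 * b * |s - t| - Real.pi)]
    rw [← sq_abs (s - t)]
    nlinarith [Real.pi_pos]
  calc gauss b (s - t) * (pois c t)⁻¹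
      ≤ gauss b (s - t) * (4 / Real.sin (Real.pi * c) * Real.exp (Real.pi * |t|)) :=
        mul_le_mul_of_nonneg_left (inv_pois_le h0 h1 t) (gauss_nonneg _ _)
    _ = √(b / Real.pi) * (4 / Real.sin (Real.pi * c)) *
          (Real.exp (-(b * (s - t) ^ 2)) * Real.exp (Real.pi * |t|)) := by unfold gauss; ring
    _ ≤ √(b / Real.pi) * (4 / Real.sin (Real.pi * c)) *
          (Real.exp (Real.pi ^ 2 / (4 * b)) * Real.exp (Real.pi * |s|)) := by gcongr
    _ = _ := by ring

theorem pois_le (h0 : 0 < c) (h1 : c < 1) (t : ℝ) : pois c t ≤ pois c 0 := by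
  unfold pois
  have h2 := cosh_add_cos_pos h0 h1 0
  refine div_le_div_of_nonneg_left (sin_pi_mul_pos h0 h1).le (by linarith) ?_
  have := Real.one_le_cosh (Real.pi * t)
  simp only [mul_zero, Real.cosh_zero]
  linarith

end Kernel

section Functional

variable {E : Type*} [NormedAddCommGroup E] [NormedSpace ℂ E] {b c : ℝ}

variable (E) in
/-- The bilinear map `(w, y) ↦ (t ↦ w t • y)`. -/
def bcfSMul : (ℝ →ᵇ ℂ) →L[ℂ] E →L[ℂ] (ℝ →ᵇ E) :=
  LinearMap.mkContinuous₂
    { toFun := fun w =>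
        { toFun := fun y => BoundedContinuousFunction.ofNormedAddCommGroup (fun t => w t • y)
            (w.continuous.smul continuous_const) (‖w‖ * ‖y‖) fun t => by
              rw [norm_smul]
              exact mul_le_mul_of_nonneg_right (w.norm_coe_le_norm t) (norm_nonneg y)
          map_add' := fun y y' => by ext t; simp
          map_smul' := fun a y => by ext t; exact smul_comm _ _ _ }
      map_add' := fun w w' => by ext y t; simp [add_smul]
      map_smul' := fun a w => by ext y t; simp [mul_smul] } 1 fun w y => by
    rw [one_mul]
    refine (BoundedContinuousFunction.norm_le (by positivity)).mpr fun t => ?_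
    exact (norm_smul_le _ _).trans
      (mul_le_mul_of_nonneg_right (w.norm_coe_le_norm t) (norm_nonneg y))

theorem bcfSMul_apply (w : ℝ →ᵇ ℂ) (y : E) (t : ℝ) : bcfSMul E w y t = w t • y := rfl

theorem norm_apply_gaussKernel_le {Λ : (ℝ →ᵇ E) →L[ℂ] ℂ}
    (hΛ : ∀ v, ‖Λ v‖ ≤ ∫ t, pois c t * ‖v t‖) (hb : 0 < b) (h0 : 0 < c) (h1 : c < 1) (z : ℂ)
    (y : E) : ‖Λ (bcfSMul E (gaussKernel hb h0 h1 z) y)‖ ≤ Real.exp (b * z.re ^ 2) * ‖y‖ := by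
  refine (hΛ _).trans (le_of_eq ?_)
  have : ∀ t, pois c t * ‖bcfSMul E (gaussKernel hb h0 h1 z) y t‖ =
      Real.exp (b * z.re ^ 2) * (gauss b (z.im - t) * ‖y‖) := fun t => by
    rw [bcfSMul_apply, norm_smul, ← mul_assoc, pois_mul_norm_gaussKernel, mul_assoc]
  simp_rw [this]
  rw [integral_const_mul, integral_mul_const, integral_sub_left_eq_self (gauss b),
    integral_gauss_eq hb, one_mul]

/-- Averaging the values on Gaussian kernels recovers a functional in the limit. -/
theorem norm_integral_apply_gaussKernel_sub_le {Λ : (ℝ →ᵇ E) →L[ℂ] ℂ}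
    (hΛ : ∀ v, ‖Λ v‖ ≤ ∫ t, pois c t * ‖v t‖) (hb : 0 < b) (h0 : 0 < c) (h1 : c < 1) (y : E)
    (α : ℝ →ᵇ ℂ) {A : ℝ} (hα : ∀ t, ‖α t‖ ≤ A * Real.exp (-t ^ 2)) :
    ‖(∫ s : ℝ, pois c s • (Λ (bcfSMul E (gaussKernel hb h0 h1 (s * Complex.I)) y) * α s)) -
      Λ (bcfSMul E α y)‖ ≤
      (∫ t, ‖(∫ s, gauss b (t - s) • (pois c s • α s)) - pois c t • α t‖) * ‖y‖ := by
  have hA0 : 0 ≤ A := by simpa using (norm_nonneg _).trans (hα 0)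
  obtain ⟨B, hB0, hB⟩ := norm_gaussKernel_mul_I_le hb h0 h1
  have hp0 : 0 ≤ pois c 0 := (pois_pos h0 h1 0).le
  -- A Bochner integrable family of bounded functions, so Λ passes under the integral. What remains
  -- is the L¹-distance between the integral of f and α in the Poisson weight.
  set f : ℝ → (ℝ →ᵇ ℂ) := fun s => (pois c s • α s) • gaussKernel hb h0 h1 (s * Complex.I)
    with hf
  have hfc : Continuous f := by
    have h2 := continuous_pois h0 h1
    have h3 := (differentiable_gaussKernel hb h0 h1).continuous
    have h4 := α.continuous
    exact (h2.smul h4).smul (h3.comp (by fun_prop))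
  have hfi : Integrable f := by
    have hg : Integrable fun s : ℝ => pois c 0 * A * B * Real.exp (Real.pi ^ 2 / 2) *
        Real.exp (-(1 / 2) * s ^ 2) := (integrable_exp_neg_mul_sq (by norm_num)).const_mul _
    refine hg.mono' hfc.aestronglyMeasurable (.of_forall fun s => ?_)
    rw [hf, norm_smul, norm_smul, Real.norm_of_nonneg (pois_pos h0 h1 s).le]
    have h5 : Real.exp (-s ^ 2) * Real.exp (Real.pi * |s|) ≤
        Real.exp (Real.pi ^ 2 / 2) * Real.exp (-(1 / 2) * s ^ 2) := by
      rw [← Real.exp_add, ← Real.exp_add, Real.exp_le_exp, ← sq_abs s]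
      linarith [sq_nonneg (|s| - Real.pi)]
    calc pois c s * ‖α s‖ * ‖gaussKernel hb h0 h1 (s * Complex.I)‖
        ≤ pois c 0 * (A * Real.exp (-s ^ 2)) * (B * Real.exp (Real.pi * |s|)) := by
          gcongr
          · exact pois_le h0 h1 s
          · exact hα s
          · exact hB s
      _ = pois c 0 * A * B * (Real.exp (-s ^ 2) * Real.exp (Real.pi * |s|)) := by ring
      _ ≤ pois c 0 * A * B * (Real.exp (Real.pi ^ 2 / 2) * Real.exp (-(1 / 2) * s ^ 2)) := by
          gcongr
      _ = _ := by ring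
  let L : (ℝ →ᵇ ℂ) →L[ℂ] ℂ := Λ.comp ((bcfSMul E).flip y)
  have hL : ∀ w, L w = Λ (bcfSMul E w y) := fun w => rfl
  have h6 : ∫ s : ℝ, pois c s • (Λ (bcfSMul E (gaussKernel hb h0 h1 (s * Complex.I)) y) * α s) =
      L (∫ s, f s) := by
    rw [← L.integral_comp_comm hfi]
    refine integral_congr_ae (.of_forall fun s => ?_)
    simp only [hf]
    rw [L.map_smul, hL, Complex.real_smul, Complex.real_smul, smul_eq_mul]
    ring
  rw [h6, ← hL α, ← map_sub, hL]
  refine (hΛ _).trans (le_of_eq ?_)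
  rw [← integral_mul_const]
  refine integral_congr_ae (.of_forall fun t => ?_)
  simp only
  have hev : (∫ s, f s) t = ∫ s, f s t :=
    ((BoundedContinuousFunction.evalCLM ℂ t).integral_comp_comm hfi).symm
  have hp := pois_pos h0 h1 t
  -- Multiplication by the Poisson weight turns the averaged kernel into the ordinary Gaussian
  -- convolution of `pois c` times α.
  have h7 : pois c t • (∫ s, f s) t = ∫ s, gauss b (t - s) • (pois c s • α s) := by
    rw [hev, ← integral_smul]
    refine integral_congr_ae (.of_forall fun s => ?_)
    simp only [hf, BoundedContinuousFunction.smul_apply]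
    rw [gaussKernel_apply, ← sub_mul, ← Complex.ofReal_sub, cgauss_mul_I, ← gauss_neg, neg_sub]
    simp only [Complex.real_smul, smul_eq_mul]
    have : (pois c t : ℂ) ≠ 0 := by exact_mod_cast hp.ne'
    push_cast
    field_simp
  rw [bcfSMul_apply, norm_smul, ← mul_assoc, ← h7]
  congr 1
  rw [← smul_sub, norm_smul, Real.norm_of_nonneg hp.le]
  rfl

end Functional

theorem norm_poisInv_le (θ : ℝ) : ∃ A, 0 ≤ A ∧ ∀ z : ℂ,
    ‖poisInv θ z‖ ≤ A * Real.exp (Real.pi * |z.im|) := by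
  refine ⟨2 * (‖Complex.cos (Real.pi * θ)‖ + 1) / ‖Complex.sin (Real.pi * θ)‖, by positivity,
    fun z => ?_⟩
  have h1 : ‖Complex.cos (Real.pi * z)‖ ≤ Real.exp (Real.pi * |z.im|) := by
    unfold Complex.cos
    rw [norm_div, Complex.norm_two, div_le_iff₀ two_pos]
    refine (norm_add_le _ _).trans ?_
    rw [Complex.norm_exp, Complex.norm_exp, mul_two]
    refine add_le_add (Real.exp_le_exp.mpr ?_) (Real.exp_le_exp.mpr ?_)
    · simp only [Complex.mul_re, Complex.I_re, Complex.I_im, Complex.mul_im, Complex.ofReal_re,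
        Complex.ofReal_im, mul_zero, zero_mul, mul_one, zero_sub, add_zero]
      nlinarith [neg_abs_le z.im, Real.pi_pos]
    · simp only [Complex.mul_re, Complex.I_re, Complex.I_im, Complex.mul_im, Complex.ofReal_re,
        Complex.ofReal_im, mul_zero, zero_mul, mul_one, zero_sub, add_zero, neg_mul,
        Complex.neg_re, neg_neg]
      nlinarith [le_abs_self z.im, Real.pi_pos]
  have h2 : 1 ≤ Real.exp (Real.pi * |z.im|) :=
    Real.one_le_exp (mul_nonneg Real.pi_pos.le (abs_nonneg _))
  unfold poisInv
  rw [norm_div, norm_mul, Complex.norm_two, div_mul_eq_mul_div]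
  refine div_le_div_of_nonneg_right ?_ (norm_nonneg _)
  have h3 := norm_sub_le (Complex.cos (Real.pi * θ)) (Complex.cos (Real.pi * z))
  nlinarith [norm_nonneg (Complex.cos (Real.pi * θ))]

theorem exists_bound_cgauss_mul_poisInv {b : ℝ} (hb : 0 < b) (θ : ℝ) (w : ℂ) :
    ∃ K, ∀ z ∈ closedStrip, ‖cgauss b (w - z) * poisInv θ z‖ ≤ K := by
  obtain ⟨A, hA0, hA⟩ := norm_poisInv_le θ
  refine ⟨Real.exp (b * (|w.re| + 1) ^ 2) * (√(b / Real.pi) * (Real.exp (Real.pi ^ 2 / (4 * b)) *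
    Real.exp (Real.pi * |w.im|))) * A, fun z hz => ?_⟩
  rw [norm_mul, norm_cgauss]
  have h1 : Real.exp (b * (w - z).re ^ 2) ≤ Real.exp (b * (|w.re| + 1) ^ 2) := by
    refine Real.exp_le_exp.mpr (mul_le_mul_of_nonneg_left ?_ hb.le)
    refine sq_le_sq' ?_ ?_ <;> simp only [Complex.sub_re] <;>
      linarith [neg_abs_le w.re, le_abs_self w.re, hz.1, hz.2]
  have h2 : gauss b (w - z).im * Real.exp (Real.pi * |z.im|) ≤
      √(b / Real.pi) * (Real.exp (Real.pi ^ 2 / (4 * b)) * Real.exp (Real.pi * |w.im|)) := by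
    unfold gauss
    rw [mul_assoc]
    refine mul_le_mul_of_nonneg_left ?_ (Real.sqrt_nonneg _)
    rw [← Real.exp_add, ← Real.exp_add, Real.exp_le_exp, Complex.sub_im]
    have h3 : |z.im| ≤ |w.im| + |w.im - z.im| := by
      have := abs_sub_abs_le_abs_sub z.im w.im
      rw [abs_sub_comm] at this
      linarith
    have h4 : Real.pi * |w.im - z.im| - b * |w.im - z.im| ^ 2 ≤ Real.pi ^ 2 / (4 * b) := by
      rw [le_div_iff₀ (by positivity)]
      linarith [sq_nonneg (2 * b * |w.im - z.im| - Real.pi)]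
    rw [← sq_abs (w.im - z.im)]
    nlinarith [Real.pi_pos]
  calc Real.exp (b * (w - z).re ^ 2) * gauss b (w - z).im * ‖poisInv θ z‖
      ≤ Real.exp (b * (|w.re| + 1) ^ 2) * gauss b (w - z).im *
          (A * Real.exp (Real.pi * |z.im|)) :=
        mul_le_mul (mul_le_mul_of_nonneg_right h1 (gauss_nonneg _ _)) (hA z) (norm_nonneg _)
          (mul_nonneg (Real.exp_pos _).le (gauss_nonneg _ _))
    _ = Real.exp (b * (|w.re| + 1) ^ 2) * (gauss b (w - z).im * Real.exp (Real.pi * |z.im|)) *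
          A := by ring
    _ ≤ _ := mul_le_mul_of_nonneg_right (mul_le_mul_of_nonneg_left h2 (Real.exp_pos _).le) hA0

/-! ### Functionals on interpolation spaces as limits of strip functions -/

theorem integrable_pois_mul_norm {E : Type*} [NormedAddCommGroup E] {c : ℝ} (h0 : 0 < c)
    (h1 : c < 1) (v : ℝ →ᵇ E) : Integrable fun t => pois c t * ‖v t‖ :=
  integrable_pois_mul h0 h1 v.continuous.norm (K := ‖v‖) fun t => by
    simpa using v.norm_coe_le_norm t

/-- The `L¹`-seminorm with respect to the Poisson kernel. -/
def poisSeminorm (E : Type*) [NormedAddCommGroup E] [NormedSpace ℂ E] {c : ℝ} (h0 : 0 < c)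
    (h1 : c < 1) : Seminorm ℂ (ℝ →ᵇ E) :=
  Seminorm.of (fun v => ∫ t, pois c t * ‖v t‖)
    (fun v w => by
      rw [← integral_add (integrable_pois_mul_norm h0 h1 v) (integrable_pois_mul_norm h0 h1 w)]
      refine integral_mono (integrable_pois_mul_norm h0 h1 (v + w))
        ((integrable_pois_mul_norm h0 h1 v).add (integrable_pois_mul_norm h0 h1 w)) fun t => ?_
      have := mul_le_mul_of_nonneg_left (norm_add_le (v t) (w t)) (pois_pos h0 h1 t).le
      simpa [mul_add] using this)
    (fun a v => by
      rw [← integral_const_mul]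
      refine integral_congr_ae (.of_forall fun t => ?_)
      simp only [BoundedContinuousFunction.smul_apply, norm_smul]
      ring)

theorem poisSeminorm_apply {E : Type*} [NormedAddCommGroup E] [NormedSpace ℂ E] {c : ℝ}
    (h0 : 0 < c) (h1 : c < 1) (v : ℝ →ᵇ E) :
    poisSeminorm E h0 h1 v = ∫ t, pois c t * ‖v t‖ := rfl

theorem poisSeminorm_le {E : Type*} [NormedAddCommGroup E] [NormedSpace ℂ E] {c : ℝ}
    (h0 : 0 < c) (h1 : c < 1) (v : ℝ →ᵇ E) : poisSeminorm E h0 h1 v ≤ ‖v‖ := by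
  rw [poisSeminorm_apply]
  have h : ∫ t, pois c t * ‖v‖ = c * ‖v‖ := by rw [integral_mul_const, integral_pois h0 h1]
  refine (integral_mono (integrable_pois_mul_norm h0 h1 v)
    ((integrable_pois h0 h1).mul_const ‖v‖) fun t => ?_).trans (h.le.trans ?_)
  · exact mul_le_mul_of_nonneg_left (v.norm_coe_le_norm t) (pois_pos h0 h1 t).le
  · nlinarith [norm_nonneg v]

namespace NormalFaithfulState

variable {M P : Type*} [JBStarAlgebra M] [NormedAddCommGroup P] [NormedSpace ℂ P]
  [CompleteSpace P] {e : M ≃ₗᵢ[ℂ] StrongDual ℂ P} (φ : NormalFaithfulState e)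
  {θ : Set.Icc (0 : ℝ) 1}

/-- The pairs consisting of the boundary values of a strip function and its value at `θ`. -/
def boundaryGraph (θ : Set.Icc (0 : ℝ) 1) :
    Submodule ℂ (((ℝ →ᵇ M) × (ℝ →ᵇ P)) × φ.couple.Interpolation θ) where
  carrier := {s | ∃ F C, φ.BddStrip F s.1.1 C ∧ (∀ t : ℝ, F (1 + t * Complex.I) = s.1.2 t) ∧
    φ.val s.2 = F (θ : ℝ)}
  add_mem' := by
    rintro s s' ⟨F, C, hF, hr, hv⟩ ⟨F', C', hF', hr', hv'⟩
    refine ⟨_, _, hF.add hF', fun t => ?_, ?_⟩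
    · rw [hr, hr']; rfl
    · rw [← hv, ← hv', ← map_add]; rfl
  zero_mem' := ⟨fun _ => 0, 0, ⟨diffContOnCl_const, ⟨0, by simp⟩, continuous_const, by simp,
    by simp, by simp⟩, by simp, by simp⟩
  smul_mem' := by
    rintro a s ⟨F, C, hF, hr, hv⟩
    refine ⟨_, ‖a‖ * C, hF.smul (g := fun _ => a) diffContOnCl_const ⟨‖a‖, by simp⟩
      (fun t => ?_) (fun t => ?_), fun t => ?_, ?_⟩
    · rw [norm_smul]; exact mul_le_mul_of_nonneg_left (hF.norm_left t) (norm_nonneg a)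
    · rw [norm_smul]; exact mul_le_mul_of_nonneg_left (hF.norm_right t) (norm_nonneg a)
    · rw [hr]; rfl
    · rw [← hv, ← map_smul]; rfl

/-- A bounded functional on the interpolation space is represented by a functional on the
boundary values that is dominated by harmonic measure. -/
theorem exists_boundary_functional (h0 : 0 < (θ : ℝ)) (h1 : (θ : ℝ) < 1)
    (ℓ : StrongDual ℂ (φ.couple.Interpolation θ)) (hℓ : ‖ℓ‖ ≤ 1) :
    ∃ (Λ₀ : (ℝ →ᵇ M) →L[ℂ] ℂ) (Λ₁ : (ℝ →ᵇ P) →L[ℂ] ℂ),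
      (∀ u, ‖Λ₀ u‖ ≤ ∫ t, pois (1 - θ) t * ‖u t‖) ∧
      (∀ v, ‖Λ₁ v‖ ≤ ∫ t, pois θ t * ‖v t‖) ∧
      ∀ (F : ℂ → P) (u : ℝ →ᵇ M) (v : ℝ →ᵇ P) (C : ℝ) (h : φ.couple.Interpolation θ),
        φ.BddStrip F u C → (∀ t : ℝ, F (1 + t * Complex.I) = v t) → φ.val h = F (θ : ℝ) →
        Λ₀ u + Λ₁ v = ℓ h := by
  have q0 : 0 < 1 - (θ : ℝ) := by linarith
  have q1 : 1 - (θ : ℝ) < 1 := by linarith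
  set p : Seminorm ℂ ((ℝ →ᵇ M) × (ℝ →ᵇ P)) :=
    (poisSeminorm M q0 q1).comp (LinearMap.fst ℂ _ _) +
      (poisSeminorm P h0 h1).comp (LinearMap.snd ℂ _ _) with hp
  have hpa : ∀ s, p s = (∫ t, pois (1 - θ) t * ‖s.1 t‖) + ∫ t, pois θ t * ‖s.2 t‖ :=
    fun s => rfl
  let ψ : φ.boundaryGraph θ →ₗ[ℂ] (ℝ →ᵇ M) × (ℝ →ᵇ P) :=
    LinearMap.fst ℂ _ _ ∘ₗ (φ.boundaryGraph θ).subtype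
  -- Domination by harmonic measure serves twice: it shows that the boundary values determine the
  -- value at θ, and it is the bound for the Hahn–Banach extension in the seminorm p.
  have hbound : ∀ s : φ.boundaryGraph θ, ‖s.1.2‖ ≤ p (ψ s) := by
    rintro ⟨s, F, C, hF, hr, hv⟩
    have h := BddStrip.norm_le_integral φ hF h0 h1 hv
    simp_rw [hr] at h
    rw [hpa]
    exact h
  have hinj : Function.Injective ψ := by
    rw [injective_iff_map_eq_zero]
    intro s hs
    have h := hbound s
    rw [hs, map_zero] at h
    exact Subtype.ext (Prod.ext hs (norm_le_zero_iff.mp h))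
  let E := LinearEquiv.ofInjective ψ hinj
  let f : Module.Dual ℂ (LinearMap.range ψ) :=
    ℓ.toLinearMap ∘ₗ LinearMap.snd ℂ _ _ ∘ₗ (φ.boundaryGraph θ).subtype ∘ₗ E.symm.toLinearMap
  obtain ⟨Λ, hΛ, hΛp⟩ := Module.Dual.exists_extension_of_le_seminorm (LinearMap.range ψ) f
    (p := p) (by
      intro x
      obtain ⟨s, rfl⟩ := E.surjective x
      have h2 : f (E s) = ℓ s.1.2 := by simp [f]
      rw [h2]
      refine (ℓ.le_opNorm _).trans ((mul_le_of_le_one_left (norm_nonneg _) hℓ).trans ?_)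
      exact hbound s)
  have b0 : ∀ u, ‖Λ (u, 0)‖ ≤ ∫ t, pois (1 - θ) t * ‖u t‖ := fun u => by
    have := hΛp (u, 0)
    rw [hpa] at this
    simpa using this
  have b1 : ∀ v, ‖Λ (0, v)‖ ≤ ∫ t, pois θ t * ‖v t‖ := fun v => by
    have := hΛp (0, v)
    rw [hpa] at this
    simpa using this
  refine ⟨(Λ ∘ₗ LinearMap.inl ℂ _ _).mkContinuous 1 fun u => ?_,
    (Λ ∘ₗ LinearMap.inr ℂ _ _).mkContinuous 1 fun v => ?_, b0, b1, ?_⟩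
  · rw [one_mul]; exact (b0 u).trans (poisSeminorm_le q0 q1 u)
  · rw [one_mul]; exact (b1 v).trans (poisSeminorm_le h0 h1 v)
  · intro F u v C h hF hr hv
    show Λ (u, 0) + Λ (0, v) = ℓ h
    rw [← map_add, Prod.mk_add_mk, add_zero, zero_add]
    let s : φ.boundaryGraph θ := ⟨((u, v), h), F, C, hF, hr, hv⟩
    have h2 := hΛ (E s)
    have h3 : f (E s) = ℓ h := by simp [f, s]
    rw [h3] at h2
    exact h2

theorem norm_le_of_forall_apply_le {ω : P} {C : ℝ} (hC : 0 ≤ C)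
    (h : ∀ x : M, ‖e x ω‖ ≤ C * ‖x‖) : ‖ω‖ ≤ C := by
  rw [← norm_predualInclusion e]
  exact ContinuousLinearMap.opNorm_le_bound _ hC h

/-- A functional of norm at most one on an interpolation space is the pointwise limit on `M` of
the functionals given by the values of strip functions of norm at most one. -/
theorem exists_niceStrip_tendsto (h0 : 0 < (θ : ℝ)) (h1 : (θ : ℝ) < 1)
    (ℓ : StrongDual ℂ (φ.couple.Interpolation θ)) (hℓ : ‖ℓ‖ ≤ 1) :
    ∃ g : ℕ → ℂ → M, (∀ n, φ.NiceStrip (g n) 1) ∧ ∀ x : M,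
      Tendsto (fun n => e (g n (1 - (θ : ℝ))) (φ.toPredual x)) atTop
        (𝓝 (ℓ (φ.ofAlgebra θ x))) := by
  have q0 : 0 < 1 - (θ : ℝ) := by linarith
  have q1 : 1 - (θ : ℝ) < 1 := by linarith
  obtain ⟨Λ₀, Λ₁, b0, b1, hΛ⟩ := φ.exists_boundary_functional h0 h1 ℓ hℓ
  -- Fixing the kernel, Λ₁ becomes a bounded functional on the predual, that is, an element of M.
  -- The shift by 1 places its norm-1 line at Re w = 1.
  let G : ∀ b : ℝ, 0 < b → ℂ → M := fun b hb w =>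
    e.symm (Λ₁.comp (bcfSMul P (gaussKernel hb h0 h1 (w - 1))))
  have hG : ∀ b hb w ω, e (G b hb w) ω = Λ₁ (bcfSMul P (gaussKernel hb h0 h1 (w - 1)) ω) := by
    intro b hb w ω
    simp only [G, LinearIsometryEquiv.apply_symm_apply]
    rfl
  have hGd : ∀ b hb, Differentiable ℂ (G b hb) := by
    intro b hb
    have h2 : Differentiable ℂ fun w : ℂ => gaussKernel hb h0 h1 (w - 1) :=
      (differentiable_gaussKernel hb h0 h1).comp (by fun_prop)
    exact e.symm.toContinuousLinearEquiv.differentiable.comp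
      ((ContinuousLinearMap.compL ℂ P (ℝ →ᵇ P) ℂ Λ₁).differentiable.comp
        ((bcfSMul P).differentiable.comp h2))
  have hGn : ∀ b hb w, ‖G b hb w‖ ≤ Real.exp (b * (w.re - 1) ^ 2) := by
    intro b hb w
    rw [← e.norm_map]
    refine ContinuousLinearMap.opNorm_le_bound _ (Real.exp_pos _).le fun ω => ?_
    rw [hG]
    simpa using norm_apply_gaussKernel_le b1 hb h0 h1 (w - 1) ω
  -- The test function `cgauss b (w - z) * poisInv θ z` times x vanishes at z = θ, so Λ₀ + Λ₁
  -- annihilates its boundary values. These are the Gaussian kernels for the two lines, with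
  -- opposite signs.
  have hswap : ∀ b hb w (x : M), e (G b hb w) (φ.toPredual x) =
      Λ₀ (bcfSMul M (gaussKernel hb q0 q1 w) x) := by
    intro b hb w x
    obtain ⟨K, hK⟩ := exists_bound_cgauss_mul_poisInv hb θ w
    have hq : Differentiable ℂ fun z => cgauss b (w - z) * poisInv θ z :=
      ((differentiable_cgauss b).comp (by fun_prop)).mul (differentiable_poisInv θ)
    have hs := (φ.bddStrip_const x).smul hq.diffContOnCl ⟨K, hK⟩ (C' := K * ‖x‖)
      (fun t => by
        rw [norm_smul]
        exact mul_le_mul_of_nonneg_right (hK _ (ofReal_mul_I_mem_closedStrip t))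
          (norm_nonneg _))
      (fun t => by
        rw [norm_smul]
        refine mul_le_mul (hK _ (one_add_mul_I_mem_closedStrip t)) (φ.norm_toPredual_le x)
          (norm_nonneg _) ((norm_nonneg _).trans (hK _ (one_add_mul_I_mem_closedStrip 0))))
    have hl : (fun t : ℝ => (cgauss b (w - t * Complex.I) * poisInv θ (t * Complex.I)) • x) =
        ⇑(-bcfSMul M (gaussKernel hb q0 q1 w) x) := by
      funext t
      rw [BoundedContinuousFunction.neg_apply, bcfSMul_apply, gaussKernel_apply, poisInv_left,
        mul_neg, neg_smul]
    rw [hl] at hs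
    have h2 := hΛ _ _ (bcfSMul P (gaussKernel hb h0 h1 (w - 1)) (φ.toPredual x)) _ 0 hs
      (fun t => by
        rw [bcfSMul_apply, gaussKernel_apply, poisInv_right, sub_sub])
      (by simp [poisInv_self])
    rw [map_zero, map_neg, neg_add_eq_zero] at h2
    rw [hG, h2]
  have hright : ∀ b hb w, ‖φ.toPredual (G b hb w)‖ ≤ Real.exp (b * w.re ^ 2) := by
    intro b hb w
    refine norm_le_of_forall_apply_le (e := e) (Real.exp_pos _).le fun x => ?_
    rw [apply_toPredual_comm, hswap]
    exact norm_apply_gaussKernel_le b0 hb q0 q1 w x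
  -- G is bounded by 1 in M on Re w = 1 and in the predual on Re w = 0; the reflection puts these
  -- bounds on the sides required of a strip function.
  refine ⟨fun n z => G (n + 1) (by positivity) (1 - z), fun n => ?_, fun x => ?_⟩
  · refine ⟨diffContOnCl_comp_one_sub (hGd _ _).diffContOnCl, ⟨Real.exp (n + 1), fun z hz => ?_⟩,
      fun t => ?_, fun t => ?_⟩
    · refine (hGn _ _ _).trans (Real.exp_le_exp.mpr (mul_le_of_le_one_right (by positivity) ?_))
      simp only [Complex.sub_re, Complex.one_re]
      nlinarith [hz.1, hz.2]
    · simpa using hGn (n + 1) (by positivity) (1 - t * Complex.I)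
    · simpa using hright (n + 1) (by positivity) (1 - (1 + t * Complex.I))
  -- A damping factor with value 1 at θ. The function a·x still represents x at θ, and its boundary
  -- values decay fast enough for the averaging lemma.
  · set a : ℂ → ℂ := fun z => Complex.exp ((1 : ℝ) * (z - (θ : ℝ)) ^ 2) with ha
    have had : DiffContOnCl ℂ a strip := diffContOnCl_gauss 1 θ
    have hac : Continuous a := by rw [ha]; fun_prop
    have hab : ∀ z ∈ closedStrip, ‖a z‖ ≤ Real.exp 1 * Real.exp (-z.im ^ 2) := fun z hz => by
      simpa [ha] using norm_exp_gauss_le zero_le_one θ.2 hz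
    have hab' : ∀ z ∈ closedStrip, ‖a z‖ ≤ Real.exp 1 := fun z hz => (hab z hz).trans
      (mul_le_of_le_one_right (Real.exp_pos _).le (Real.exp_le_one_iff.mpr (by
        nlinarith)))
    have haθ : a (θ : ℝ) = 1 := by simp [ha]
    let α₀ : ℝ →ᵇ ℂ := BoundedContinuousFunction.ofNormedAddCommGroup
      (fun t : ℝ => a (t * Complex.I)) (hac.comp (by fun_prop)) (Real.exp 1)
      fun t => hab' _ (ofReal_mul_I_mem_closedStrip t)
    let α₁ : ℝ →ᵇ ℂ := BoundedContinuousFunction.ofNormedAddCommGroup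
      (fun t : ℝ => a (1 + t * Complex.I)) (hac.comp (by fun_prop)) (Real.exp 1)
      fun t => hab' _ (one_add_mul_I_mem_closedStrip t)
    have hα₀ : ∀ t, ‖α₀ t‖ ≤ Real.exp 1 * Real.exp (-t ^ 2) := fun t => by
      show ‖a (t * Complex.I)‖ ≤ _
      simpa using hab _ (ofReal_mul_I_mem_closedStrip t)
    have hα₁ : ∀ t, ‖α₁ t‖ ≤ Real.exp 1 * Real.exp (-t ^ 2) := fun t => by
      show ‖a (1 + t * Complex.I)‖ ≤ _
      simpa using hab _ (one_add_mul_I_mem_closedStrip t)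
    have hℓx : Λ₀ (bcfSMul M α₀ x) + Λ₁ (bcfSMul P α₁ (φ.toPredual x)) =
        ℓ (φ.ofAlgebra θ x) := by
      refine hΛ _ _ _ (Real.exp 1 * ‖x‖) _ ((φ.bddStrip_const x).smul had ⟨_, hab'⟩
        (fun t => ?_) (fun t => ?_)) (fun t => rfl) ?_
      · rw [norm_smul]
        exact mul_le_mul_of_nonneg_right (hab' _ (ofReal_mul_I_mem_closedStrip t))
          (norm_nonneg _)
      · rw [norm_smul]
        exact mul_le_mul (hab' _ (one_add_mul_I_mem_closedStrip t)) (φ.norm_toPredual_le x)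
          (norm_nonneg _) (Real.exp_pos _).le
      · rw [haθ, one_smul, val_ofAlgebra]
    -- The Poisson formula writes the value at θ as averages of Λ₀ and Λ₁ on Gaussian kernels. These
    -- are close to Λ₀ and Λ₁ on the boundary values of a·x, whose sum is ℓ(x).
    have hpoint : ∀ b hb, ‖e (G b hb (θ : ℝ)) (φ.toPredual x) - ℓ (φ.ofAlgebra θ x)‖ ≤
        (∫ t, ‖(∫ s, gauss b (t - s) • (pois (1 - θ) s • α₀ s)) - pois (1 - θ) t • α₀ t‖) * ‖x‖ +
        (∫ t, ‖(∫ s, gauss b (t - s) • (pois θ s • α₁ s)) - pois θ t • α₁ t‖) *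
          ‖φ.toPredual x‖ := by
      intro b hb
      have hβd : DiffContOnCl ℂ (fun w => e (G b hb w) (φ.toPredual x) * a w) strip := by
        have h2 : Differentiable ℂ fun w => e (G b hb w) (φ.toPredual x) :=
          (e.toContinuousLinearEquiv.differentiable.comp (hGd b hb)).clm_apply
            (differentiable_const _)
        exact h2.diffContOnCl.smul had
      have h3 := poisson_formula h0 h1 hβd ⟨Real.exp b * ‖φ.toPredual x‖ * Real.exp 1,
        fun z hz => by
          rw [norm_mul]
          refine mul_le_mul (((e _).le_opNorm _).trans ?_) (hab' z hz) (norm_nonneg _)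
            (by positivity)
          rw [e.norm_map]
          refine mul_le_mul_of_nonneg_right ((hGn b hb z).trans (Real.exp_le_exp.mpr
            (mul_le_of_le_one_right hb.le ?_))) (norm_nonneg _)
          nlinarith [hz.1, hz.2]⟩
      rw [haθ, mul_one] at h3
      have h4 := norm_integral_apply_gaussKernel_sub_le b0 hb q0 q1 x α₀ hα₀
      have h5 := norm_integral_apply_gaussKernel_sub_le b1 hb h0 h1 (φ.toPredual x) α₁ hα₁
      have h6 : ∀ t : ℝ, e (G b hb (t * Complex.I)) (φ.toPredual x) * a (t * Complex.I) =
          Λ₀ (bcfSMul M (gaussKernel hb q0 q1 (t * Complex.I)) x) * α₀ t := fun t => by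
        rw [hswap]; rfl
      have h7 : ∀ t : ℝ, e (G b hb (1 + t * Complex.I)) (φ.toPredual x) *
          a (1 + t * Complex.I) =
          Λ₁ (bcfSMul P (gaussKernel hb h0 h1 (t * Complex.I)) (φ.toPredual x)) * α₁ t :=
        fun t => by rw [hG, add_sub_cancel_left]; rfl
      simp_rw [h6, h7] at h3
      rw [h3, ← hℓx, add_sub_add_comm]
      exact (norm_add_le _ _).trans (add_le_add h4 h5)
    have hdecay : ∀ (c : ℝ) (hc0 : 0 < c) (hc1 : c < 1) (α : ℝ →ᵇ ℂ),
        (∀ t, ‖α t‖ ≤ Real.exp 1 * Real.exp (-t ^ 2)) →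
        Tendsto (fun b => ∫ t, ‖(∫ s, gauss b (t - s) • (pois c s • α s)) - pois c t • α t‖)
          atTop (𝓝 0) := by
      intro c hc0 hc1 α hα
      refine tendsto_integral_norm_gauss_sub ((continuous_pois hc0 hc1).smul α.continuous)
        (A := pois c 0 * Real.exp 1) fun t => ?_
      rw [norm_smul, Real.norm_of_nonneg (pois_pos hc0 hc1 t).le, mul_assoc]
      have h2 : Real.exp (-t ^ 2) ≤ (1 + t ^ 2)⁻¹ := by
        rw [Real.exp_neg]
        exact inv_anti₀ (by positivity) (by linarith [Real.add_one_le_exp (t ^ 2)])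
      exact mul_le_mul (pois_le hc0 hc1 t) ((hα t).trans
        (mul_le_mul_of_nonneg_left h2 (Real.exp_pos _).le)) (norm_nonneg _)
        (pois_pos hc0 hc1 0).le
    have hn : Tendsto (fun n : ℕ => (n : ℝ) + 1) atTop atTop :=
      tendsto_atTop_add_const_right _ _ tendsto_natCast_atTop_atTop
    have hlim := (((hdecay _ q0 q1 α₀ hα₀).comp hn).mul_const ‖x‖).add
      (((hdecay _ h0 h1 α₁ hα₁).comp hn).mul_const ‖φ.toPredual x‖)
    rw [zero_mul, zero_mul, add_zero] at hlim
    rw [tendsto_iff_norm_sub_tendsto_zero]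
    refine squeeze_zero (fun n => norm_nonneg _) (fun n => ?_) hlim
    simp only [sub_sub_cancel]
    exact hpoint _ _

end NormalFaithfulState

/-! ### Equality of norms, the Hilbert space at 1/2, and completeness -/

instance JBStarAlgebra.normedStarGroup {M : Type*} [JBStarAlgebra M] : NormedStarGroup M :=
  ⟨fun x => (JBStarAlgebra.norm_star' x).le⟩

namespace NormalFaithfulState

variable {M P : Type*} [JBStarAlgebra M] [NormedAddCommGroup P] [NormedSpace ℂ P]
  [CompleteSpace P] {e : M ≃ₗᵢ[ℂ] StrongDual ℂ P} (φ : NormalFaithfulState e)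
  {θ θ' : Set.Icc (0 : ℝ) 1}

variable {φ} in
theorem NiceStrip.norm_ofAlgebra_le {g : ℂ → M} {C : ℝ} (hg : φ.NiceStrip g C)
    (θ : Set.Icc (0 : ℝ) 1) : ‖φ.ofAlgebra θ (g (θ : ℝ))‖ ≤ C :=
  BddStrip.norm_le_of_val_eq φ hg.bddStrip (φ.val_ofAlgebra θ _)

/-- The norm of an element of `M` in an interpolation space is its norm as a functional on the
dual interpolation space. -/
theorem norm_pairing_eq (h0 : 0 < (θ : ℝ)) (h1 : (θ : ℝ) < 1) (hθ : (θ' : ℝ) = 1 - θ) (y : M) :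
    ‖φ.pairing θ y‖ = ‖φ.ofAlgebra θ' y‖ := by
  refine le_antisymm (φ.norm_pairing_apply_le hθ y) ?_
  -- A norming functional of y is approximated on M by elements of norm at most 1 of the space at 1
  -- - θ' = θ, and symmetry of the form lets y act on them.
  obtain ⟨ℓ, hℓ, hy⟩ := exists_dual_vector'' ℂ (φ.ofAlgebra θ' y)
  obtain ⟨g, hg, hlim⟩ := φ.exists_niceStrip_tendsto (θ := θ') (by linarith) (by linarith) ℓ hℓ
  have h2 := (hlim y).norm
  rw [hy] at h2
  have h3 : ‖((‖φ.ofAlgebra θ' y‖ : ℝ) : ℂ)‖ = ‖φ.ofAlgebra θ' y‖ := by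
    rw [Complex.norm_real, norm_norm]
  rw [← h3]
  refine le_of_tendsto h2 (.of_forall fun n => ?_)
  have h4 : (1 : ℂ) - ((θ' : ℝ) : ℂ) = ((θ : ℝ) : ℂ) := by rw [hθ]; push_cast; ring
  rw [h4, apply_toPredual_comm, ← φ.val_ofAlgebra θ, ← pairing_apply]
  refine ((φ.pairing θ y).le_opNorm _).trans (mul_le_of_le_one_right (norm_nonneg _) ?_)
  exact (hg n).norm_ofAlgebra_le θ

theorem inner_toPreHilbert (x y : M) :
    inner ℂ (φ.toPreHilbert x) (φ.toPreHilbert y) = φ.toDual (star x * y) := rfl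

theorem norm_toPreHilbert_sq (x : M) :
    ((‖φ.toPreHilbert x‖ ^ 2 : ℝ) : ℂ) = φ.toDual (star x * x) := by
  have h := inner_self_eq_norm_sq_to_K (𝕜 := ℂ) (φ.toPreHilbert x)
  rw [Complex.ofReal_pow]
  exact h.symm

theorem norm_toPreHilbert_star (x : M) : ‖φ.toPreHilbert (star x)‖ = ‖φ.toPreHilbert x‖ := by
  have h1 := φ.norm_toPreHilbert_sq (star x)
  rw [star_star, mul_comm, ← φ.norm_toPreHilbert_sq] at h1
  have h2 : ‖φ.toPreHilbert (star x)‖ ^ 2 = ‖φ.toPreHilbert x‖ ^ 2 := by exact_mod_cast h1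
  exact (pow_left_inj₀ (norm_nonneg _) (norm_nonneg _) two_ne_zero).mp h2

theorem norm_toPreHilbert_le (x : M) : ‖φ.toPreHilbert x‖ ≤ ‖x‖ := by
  refine le_of_sq_le_sq ?_ (norm_nonneg x)
  have h1 := congrArg norm (φ.norm_toPreHilbert_sq x)
  rw [Complex.norm_real, Real.norm_of_nonneg (by positivity)] at h1
  rw [h1]
  refine (φ.norm_toDual_le _).trans ((JBStarAlgebra.norm_mul_le' _ _).trans (le_of_eq ?_))
  rw [JBStarAlgebra.norm_star', sq]

theorem norm_apply_toPredual_le_toPreHilbert (x y : M) :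
    ‖e y (φ.toPredual x)‖ ≤ ‖φ.toPreHilbert x‖ * ‖φ.toPreHilbert y‖ := by
  have h : e y (φ.toPredual x) = inner ℂ (φ.toPreHilbert (star x)) (φ.toPreHilbert y) := by
    rw [inner_toPreHilbert, star_star, apply_toPredual]
  rw [h, ← norm_toPreHilbert_star φ x]
  exact norm_inner_le_norm _ _

theorem norm_toPredual_star_le (x : M) : ‖φ.toPredual (star x)‖ ≤ ‖φ.toPredual x‖ := by
  refine norm_le_of_forall_apply_le (e := e) (norm_nonneg _) fun y => ?_
  have h : e y (φ.toPredual (star x)) = (starRingEnd ℂ) (e (star y) (φ.toPredual x)) := by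
    rw [apply_toPredual, apply_toPredual, ← map_star_mul_star, star_star]
  rw [h, Complex.norm_conj, mul_comm, ← JBStarAlgebra.norm_star' y, ← e.norm_map]
  exact (e (star y)).le_opNorm _

variable {φ} in
/-- The adjoint of a strip function. -/
theorem NiceStrip.star {g : ℂ → M} {C : ℝ} (hg : φ.NiceStrip g C) :
    φ.NiceStrip (fun z => star (g (star z))) C where
  diff := by
    have hre : ∀ z : ℂ, (Star.star z).re = z.re := fun z => by simp
    refine ⟨fun z hz => ?_, ?_⟩
    · have hz' : Star.star z ∈ strip := by rw [mem_strip, hre]; exact hz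
      have h := (hg.diff.differentiableAt isOpen_strip hz').star_star
      rw [star_star] at h
      exact h.differentiableWithinAt
    · rw [closure_strip]
      refine continuous_star.comp_continuousOn (hg.continuousOn.comp
        continuous_star.continuousOn fun z hz => ?_)
      rw [mem_closedStrip, hre]
      exact hz
  bdd := by
    obtain ⟨K, hK⟩ := hg.bdd
    refine ⟨K, fun z hz => ?_⟩
    rw [norm_star]
    refine hK _ ?_
    rw [mem_closedStrip] at hz ⊢
    simpa using hz
  norm_left t := by
    have := hg.norm_left (-t)
    rw [norm_star]
    simpa using this
  norm_right t := by
    have := hg.norm_right (-t)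
    refine (φ.norm_toPredual_star_le _).trans ?_
    simpa using this

/-- The midpoint of the interval `[0, 1]`. -/
def midpoint : Set.Icc (0 : ℝ) 1 := ⟨1 / 2, by norm_num, by norm_num⟩

theorem coe_midpoint : ((midpoint : ℝ) : ℂ) = 1 / 2 := by
  simp [midpoint]

-- Pairing g with its adjoint strip function gives at z = 1/2 the quantity φ(g* ∘ g), which the
-- three lines theorem bounds by C².
variable {φ} in
theorem NiceStrip.norm_toPreHilbert_le {g : ℂ → M} {C : ℝ} (hg : φ.NiceStrip g C) :
    ‖φ.toPreHilbert (g (1 / 2))‖ ≤ C := by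
  obtain ⟨p1, p2, p3, p4⟩ := φ.norm_pairing_le hg.star.bddStrip hg
  have h := norm_le_of_strip p1 p2 p3 p4 (z := 1 / 2) (by
    rw [mem_closedStrip]; constructor <;> norm_num)
  have hC : 0 ≤ C := (norm_nonneg _).trans (hg.norm_left 0)
  have h2 : (1 : ℂ) - 1 / 2 = 1 / 2 := by norm_num
  have h3 : Star.star (1 / 2 : ℂ) = 1 / 2 := by simp
  simp only [h2, h3] at h
  rw [apply_toPredual, ← norm_toPreHilbert_sq, Complex.norm_real,
    Real.norm_of_nonneg (by positivity), ← sq] at h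
  exact le_of_sq_le_sq h hC

/-- For ≤, a norming functional is a limit of elements g_n(1/2) in the unit ball of H_φ, and
Cauchy–Schwarz applies. For ≥, x is approximated by a value g(1/2) whose Hilbert norm is controlled,
and both are paired with x*. -/
theorem norm_ofAlgebra_midpoint (x : M) :
    ‖φ.ofAlgebra midpoint x‖ = ‖φ.toPreHilbert x‖ := by
  have hhalf : ((midpoint : ℝ)) = 1 - midpoint := by norm_num [midpoint]
  refine le_antisymm ?_ ?_
  · obtain ⟨ℓ, hℓ, hy⟩ := exists_dual_vector'' ℂ (φ.ofAlgebra midpoint x)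
    obtain ⟨g, hg, hlim⟩ := φ.exists_niceStrip_tendsto (θ := midpoint) (by norm_num [midpoint])
      (by norm_num [midpoint]) ℓ hℓ
    have h2 := (hlim x).norm
    rw [hy] at h2
    have h3 : ‖((‖φ.ofAlgebra midpoint x‖ : ℝ) : ℂ)‖ = ‖φ.ofAlgebra midpoint x‖ := by
      rw [Complex.norm_real, norm_norm]
    rw [← h3]
    refine le_of_tendsto h2 (.of_forall fun n => ?_)
    have h4 : (1 : ℂ) - ((midpoint : ℝ) : ℂ) = 1 / 2 := by rw [coe_midpoint]; norm_num
    rw [h4]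
    exact (φ.norm_apply_toPredual_le_toPreHilbert _ _).trans
      (mul_le_of_le_one_right (norm_nonneg _) (hg n).norm_toPreHilbert_le)
  · have key : ∀ ε : ℝ, 0 < ε → ‖φ.toPreHilbert x‖ ^ 2 ≤
        ‖φ.toPreHilbert x‖ * (‖φ.ofAlgebra midpoint x‖ + ε) + ‖x‖ * ε := by
      intro ε hε
      obtain ⟨g, hg, hd⟩ := φ.exists_niceStrip (φ.ofAlgebra midpoint x)
        (lt_add_of_pos_right _ hε) hε
      have h1 : ((‖φ.toPreHilbert x‖ ^ 2 : ℝ) : ℂ) =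
          e (star x) (φ.toPredual (g (1 / 2))) + e (star x) (φ.toPredual (x - g (1 / 2))) := by
        rw [norm_toPreHilbert_sq, ← map_add, ← map_add, add_sub_cancel, apply_toPredual,
          mul_comm]
      have h2 := congrArg norm h1
      rw [Complex.norm_real, Real.norm_of_nonneg (by positivity)] at h2
      rw [h2]
      refine (norm_add_le _ _).trans (add_le_add ?_ ?_)
      · refine (φ.norm_apply_toPredual_le_toPreHilbert _ _).trans ?_
        rw [norm_toPreHilbert_star, mul_comm]
        exact mul_le_mul_of_nonneg_left hg.norm_toPreHilbert_le (norm_nonneg _)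
      · refine ((e (star x)).le_opNorm _).trans ?_
        rw [e.norm_map, JBStarAlgebra.norm_star']
        refine mul_le_mul_of_nonneg_left ?_ (norm_nonneg _)
        rw [coe_midpoint, ← map_sub] at hd
        rw [← φ.val_ofAlgebra midpoint]
        exact (φ.norm_val_le _).trans hd
    have hlim : Tendsto (fun ε : ℝ => ‖φ.toPreHilbert x‖ * (‖φ.ofAlgebra midpoint x‖ + ε) +
        ‖x‖ * ε) (𝓝[>] 0) (𝓝 (‖φ.toPreHilbert x‖ * (‖φ.ofAlgebra midpoint x‖ + 0) +
        ‖x‖ * 0)) :=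
      (by fun_prop : Continuous fun ε : ℝ => ‖φ.toPreHilbert x‖ *
        (‖φ.ofAlgebra midpoint x‖ + ε) + ‖x‖ * ε).continuousAt.tendsto.mono_left
        nhdsWithin_le_nhds
    have h5 : ‖φ.toPreHilbert x‖ ^ 2 ≤ ‖φ.toPreHilbert x‖ * (‖φ.ofAlgebra midpoint x‖ + 0) +
        ‖x‖ * 0 := by
      refine ge_of_tendsto hlim ?_
      filter_upwards [self_mem_nhdsWithin] with ε hε using key ε hε
    rw [add_zero, mul_zero, add_zero, sq] at h5
    rcases (norm_nonneg (φ.toPreHilbert x)).eq_or_lt with h6 | h6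
    · rw [← h6]; exact norm_nonneg _
    · exact le_of_mul_le_mul_left h5 h6

variable {φ} in
theorem BddStrip.tsum {F : ℕ → ℂ → P} {u : ℕ → ℝ → M} {C : ℕ → ℝ}
    (hF : ∀ i, φ.BddStrip (F i) (u i) (C i)) (hC : Summable C) :
    φ.BddStrip (fun z => ∑' i, F i z) (fun t => ∑' i, u i t) (∑' i, C i) where
  diff := ⟨Complex.differentiableOn_tsum_of_summable_norm hC (fun i => (hF i).diff.differentiableOn)
      isOpen_strip fun i z hz => (hF i).norm_le (strip_subset_closedStrip hz), by
    rw [closure_strip]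
    exact continuousOn_tsum (fun i => (hF i).continuousOn) hC fun i z hz => (hF i).norm_le hz⟩
  bdd := ⟨∑' i, C i, fun z hz => tsum_of_norm_bounded hC.hasSum fun i => (hF i).norm_le hz⟩
  cont := continuous_tsum (fun i => (hF i).cont) hC fun i t => (hF i).norm_left t
  left t := by
    have hs : Summable fun i => u i t :=
      Summable.of_norm_bounded hC fun i => (hF i).norm_left t
    rw [φ.toPredual.map_tsum hs]
    exact tsum_congr fun i => (hF i).left t
  norm_left t := tsum_of_norm_bounded hC.hasSum fun i => (hF i).norm_left t
  norm_right t := tsum_of_norm_bounded hC.hasSum fun i => (hF i).norm_right t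

/-- An absolutely convergent series lifts to strip functions with summable bounds, since each lift
costs only an extra 2^{-i}. The tails of the summed lifts bound the error. -/
instance completeSpace_interpolation : CompleteSpace (φ.couple.Interpolation θ) := by
  refine NormedAddCommGroup.completeSpace_of_summable_imp_tendsto fun h hs => ?_
  have hex : ∀ i, ∃ F u, φ.BddStrip F u (‖h i‖ + (1 / 2) ^ i) ∧ F (θ : ℝ) = φ.val (h i) :=
    fun i => by
      obtain ⟨F, u, hF, hv, -, -⟩ := φ.exists_bddStrip (h i) (lt_add_of_pos_right ‖h i‖
        (by positivity : (0 : ℝ) < (1 / 2) ^ i))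
      exact ⟨F, u, hF, hv⟩
  choose F u hF hv using hex
  have hC : Summable fun i => ‖h i‖ + (1 / 2 : ℝ) ^ i := hs.add summable_geometric_two
  obtain ⟨a, ha, -⟩ := BddStrip.exists_val φ (BddStrip.tsum hF hC) θ
  have hθ : ((θ : ℝ) : ℂ) ∈ closedStrip := ⟨θ.2.1, θ.2.2⟩
  refine ⟨a, ?_⟩
  rw [tendsto_iff_norm_sub_tendsto_zero]
  refine squeeze_zero (fun _ => norm_nonneg _) (fun n => ?_)
    (tendsto_sum_nat_add fun i => ‖h i‖ + (1 / 2 : ℝ) ^ i)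
  rw [norm_sub_rev]
  refine BddStrip.norm_le_of_val_eq φ (BddStrip.tsum (fun i => hF (i + n))
    ((summable_nat_add_iff n).mpr hC)) ?_
  have hsum : Summable fun i => F i (θ : ℝ) :=
    Summable.of_norm_bounded hC fun i => (hF i).norm_le hθ
  rw [map_sub, ha, map_sum, ← hsum.sum_add_tsum_nat_add n]
  simp_rw [hv]
  rw [add_sub_cancel_left]

/-- The linear map `M → H_φ`. -/
def toHilbertLM : M →ₗ[ℂ] φ.HilbertCompletion :=
  (UniformSpace.Completion.toComplL (𝕜 := ℂ) (E := φ.PreHilbert)).toLinearMap ∘ₗ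
    φ.toPreHilbert.toLinearMap

theorem norm_toHilbert (x : M) : ‖φ.toHilbert x‖ = ‖φ.toPreHilbert x‖ :=
  UniformSpace.Completion.norm_coe _

theorem denseRange_toHilbert : DenseRange φ.toHilbert :=
  UniformSpace.Completion.denseRange_coe (α := φ.PreHilbert)

/-- The isometry of the interpolation space at `1 / 2` onto the Hilbert space `H_φ`. -/
theorem exists_hilbert_isometry : ∃ U : φ.couple.Interpolation midpoint ≃ₗᵢ[ℂ]
    φ.HilbertCompletion, ∀ x, U (φ.ofAlgebra midpoint x) = φ.toHilbert x :=
  ⟨(LinearEquiv.refl ℂ M).extendOfIsometry (φ.ofAlgebra midpoint) φ.toHilbertLM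
    (φ.denseRange_ofAlgebra _) φ.denseRange_toHilbert fun x => by
      rw [norm_ofAlgebra_midpoint, ← norm_toHilbert]; rfl,
    fun x => LinearEquiv.extendOfIsometry_eq _ _ _ _ _ _ x⟩

end NormalFaithfulState

/-! ### Density of the algebra in the dual -/

/-- For a function `Q ≥ 0` satisfying the parallelogram inequality on a convex set, every sequence
has convex combinations of its tails that are Cauchy for `Q`. -/
theorem exists_convexHull_cauchy {V : Type*} [AddCommGroup V] [Module ℝ V] {Q : V → ℝ}
    {S : Set V} (hS : Convex ℝ S) (hQ : ∀ v, 0 ≤ Q v) {B : ℝ} (hB : ∀ v ∈ S, Q v ≤ B)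
    (hpar : ∀ v ∈ S, ∀ w ∈ S,
      Q (v - w) ≤ 2 * Q v + 2 * Q w - 4 * Q ((1 / 2 : ℝ) • v + (1 / 2 : ℝ) • w))
    {g : ℕ → V} (hg : ∀ n, g n ∈ S) :
    ∃ k : ℕ → V, (∀ n, k n ∈ convexHull ℝ (g '' Set.Ici n)) ∧
      ∀ ε > 0, ∃ N, ∀ m ≥ N, ∀ n ≥ N, Q (k m - k n) ≤ ε := by
  set A : ℕ → Set V := fun n => convexHull ℝ (g '' Set.Ici n) with hA
  have hAS : ∀ n, A n ⊆ S := fun n =>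
    convexHull_min (by rintro _ ⟨m, -, rfl⟩; exact hg m) hS
  have hanti : ∀ {m n}, m ≤ n → A n ⊆ A m := fun h =>
    convexHull_mono (Set.image_mono (Set.Ici_subset_Ici.mpr h))
  have hne : ∀ n, (Q '' A n).Nonempty := fun n =>
    ⟨_, g n, subset_convexHull ℝ _ ⟨n, le_refl n, rfl⟩, rfl⟩
  have hbdd : ∀ n, BddBelow (Q '' A n) := fun n => ⟨0, by rintro _ ⟨v, -, rfl⟩; exact hQ v⟩
  -- The infima over the hulls of the tails increase to a finite limit. Two near-minimizers from
  -- late tails have their midpoint in an earlier hull, where Q is not much smaller, so the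
  -- parallelogram inequality makes them close.
  set d : ℕ → ℝ := fun n => sInf (Q '' A n) with hd
  have hmono : Monotone d := fun m n h =>
    csInf_le_csInf (hbdd m) (hne n) (Set.image_mono (hanti h))
  have hdle : ∀ n, ∀ v ∈ A n, d n ≤ Q v := fun n v hv => csInf_le (hbdd n) ⟨v, hv, rfl⟩
  have hdB : BddAbove (Set.range d) := by
    refine ⟨B, ?_⟩
    rintro _ ⟨n, rfl⟩
    have h := subset_convexHull ℝ (g '' Set.Ici n) ⟨n, le_refl n, rfl⟩
    exact (hdle n _ h).trans (hB _ (hg n))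
  have hk : ∀ n : ℕ, ∃ v ∈ A n, Q v < d n + 1 / ((n : ℝ) + 1) := fun n => by
    obtain ⟨_, ⟨v, hv, rfl⟩, h⟩ := exists_lt_of_csInf_lt (hne n)
      (lt_add_of_pos_right (d n) (Nat.one_div_pos_of_nat (α := ℝ) (n := n)))
    exact ⟨v, hv, h⟩
  choose k hkA hkQ using hk
  refine ⟨k, hkA, fun ε hε => ?_⟩
  have hlim : Tendsto (fun N : ℕ => 4 * ((⨆ n, d n) - d N) + 4 * (1 / ((N : ℝ) + 1))) atTop
      (𝓝 (4 * ((⨆ n, d n) - ⨆ n, d n) + 4 * 0)) :=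
    (((tendsto_const_nhds.sub (tendsto_atTop_ciSup hmono hdB)).const_mul 4).add
      ((tendsto_one_div_add_atTop_nhds_zero_nat (𝕜 := ℝ)).const_mul 4))
  rw [sub_self, mul_zero, add_zero] at hlim
  obtain ⟨N, hN⟩ := (hlim.eventually_lt_const hε).exists
  refine ⟨N, fun m hm n hn => ?_⟩
  have hsmall : ∀ i ≥ N, Q (k i) ≤ (⨆ n, d n) + 1 / ((N : ℝ) + 1) := fun i hi =>
    (hkQ i).le.trans (add_le_add (le_ciSup hdB i) (Nat.one_div_le_one_div hi))
  have hmid : d N ≤ Q ((1 / 2 : ℝ) • k m + (1 / 2 : ℝ) • k n) :=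
    hdle N _ (convex_convexHull ℝ _ (hanti hm (hkA m)) (hanti hn (hkA n)) (by norm_num)
      (by norm_num) (by norm_num))
  have h1 := hpar _ (hAS m (hkA m)) _ (hAS n (hkA n))
  linarith [hsmall m hm, hsmall n hn]

/-- The substitution w ↦ 1/2 + cw carries the line Re w = 0 into the line Re z = 1/2 and Re w = 1
into a line on the side given by the sign of c. It covers θ on either side of 1/2 at once. -/
theorem half_add_mul_mem_strip {c : ℝ} (hc : |c| ≤ 1 / 2) {w : ℂ} (hw : w ∈ strip) :
    1 / 2 + c * w ∈ strip := by
  rw [mem_strip] at hw ⊢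
  have h := abs_le.mp hc
  have hre : (1 / 2 + (c : ℂ) * w).re = 1 / 2 + c * w.re := by simp
  rw [hre]
  constructor <;> nlinarith [hw.1, hw.2]

theorem half_add_mul_mem_closedStrip {c : ℝ} (hc : |c| ≤ 1 / 2) {w : ℂ} (hw : w ∈ closedStrip) :
    1 / 2 + c * w ∈ closedStrip := by
  rw [mem_closedStrip] at hw ⊢
  have h := abs_le.mp hc
  have hre : (1 / 2 + (c : ℂ) * w).re = 1 / 2 + c * w.re := by simp
  rw [hre]
  constructor <;> nlinarith [hw.1, hw.2]

theorem half_sub_mul_I_mem_closedStrip (c t : ℝ) :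
    (1 / 2 - c * (t * Complex.I) : ℂ) ∈ closedStrip := by
  rw [mem_closedStrip]
  constructor <;> (simp; try norm_num)

namespace NormalFaithfulState

variable {M P : Type*} [JBStarAlgebra M] [NormedAddCommGroup P] [NormedSpace ℂ P]
  [CompleteSpace P] {e : M ≃ₗᵢ[ℂ] StrongDual ℂ P} (φ : NormalFaithfulState e)
  {θ : Set.Icc (0 : ℝ) 1}

variable {φ} in
theorem NiceStrip.add {g g' : ℂ → M} {C C' : ℝ} (hg : φ.NiceStrip g C) (hg' : φ.NiceStrip g' C') :
    φ.NiceStrip (g + g') (C + C') where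
  diff := hg.diff.add hg'.diff
  bdd := by
    obtain ⟨K, hK⟩ := hg.bdd
    obtain ⟨K', hK'⟩ := hg'.bdd
    exact ⟨K + K', fun z hz => (norm_add_le _ _).trans (add_le_add (hK z hz) (hK' z hz))⟩
  norm_left t := (norm_add_le _ _).trans (add_le_add (hg.norm_left t) (hg'.norm_left t))
  norm_right t := by
    rw [Pi.add_apply, map_add]
    exact (norm_add_le _ _).trans (add_le_add (hg.norm_right t) (hg'.norm_right t))

variable {φ} in
theorem NiceStrip.smul {g : ℂ → M} {C : ℝ} (hg : φ.NiceStrip g C) (a : ℝ) :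
    φ.NiceStrip (a • g) (|a| * C) where
  diff := hg.diff.const_smul a
  bdd := by
    obtain ⟨K, hK⟩ := hg.bdd
    refine ⟨|a| * K, fun z hz => ?_⟩
    rw [Pi.smul_apply, norm_smul, Real.norm_eq_abs]
    exact mul_le_mul_of_nonneg_left (hK z hz) (abs_nonneg a)
  norm_left t := by
    rw [Pi.smul_apply, norm_smul, Real.norm_eq_abs]
    exact mul_le_mul_of_nonneg_left (hg.norm_left t) (abs_nonneg a)
  norm_right t := by
    rw [Pi.smul_apply, ← Complex.coe_smul, map_smul, Complex.coe_smul, norm_smul, Real.norm_eq_abs]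
    exact mul_le_mul_of_nonneg_left (hg.norm_right t) (abs_nonneg a)

theorem convex_niceStrip (C : ℝ) : Convex ℝ {g | φ.NiceStrip g C} := by
  intro g hg g' hg' a b ha hb hab
  have h := (NiceStrip.smul hg a).add (NiceStrip.smul hg' b)
  rwa [abs_of_nonneg ha, abs_of_nonneg hb, ← add_mul, hab, one_mul] at h

variable {φ} in
theorem NiceStrip.sub {g g' : ℂ → M} {C C' : ℝ} (hg : φ.NiceStrip g C) (hg' : φ.NiceStrip g' C') :
    φ.NiceStrip (g - g') (C + C') := by
  have h := hg.add (hg'.smul (-1))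
  rwa [neg_one_smul, ← sub_eq_add_neg, abs_neg, abs_one, one_mul] at h

variable {φ} in
theorem BddStrip.translate {F : ℂ → P} {u : ℝ → M} {C : ℝ} (hF : φ.BddStrip F u C) (s : ℝ) :
    φ.BddStrip (fun z => F (z + s * Complex.I)) (fun t => u (t + s)) C where
  diff := by
    refine hF.diff.comp (g := fun z => z + s * Complex.I)
      (Differentiable.diffContOnCl (by fun_prop)) fun z hz => ?_
    rw [mem_strip] at hz ⊢
    simpa using hz
  bdd := by
    obtain ⟨K, hK⟩ := hF.bdd
    refine ⟨K, fun z hz => hK _ ?_⟩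
    rw [mem_closedStrip] at hz ⊢
    simpa using hz
  cont := hF.cont.comp (by fun_prop)
  left t := by
    rw [← hF.left, Complex.ofReal_add, add_mul]
  norm_left t := hF.norm_left _
  norm_right t := by
    have h := hF.norm_right (t + s)
    rwa [Complex.ofReal_add, add_mul, ← add_assoc] at h

-- A vertical translate of F is again a strip function with the same bound, so every value on Re z =
-- 1/2 has norm at most C in the midpoint space, which is the Hilbert space.
variable {φ} in
theorem BddStrip.norm_apply_half_le {F : ℂ → P} {u : ℝ → M} {C : ℝ} (hF : φ.BddStrip F u C)
    (s : ℝ) (y : M) : ‖e y (F (1 / 2 + s * Complex.I))‖ ≤ C * ‖φ.toPreHilbert y‖ := by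
  obtain ⟨h, hv, hn⟩ := BddStrip.exists_val φ (hF.translate s) midpoint
  rw [coe_midpoint] at hv
  rw [← hv]
  refine (φ.norm_apply_val_le (θ' := midpoint) (by norm_num [midpoint]) h y).trans ?_
  rw [norm_ofAlgebra_midpoint]
  exact mul_le_mul_of_nonneg_right hn (norm_nonneg _)

/-- The weighted quadratic mean of the Hilbert space norm on the line `Re z = 1 / 2`. -/
def midEnergy (τ c : ℝ) (k : ℂ → M) : ℝ :=
  ∫ t : ℝ, pois (1 - τ) t * ‖φ.toPreHilbert (k (1 / 2 - c * (t * Complex.I)))‖ ^ 2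

variable {τ c : ℝ}

theorem midEnergy_nonneg (h0 : 0 < τ) (h1 : τ < 1) (k : ℂ → M) : 0 ≤ φ.midEnergy τ c k :=
  integral_nonneg fun t => mul_nonneg (pois_pos (by linarith) (by linarith) t).le (sq_nonneg _)

theorem continuous_toPreHilbert : Continuous φ.toPreHilbert :=
  AddMonoidHomClass.continuous_of_bound φ.toPreHilbert 1 fun x => by
    simpa using φ.norm_toPreHilbert_le x

variable {φ} in
theorem NiceStrip.norm_toPreHilbert_midline_le {k : ℂ → M} {C : ℝ} (hk : φ.NiceStrip k C)
    (c t : ℝ) : ‖φ.toPreHilbert (k (1 / 2 - c * (t * Complex.I)))‖ ≤ C := by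
  rw [← norm_ofAlgebra_midpoint]
  refine BddStrip.norm_le_of_val_eq φ (hk.bddStrip.translate (-(c * t))) ?_
  rw [φ.val_ofAlgebra, coe_midpoint]
  congr 2
  push_cast
  ring

variable {φ} in
theorem NiceStrip.integrable_midEnergy (h0 : 0 < τ) (h1 : τ < 1) {k : ℂ → M} {C : ℝ}
    (hk : φ.NiceStrip k C) : Integrable fun t : ℝ =>
      pois (1 - τ) t * ‖φ.toPreHilbert (k (1 / 2 - c * (t * Complex.I)))‖ ^ 2 := by
  have hcont : Continuous fun t : ℝ => φ.toPreHilbert (k (1 / 2 - c * (t * Complex.I))) :=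
    φ.continuous_toPreHilbert.comp (hk.continuousOn.comp_continuous (by fun_prop)
      (half_sub_mul_I_mem_closedStrip c))
  obtain ⟨K, hK⟩ := hk.bdd
  refine integrable_pois_mul (by linarith) (by linarith) (hcont.norm.pow 2) (K := K ^ 2)
    fun t => ?_
  rw [norm_pow, norm_norm]
  exact pow_le_pow_left₀ (norm_nonneg _) ((φ.norm_toPreHilbert_le _).trans
    (hK _ (half_sub_mul_I_mem_closedStrip c t))) 2

theorem midEnergy_sub (h0 : 0 < τ) (h1 : τ < 1) {k k' : ℂ → M} {C : ℝ}
    (hk : φ.NiceStrip k C) (hk' : φ.NiceStrip k' C) :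
    φ.midEnergy τ c (k - k') = 2 * φ.midEnergy τ c k + 2 * φ.midEnergy τ c k' -
      4 * φ.midEnergy τ c ((1 / 2 : ℝ) • k + (1 / 2 : ℝ) • k') := by
  have hm := (hk.smul (1 / 2)).add (hk'.smul (1 / 2))
  unfold midEnergy
  rw [← integral_const_mul, ← integral_const_mul, ← integral_const_mul, ← integral_add,
    ← integral_sub]
  · congr 1 with t
    generalize 1 / 2 - (c : ℂ) * (t * Complex.I) = z
    have h := parallelogram_law_with_norm ℂ (φ.toPreHilbert (k z)) (φ.toPreHilbert (k' z))
    have h2 : φ.toPreHilbert (((1 / 2 : ℝ) • k + (1 / 2 : ℝ) • k') z) =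
        (1 / 2 : ℂ) • (φ.toPreHilbert (k z) + φ.toPreHilbert (k' z)) := by
      rw [← map_add, ← map_smul, smul_add, Pi.add_apply, Pi.smul_apply, Pi.smul_apply,
        ← Complex.coe_smul, ← Complex.coe_smul]
      norm_num
    have h3 : φ.toPreHilbert ((k - k') z) = φ.toPreHilbert (k z) - φ.toPreHilbert (k' z) := by
      rw [← map_sub, Pi.sub_apply]
    rw [h2, h3, norm_smul]
    norm_num
    linear_combination (pois (1 - τ) t) * h
  · exact ((hk.integrable_midEnergy h0 h1).const_mul 2).add
      ((hk'.integrable_midEnergy h0 h1).const_mul 2)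
  · exact (hm.integrable_midEnergy h0 h1).const_mul 4
  · exact (hk.integrable_midEnergy h0 h1).const_mul 2
  · exact (hk'.integrable_midEnergy h0 h1).const_mul 2

variable {φ} in
theorem NiceStrip.midEnergy_le (h0 : 0 < τ) (h1 : τ < 1) {k : ℂ → M} {C : ℝ}
    (hk : φ.NiceStrip k C) : φ.midEnergy τ c k ≤ (1 - τ) * C ^ 2 := by
  rw [← integral_pois (c := 1 - τ) (by linarith) (by linarith), ← integral_mul_const]
  refine integral_mono (hk.integrable_midEnergy h0 h1)
    ((integrable_pois (by linarith) (by linarith)).mul_const _) fun t => ?_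
  exact mul_le_mul_of_nonneg_left (pow_le_pow_left₀ (norm_nonneg _)
    (hk.norm_toPreHilbert_midline_le c t) 2) (pois_pos (by linarith) (by linarith) t).le

/-- The pairing of two strip functions at a point is controlled by the Hilbert space norm of one of
them on the line `Re z = 1 / 2`. -/
theorem norm_pairing_le_midEnergy (h0 : 0 < τ) (h1 : τ < 1) (hc : |c| ≤ 1 / 2) {F : ℂ → P}
    {u : ℝ → M} {C C' : ℝ} (hF : φ.BddStrip F u C) {k : ℂ → M} (hk : φ.NiceStrip k C') (a : ℝ)
    {δ : ℝ} (hδ : 0 < δ) :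
    ‖e (k (1 - (1 / 2 + c * τ))) (F (1 / 2 + c * τ))‖ ≤ C * (Real.exp (a * τ) *
      ((1 - τ) * δ + φ.midEnergy τ c k / δ) / 2 + Real.exp (a * (τ - 1)) * C' * τ) := by
  have hC := hF.nonneg
  have q0 : 0 < 1 - τ := by linarith
  have q1 : 1 - τ < 1 := by linarith
  obtain ⟨p1, ⟨K, hK⟩, p3, p4⟩ := φ.norm_pairing_le hF hk
  set b : ℂ → ℂ := fun z => e (k (1 - z)) (F z) with hb
  have hbC : ∀ z ∈ closedStrip, ‖b z‖ ≤ C * C' := fun z hz =>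
    norm_le_of_strip p1 ⟨K, hK⟩ p3 p4 hz
  have hCC : 0 ≤ C * C' := (norm_nonneg _).trans (p3 0)
  have hnexp : ∀ w : ℂ, ‖Complex.exp (a * (τ - w))‖ = Real.exp (a * (τ - w.re)) := fun w => by
    rw [Complex.norm_exp]; simp
  -- The exponential is 1 at w = τ. The free parameter a shifts weight between the two lines, as in
  -- the proof of the three lines theorem.
  have hd : DiffContOnCl ℂ (fun w : ℂ => Complex.exp (a * (τ - w)) * b (1 / 2 + c * w)) strip := by
    refine DiffContOnCl.smul (f := fun w : ℂ => b (1 / 2 + c * w))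
      (c := fun w : ℂ => Complex.exp (a * (τ - w))) (Differentiable.diffContOnCl (by fun_prop)) ?_
    exact p1.comp (g := fun w : ℂ => 1 / 2 + c * w) (Differentiable.diffContOnCl (by fun_prop))
      fun w hw => half_add_mul_mem_strip hc hw
  have hbdd : ∃ K, ∀ w ∈ closedStrip,
      ‖Complex.exp (a * (τ - w)) * b (1 / 2 + c * w)‖ ≤ K := by
    refine ⟨Real.exp (|a| * (|τ| + 1)) * (C * C'), fun w hw => ?_⟩
    rw [norm_mul, hnexp]
    refine mul_le_mul (Real.exp_le_exp.mpr ?_) (hbC _ (half_add_mul_mem_closedStrip hc hw))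
      (norm_nonneg _) (Real.exp_pos _).le
    refine (le_abs_self _).trans ?_
    rw [abs_mul]
    refine mul_le_mul_of_nonneg_left ?_ (abs_nonneg a)
    rw [mem_closedStrip] at hw
    refine (abs_sub _ _).trans (add_le_add le_rfl ?_)
    rw [abs_of_nonneg hw.1]
    exact hw.2
  have hform := poisson_formula h0 h1 hd hbdd
  rw [sub_self, mul_zero, Complex.exp_zero, one_mul] at hform
  rw [show e (k (1 - (1 / 2 + c * τ))) (F (1 / 2 + c * τ)) = b (1 / 2 + c * τ) from rfl, hform,
    mul_add]
  refine (norm_add_le _ _).trans (add_le_add ?_ ?_)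
  · have hInt := hk.integrable_midEnergy (c := c) h0 h1
    have hInt2 := ((integrable_pois q0 q1).mul_const δ).add (hInt.div_const δ)
    have hval : C * (Real.exp (a * τ) * ((1 - τ) * δ + φ.midEnergy τ c k / δ) / 2) =
        ∫ t : ℝ, C * Real.exp (a * τ) / 2 * (pois (1 - τ) t * δ + pois (1 - τ) t *
          ‖φ.toPreHilbert (k (1 / 2 - c * (t * Complex.I)))‖ ^ 2 / δ) := by
      rw [integral_const_mul, integral_add ((integrable_pois q0 q1).mul_const δ)
        (hInt.div_const δ), integral_mul_const, integral_div, integral_pois q0 q1]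
      unfold midEnergy
      ring
    rw [hval]
    refine norm_integral_le_of_norm_le (hInt2.const_mul _) (.of_forall fun t => ?_)
    have hpos := pois_pos q0 q1 t
    rw [norm_smul, norm_mul, hnexp, Real.norm_of_nonneg hpos.le]
    have hline : (1 / 2 + (c : ℂ) * (t * Complex.I)) = 1 / 2 + ((c * t : ℝ) : ℂ) * Complex.I := by
      push_cast; ring
    have hline2 : 1 - (1 / 2 + ((c * t : ℝ) : ℂ) * Complex.I) =
        1 / 2 - c * (t * Complex.I) := by
      push_cast; ring
    have h2 := hF.norm_apply_half_le (c * t) (k (1 - (1 / 2 + ((c * t : ℝ) : ℂ) * Complex.I)))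
    have h3 : ‖b (1 / 2 + c * (t * Complex.I))‖ ≤
        C * ‖φ.toPreHilbert (k (1 / 2 - c * (t * Complex.I)))‖ := by
      rw [hline, ← hline2]; exact h2
    set x := ‖φ.toPreHilbert (k (1 / 2 - c * (t * Complex.I)))‖ with hx
    -- The arithmetic–geometric mean inequality passes from the norm to its square, so that the
    -- quadratic mean appears.
    have h4 : x ≤ (δ + x ^ 2 / δ) / 2 := by
      have : 0 ≤ (δ - x) ^ 2 / δ := by positivity
      have h5 : (δ - x) ^ 2 / δ = δ - 2 * x + x ^ 2 / δ := by field_simp; ring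
      linarith
    have hre : ((t : ℂ) * Complex.I).re = 0 := by simp
    rw [hre, sub_zero]
    calc pois (1 - τ) t * (Real.exp (a * τ) * ‖b (1 / 2 + c * (t * Complex.I))‖)
        ≤ pois (1 - τ) t * (Real.exp (a * τ) * (C * ((δ + x ^ 2 / δ) / 2))) := by
          refine mul_le_mul_of_nonneg_left (mul_le_mul_of_nonneg_left (h3.trans
            (mul_le_mul_of_nonneg_left h4 hC)) (Real.exp_pos _).le) hpos.le
      _ = _ := by ring
  · have hval : C * (Real.exp (a * (τ - 1)) * C' * τ) =
        ∫ t : ℝ, pois τ t * (Real.exp (a * (τ - 1)) * (C * C')) := by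
      rw [integral_mul_const, integral_pois h0 h1]; ring
    rw [hval]
    refine norm_integral_le_of_norm_le ((integrable_pois h0 h1).mul_const _)
      (.of_forall fun t => ?_)
    have hpos := pois_pos h0 h1 t
    rw [norm_smul, norm_mul, hnexp, Real.norm_of_nonneg hpos.le]
    have hre : (1 + (t : ℂ) * Complex.I).re = 1 := by simp
    rw [hre]
    exact mul_le_mul_of_nonneg_left (mul_le_mul_of_nonneg_left (hbC _
      (half_add_mul_mem_closedStrip hc (one_add_mul_I_mem_closedStrip t))) (Real.exp_pos _).le)
      hpos.le

/-- First a is chosen to make the contribution of the far line at most ε/2, using only the a priori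
bound 2. Then a small energy η = δ² takes care of the middle line. -/
theorem exists_midEnergy_modulus (h0 : 0 < τ) (h1 : τ < 1) (hc : |c| ≤ 1 / 2)
    (hθ : (θ : ℝ) = 1 / 2 + c * τ) {ε : ℝ} (hε : 0 < ε) : ∃ η > 0, ∀ k : ℂ → M,
      φ.NiceStrip k 2 → φ.midEnergy τ c k ≤ η → ‖φ.pairing θ (k (1 - (θ : ℝ)))‖ ≤ ε := by
  obtain ⟨a, ha⟩ : ∃ a : ℝ, Real.exp (a * (τ - 1)) * 2 * τ ≤ ε / 2 := by
    refine ⟨Real.log (ε / 4) / (τ - 1), ?_⟩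
    rw [div_mul_cancel₀ _ (by linarith), Real.exp_log (by positivity)]
    nlinarith
  set δ := ε / 2 / Real.exp (a * τ) with hδ
  have hδ0 : 0 < δ := by positivity
  have hδ1 : Real.exp (a * τ) * δ = ε / 2 := by rw [hδ]; field_simp
  refine ⟨δ ^ 2, by positivity, fun k hk hQ => ?_⟩
  have hQ' : φ.midEnergy τ c k / δ ≤ δ := by rw [div_le_iff₀ hδ0, ← sq]; exact hQ
  have hcoef : Real.exp (a * τ) * ((1 - τ) * δ + φ.midEnergy τ c k / δ) / 2 +
      Real.exp (a * (τ - 1)) * 2 * τ ≤ ε := by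
    have h2 : (1 - τ) * δ + φ.midEnergy τ c k / δ ≤ 2 * δ := by nlinarith
    have h3 := mul_le_mul_of_nonneg_left h2 (Real.exp_pos (a * τ)).le
    linarith
  refine ContinuousLinearMap.opNorm_le_bound _ hε.le fun h => ?_
  rw [← div_le_iff₀' hε]
  refine le_of_forall_gt_imp_ge_of_dense fun C hC => ?_
  rw [div_le_iff₀' hε]
  obtain ⟨F, u, hF, hv, -, -⟩ := φ.exists_bddStrip h hC
  have h2 := φ.norm_pairing_le_midEnergy h0 h1 hc hF hk a hδ0
  have hθ' : ((θ : ℝ) : ℂ) = 1 / 2 + c * τ := by rw [hθ]; push_cast; ring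
  rw [pairing_apply, ← hv, hθ', mul_comm ε]
  exact h2.trans (mul_le_mul_of_nonneg_left hcoef hF.nonneg)

theorem mem_closure_range_pairing (h0 : 0 < (θ : ℝ)) (h1 : (θ : ℝ) < 1)
    (ℓ : StrongDual ℂ (φ.couple.Interpolation θ)) (hℓ : ‖ℓ‖ ≤ 1) :
    ℓ ∈ closure (Set.range (φ.pairing θ)) := by
  set r := |(θ : ℝ) - 1 / 2| with hr
  have hr0 : 0 ≤ r := abs_nonneg _
  have hr1 : r < 1 / 2 := by rw [hr, abs_lt]; constructor <;> linarith
  -- As r < 1/2, this gives τ < 1 and |c| = r/(1/2 + r) ≤ 1/2. For θ = 1/2 it degenerates harmlessly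
  -- to c = 0.
  set τ := 1 / 2 + r with hτ
  have t0 : 0 < τ := by positivity
  have t1 : τ < 1 := by linarith
  set c := ((θ : ℝ) - 1 / 2) / τ with hc'
  have hc : |c| ≤ 1 / 2 := by
    rw [hc', abs_div, abs_of_pos t0, ← hr, div_le_iff₀ t0]
    linarith
  have hθ : (θ : ℝ) = 1 / 2 + c * τ := by rw [hc', div_mul_cancel₀ _ t0.ne']; ring
  obtain ⟨g, hg, hlim⟩ := φ.exists_niceStrip_tendsto h0 h1 ℓ hℓ
  -- Convex combinations of tails keep the strip bound 1 and the pointwise limit ℓ, and are in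
  -- addition Cauchy in quadratic mean on Re z = 1/2.
  obtain ⟨k, hk, hcau⟩ := exists_convexHull_cauchy (φ.convex_niceStrip 1)
    (Q := φ.midEnergy τ c) (φ.midEnergy_nonneg t0 t1) (B := (1 - τ) * 1 ^ 2)
    (fun v hv => NiceStrip.midEnergy_le t0 t1 hv)
    (fun v hv w hw => (φ.midEnergy_sub t0 t1 hv hw).le) hg
  have hkN : ∀ n, φ.NiceStrip (k n) 1 := fun n =>
    convexHull_min (by rintro _ ⟨m, -, rfl⟩; exact hg m) (φ.convex_niceStrip 1) (hk n)
  have hklim : ∀ x : M, Tendsto (fun n => e (k n (1 - (θ : ℝ))) (φ.toPredual x)) atTop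
      (𝓝 (ℓ (φ.ofAlgebra θ x))) := by
    intro x
    rw [Metric.tendsto_atTop]
    intro ε hε
    obtain ⟨N, hN⟩ := Metric.tendsto_atTop.mp (hlim x) ε hε
    refine ⟨N, fun n hn => ?_⟩
    have hconv : Convex ℝ {v : ℂ → M | e (v (1 - (θ : ℝ))) (φ.toPredual x) ∈
        Metric.ball (ℓ (φ.ofAlgebra θ x)) ε} :=
      (convex_ball _ _).is_linear_preimage ⟨fun v w => by simp, fun a v => by
        rw [Pi.smul_apply, ← Complex.coe_smul, map_smul, ← Complex.coe_smul]; rfl⟩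
    refine convexHull_min ?_ hconv (hk n)
    rintro _ ⟨m, hm, rfl⟩
    exact hN m (le_trans hn hm)
  rw [Metric.mem_closure_iff]
  intro ε hε
  obtain ⟨η, hη, hmod⟩ := φ.exists_midEnergy_modulus (θ := θ) t0 t1 hc hθ (half_pos hε)
  obtain ⟨N, hN⟩ := hcau η hη
  refine ⟨_, ⟨k N (1 - (θ : ℝ)), rfl⟩, ?_⟩
  rw [dist_eq_norm]
  refine lt_of_le_of_lt (ContinuousLinearMap.opNorm_le_bound _ (half_pos hε).le fun h => ?_)
    (half_lt_self hε)
  -- On M the functional ℓ is the limit of the k_m, so its distance from k_N is bounded by that of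
  -- k_m from k_N. The difference k_m - k_N satisfies the strip bound 2 and has small energy.
  refine (φ.denseRange_ofAlgebra θ).induction_on (p := fun h =>
    ‖(ℓ - φ.pairing θ (k N (1 - (θ : ℝ)))) h‖ ≤ ε / 2 * ‖h‖) h
    (isClosed_le (by fun_prop) (by fun_prop)) fun x => ?_
  have hl : Tendsto (fun m => ‖φ.pairing θ ((k m - k N) (1 - (θ : ℝ))) (φ.ofAlgebra θ x)‖) atTop
      (𝓝 ‖(ℓ - φ.pairing θ (k N (1 - (θ : ℝ)))) (φ.ofAlgebra θ x)‖) := by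
    have h2 := ((hklim x).sub_const (e (k N (1 - (θ : ℝ))) (φ.toPredual x))).norm
    refine h2.congr' (.of_forall fun m => ?_) |>.trans_eq ?_
    · rw [Pi.sub_apply, map_sub]
      simp [pairing_apply, val_ofAlgebra]
    · simp [pairing_apply, val_ofAlgebra]
  refine le_of_tendsto hl ?_
  filter_upwards [eventually_ge_atTop N] with m hm
  refine (ContinuousLinearMap.le_opNorm _ _).trans (mul_le_mul_of_nonneg_right ?_ (norm_nonneg _))
  refine hmod _ ?_ (hN m hm N le_rfl)
  have h3 := (hkN m).sub (hkN N)
  rwa [one_add_one_eq_two] at h3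

/-- The functionals given by elements of `M` are dense in the dual of an interpolation space. -/
theorem denseRange_pairing (h0 : 0 < (θ : ℝ)) (h1 : (θ : ℝ) < 1) : DenseRange (φ.pairing θ) := by
  intro ℓ
  have hr : (0 : ℝ) < ‖ℓ‖ + 1 := by positivity
  have hne : ((‖ℓ‖ + 1 : ℝ) : ℂ) ≠ 0 := by exact_mod_cast hr.ne'
  have hn : ‖((‖ℓ‖ + 1 : ℝ) : ℂ)⁻¹ • ℓ‖ ≤ 1 := by
    rw [norm_smul, norm_inv, Complex.norm_real, Real.norm_of_nonneg hr.le, inv_mul_le_iff₀ hr]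
    linarith
  have h2 : ((‖ℓ‖ + 1 : ℝ) : ℂ)⁻¹ • ℓ ∈ (LinearMap.range (φ.pairing θ)).topologicalClosure :=
    φ.mem_closure_range_pairing h0 h1 _ hn
  have h3 := Submodule.smul_mem _ ((‖ℓ‖ + 1 : ℝ) : ℂ) h2
  rw [smul_inv_smul₀ hne] at h3
  exact h3

end NormalFaithfulState

/-! ### The duality isometry -/

namespace NormalFaithfulState

variable {M P : Type*} [JBStarAlgebra M] [NormedAddCommGroup P] [NormedSpace ℂ P]
  [CompleteSpace P] {e : M ≃ₗᵢ[ℂ] StrongDual ℂ P} (φ : NormalFaithfulState e)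
  {θ θ' : Set.Icc (0 : ℝ) 1}

theorem toSum_ofAlgebra (x : M) :
    InterpolationCouple.Interpolation.toSum (φ.ofAlgebra θ x) = φ.couple.inl x := by
  rw [← inr_val, val_ofAlgebra, inl_eq_inr]

theorem toAmbient_toSum_apply (h : φ.couple.Interpolation θ) (y : M) :
    φ.couple.toAmbient (InterpolationCouple.Interpolation.toSum h) y = e y (φ.val h) := by
  rw [← inr_val]
  change φ.couple.addMap _ y = _
  simp [InterpolationCouple.addMap, couple, predualInclusion]

/-- The duality of the interpolation spaces. -/
theorem exists_dual_isometry (h0 : 0 < (θ : ℝ)) (h1 : (θ : ℝ) < 1) (hθ : (θ' : ℝ) = 1 - θ) :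
    ∃ D : φ.couple.Interpolation θ' ≃ₗᵢ[ℂ] StrongDual ℂ (φ.couple.Interpolation θ),
      ∀ y, D (φ.ofAlgebra θ' y) = φ.pairing θ y :=
  -- The identity of M is isometric between two dense copies of M in complete spaces, so its
  -- extension is surjective.
  ⟨(LinearEquiv.refl ℂ M).extendOfIsometry (φ.ofAlgebra θ') (φ.pairing θ)
    (φ.denseRange_ofAlgebra θ') (φ.denseRange_pairing h0 h1)
    fun y => φ.norm_pairing_eq h0 h1 hθ y,
    fun y => LinearEquiv.extendOfIsometry_eq _ _ _ _ _ _ y⟩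

end NormalFaithfulState

end

theorem mainTheorem5 {M P : Type*} [JBStarAlgebra M] [NormedAddCommGroup P] [NormedSpace ℂ P]
    [CompleteSpace P] (e : M ≃ₗᵢ[ℂ] StrongDual ℂ P) (φ : NormalFaithfulState e) :
    (∃ U : φ.Lp 2 one_lt_two ≃ₗᵢ[ℂ] φ.HilbertCompletion,
      ∀ x : M, ∃ h : φ.Lp 2 one_lt_two, h.IsElement x ∧ U h = φ.toHilbert x) ∧
    ∀ (p q : ℝ) (hpq : p.HolderConjugate q),
      ∃ D : φ.Lp q hpq.symm.lt ≃ₗᵢ[ℂ] StrongDual ℂ (φ.Lp p hpq.lt),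
        ∀ y : M, ∃ k : φ.Lp q hpq.symm.lt, k.IsElement y ∧
          ∀ h : φ.Lp p hpq.lt, D k h = h.toFunctional y := by
  constructor
  · obtain ⟨U, hU⟩ := φ.exists_hilbert_isometry
    exact ⟨U, fun x => ⟨φ.ofAlgebra NormalFaithfulState.midpoint x, φ.toSum_ofAlgebra x, hU x⟩⟩
  · intro p q hpq
    have hp := hpq.lt
    have hp0 : 0 < 1 / p := one_div_pos.mpr (zero_lt_one.trans hp)
    have hp1 : 1 / p < 1 := (div_lt_one (zero_lt_one.trans hp)).mpr hp
    have hq : 1 / q = 1 - 1 / p := by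
      rw [one_div, one_div, ← hpq.inv_add_inv_eq_one]
      ring
    obtain ⟨D, hD⟩ := φ.exists_dual_isometry
      (θ := ⟨1 / p, one_div_nonneg.mpr (zero_le_one.trans hp.le),
        (div_le_one (zero_lt_one.trans hp)).mpr hp.le⟩)
      (θ' := ⟨1 / q, one_div_nonneg.mpr (zero_le_one.trans hpq.symm.lt.le),
        (div_le_one (zero_lt_one.trans hpq.symm.lt)).mpr hpq.symm.lt.le⟩) hp0 hp1 hq
    refine ⟨D, fun y => ⟨φ.ofAlgebra _ y, φ.toSum_ofAlgebra y, fun h => ?_⟩⟩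
    rw [hD, NormalFaithfulState.pairing_apply]
    exact (φ.toAmbient_toSum_apply h y).symm
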